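/- **Setting.** Let $d\in\{2,3\}$ and let $\Omega\subset\mathbb R^d$ be bounded, open and connected with Lipschitz boundary, $\partial\Omega=\overline{\Gamma_D}\cup\overline{\Gamma_V}\cup\overline{\Gamma_N}$ with $\Gamma_D,\Gamma_V,\Gamma_N$ disjoint, relatively open and possibly empty, with relative boundaries of zero surface measure. Let $G,\widehat N\ge 2$; unknowns are indexed by $(g,i)\in\{1,\dots,G\}\times\{1,\dots,\widehat N\}$, and function spaces, scalar products and norms are extended componentwise. Set $\alpha_0=1$, $\alpha_{m+1}=\frac{4(m+1)^2-1}{(m+1)\alpha_m}$, $t_m=\frac{\alpha_m^2}{2m+1}$, and let $P_m$ be the Legendre polynomials. Define constant matrices, block diagonal in $g$ with identical blocks: $\mathbb H$ with block entries $\delta_{i,j}+\delta_{i,j-1}$; $\Gamma_e$ with block entries $\alpha_{2(i-1)}\alpha_{2(j-1)}\int_0^1xP_{2(i-1)}P_{2(j-1)}\,dx$; $\tilde\Gamma_e=\mathbb H\Gamma_e^{-1}\mathbb H^T$. Given cross sections $\Sigma_t^g$, $\Sigma_{s,m}^{g'\to g}$, put $\Sigma_{r,m}^g=\Sigma_t^g-\Sigma_{s,m}^{g\to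 g}$. The matrix $\mathbb T_e$ (resp. $\mathbb T_o$) has entries $t_m\Sigma_{r,m}^g$ in position $((g,i),(g,i))$, $-t_m\Sigma_{s,m}^{g'\to g}$ in position $((g,i),(g',i))$ for $g'\ne g$, and $0$ elsewhere, with $m=2(i-1)$ (resp. $m=2i-1$). Assume, for $0\le m<2\widehat N$: $t_m\Sigma_{r,m}^g$ is bounded above and below by positive constants; $|\Sigma_{s,m}^{g\to g'}|\le\varepsilon\,\Sigma_{r,m}^g$ for $g'\neq g$, for some $0<\varepsilon<\frac1{G-1}$; $\mathbb T_e$ and $\mathbb T_o^{-1}$ are uniformly bounded and uniformly coercive (all a.e. in $\Omega$). Let $\mathcal X=\mathbf Q\times L^2(\Omega)$, where $\mathbf Q=\{\mathbf q\in\mathbf H(\mathrm{div},\Omega):\ \mathbf q\cdot\mathbf n\in L^2(\Gamma_V),\ \mathbf q\cdot\mathbf n=0\text{ on }\Gamma_N\}$, and let $V=\{\psi\in H^1(\Omega):\psi=0\text{ on }\Gamma_D\}$. For $\zeta=(\mathbf p,\phi)$ and $\xi=(\mathbf q,\psi)$ in $\mathcal X$ (componentwise) set $$c(\zeta,\xi)=-(\mathbb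 T_o\mathbf p,\mathbf q)_{\Omega}+(\phi,\mathbb H^T\mathrm{div}\,\mathbf q)_\Omega+(\psi,\mathbb H^T\mathrm{div}\,\mathbf p)_\Omega+(\mathbb T_e\phi,\psi)_\Omega-(\tilde\Gamma_e\,\mathbf p\cdot\mathbf n,\mathbf q\cdot\mathbf n)_{\Gamma_V},$$ and $d(\zeta,\xi)=c(\zeta,(-\mathbf q,\psi))$. Let $\zeta\in\mathcal X$ satisfy $c(\zeta,\xi)=(S_f,\psi)_\Omega$ for all $\xi\in\mathcal X$. Let $\mathcal T_h$ be a conforming mesh of $\Omega$ made of simplices, or of rectangles/cuboids. Let $\zeta_h=(\mathbf p_h,\phi_h)$ be the solution of the same problem with $\mathcal X$ replaced by the conforming Raviart–Thomas–Nédélec space $\mathcal X_h=(\mathbf Q_h\cap\mathbf Q)\times L_h$ of order $k\ge0$: on a simplex, fields $\mathbf a+b\,\mathbf x$ with $\mathbf a\in\mathbb P_k^d$, $b\in\mathbb P_k$, and scalars in $\mathbb P_k$; on a rectangle/cuboid, in coordinates along the edges, fields whose $i$-th component has degree $\le k+1$ in $x_i$ and $\le k$ in the other variables, and scalars of degree $\le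 k$ in each variable. Let $\tilde\zeta_h=(\mathbf p_h,\tilde\phi_h)$ with $\tilde\phi_h\in V$ (componentwise). For a cell $K$ write $h_K$ for its diameter and $\kappa_K=|K|/h_K^d$. Let $\delta_{e},\delta_o$ be the diagonal parts of $\mathbb T_{e},\mathbb T_o$, and $\delta^{\max}_{e,K},\delta^{\min}_{e,K},\delta^{\max}_{o,K},\delta^{\min}_{o,K}$ the largest supremum and the smallest infimum over $K$ of their diagonal entries. For a facet $F\subset\overline{\Gamma_V}$, let $K_F$ be the cell having $F$ as a facet and $h_{\perp F}$ the length of the altitude of $K_F$ associated with $F$. Set $$\|\xi\|_S^2=(\delta_o\mathbf q,\mathbf q)_\Omega+(\delta_e\psi,\psi)_\Omega+\sum_{K}\delta^{\max}_{o,K}h_K^2\|\mathrm{div}\,\mathbf q\|_{0,K}^2+\sum_{F\subset\overline{\Gamma_V}}\delta^{\max}_{o,K_F}h_{\perp F}\|\tilde\Gamma_e^{1/2}(\mathbf q\cdot\mathbf n)\|_{0,F}^2,$$ $$|\zeta|_{+,K}=\sup\{d(\zeta,\xi):\ \xi=(\mathbf q,\psi)\in\mathcal X,\ \mathrm{Supp}\,\psi\subset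 K,\ \mathrm{Supp}\,\mathbf q\subset N(K),\ \|\xi\|_S\le1\},$$ where $N(K)$ is the union of the cells $K'$ with $\dim_H(\partial K'\cap\partial K)=d-1$ (including $K$). The estimators are $$\eta_{r,K}=\|\delta_e^{-1/2}(S_f-\mathbb H^T\mathrm{div}\,\mathbf p_h-\mathbb T_e\tilde\phi_h)\|_{0,K},\qquad \eta_{f,K}=\|\delta_o^{-1/2}(\mathbb T_o\mathbf p_h+\mathbb H\,\mathbf{grad}\,\tilde\phi_h)\|_{0,K},$$ $$\eta_{bc,F}=(\delta^{\max}_{o,K_F}h_{\perp F})^{-1/2}\|\tilde\Gamma_e^{-1/2}(\mathbb H\tilde\phi_h-\tilde\Gamma_e(\mathbf p_h\cdot\mathbf n))\|_{0,F}.$$ **Theorem (local efficiency, mixed boundary conditions).** Assume that, on every cell, the entries of $\mathbb T_o$ and $\mathbb T_e$ and the components of $\tilde\phi_h$ are polynomials of degrees at most $m_o$, $m_e$ and $m_\phi$ respectively, and that $S_f\in L_h$ componentwise. Let $\kappa>0$. There are constants $\mathtt c,\mathtt C>0$ depending only on $d,k,m_o,m_e,m_\phi,\kappa$, and a constant $\mathsf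 C>0$ depending only on these and on $\widehat N$ (through $\tilde\Gamma_e$), such that for every cell $K$ with $\kappa_K\ge\kappa$ $$\eta_{r,K}\le\mathtt c\left(\frac{\delta^{\max}_{e,K}}{\delta^{\min}_{e,K}}\right)^{1/2}|\zeta-\tilde\zeta_h|_{+,K},\qquad \eta_{f,K}\le\mathtt C\left(\frac{\delta^{\max}_{o,K}}{\delta^{\min}_{o,K}}\right)^{1/2}|\zeta-\tilde\zeta_h|_{+,K},$$ and for every facet $F\subset\overline{\Gamma_V}$ with $\kappa_{K_F}\ge\kappa$ $$\eta_{bc,F}\le\mathsf C\,|\zeta-\tilde\zeta_h|_{+,K_F}.$$ -/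

import Mathlib

open MeasureTheory Set Filter Topology
open scoped ContDiff ENNReal NNReal

noncomputable section

namespace SPN

/-- The Euclidean space `ℝ^d`. -/
abbrev E (d : ℕ) : Type := EuclideanSpace ℝ (Fin d)

/-- The `(d-1)`-dimensional surface measure on `ℝ^d` (normalised to agree with Lebesgue measure
on hyperplanes). -/
def surf (d : ℕ) : Measure (E d) := Measure.euclideanHausdorffMeasure (d - 1)

/-! ### Domains with a partitioned Lipschitz boundary -/

/-- `Ω` has a Lipschitz boundary: near every boundary point, in suitable orthonormal coordinates,
`Ω` is the strict epigraph of a Lipschitz function. Here `e` is the vertical direction and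
`y - ⟪e, y⟫ e` stands for the horizontal coordinates of `y`. -/
def HasLipschitzBoundary {d : ℕ} (Ω : Set (E d)) : Prop :=
  ∀ x ∈ frontier Ω, ∃ e : E d, ‖e‖ = 1 ∧ ∃ r : ℝ, 0 < r ∧ ∃ (L : ℝ≥0) (γ : E d → ℝ),
    LipschitzWith L γ ∧
      ∀ y ∈ Metric.ball x r, y ∈ Ω ↔ γ (y - inner ℝ e y • e) < inner ℝ e y

/-- `Γ` is a relatively open subset of `∂Ω` whose relative boundary is negligible for the
surface measure (as is the case for Lipschitz submanifolds of `∂Ω`). -/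
structure IsBoundaryPart {d : ℕ} (Ω Γ : Set (E d)) : Prop where
  isOpen : ∃ U : Set (E d), IsOpen U ∧ Γ = U ∩ frontier Ω
  null_boundary : surf d (closure Γ \ Γ) = 0

/-- A bounded, connected, open set `Ω` with Lipschitz boundary, whose boundary is split into
a Dirichlet part `ΓD`, a vacuum (Robin) part `ΓV` and a Neumann part `ΓN`, each possibly empty. -/
structure MixedDomain (d : ℕ) where
  Ω : Set (E d)
  ΓD : Set (E d)
  ΓV : Set (E d)
  ΓN : Set (E d)
  isOpen : IsOpen Ω
  isConnected : IsConnected Ω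
  isBounded : Bornology.IsBounded Ω
  lipschitz : HasLipschitzBoundary Ω
  partD : IsBoundaryPart Ω ΓD
  partV : IsBoundaryPart Ω ΓV
  partN : IsBoundaryPart Ω ΓN
  disjointDV : Disjoint ΓD ΓV
  disjointDN : Disjoint ΓD ΓN
  disjointVN : Disjoint ΓV ΓN
  cover : frontier Ω = closure ΓD ∪ closure ΓV ∪ closure ΓN

/-! ### Meshes -/

/-- A (closed) mesh cell: a nondegenerate simplex, or a nondegenerate rectangle / cuboid with
edges parallel to the vectors of an orthonormal basis `e`. -/
inductive Cell (d : ℕ) : Type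
  | simplex (s : Affine.Simplex ℝ (E d) d) : Cell d
  | box (e : OrthonormalBasis (Fin d) ℝ (E d)) (a b : Fin d → ℝ) (hab : ∀ i, a i < b i) : Cell d

namespace Cell

variable {d : ℕ}

/-- The coordinates used on the cell: the standard ones for a simplex, those along the edges for
a rectangle or cuboid. -/
def coords : Cell d → E d → Fin d → ℝ
  | simplex _, x => fun i => x i
  | box e _ _ _, x => fun i => e.repr x i

/-- The closed set of points of the cell. -/
def carrier : Cell d → Set (E d)
  | simplex s => convexHull ℝ (Set.range s.points)
  | box e a b _ => {x | ∀ i, a i ≤ e.repr x i ∧ e.repr x i ≤ b i}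

/-- The vertices of the cell. -/
def vertices : Cell d → Set (E d)
  | simplex s => Set.range s.points
  | box e a b _ => {x | ∀ i, e.repr x i = a i ∨ e.repr x i = b i}

def IsSimplex : Cell d → Prop
  | simplex _ => True
  | box _ _ _ _ => False

open Classical in
/-- The facets (closed faces of dimension `d - 1`) of the cell. -/
def facets : Cell d → Finset (Set (E d))
  | simplex s => Finset.univ.image fun i : Fin (d + 1) => convexHull ℝ (s.points '' {i}ᶜ)
  | box e a b hab =>
      (Finset.univ.image fun i : Fin d => {x ∈ (box e a b hab).carrier | e.repr x i = a i}) ∪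
        (Finset.univ.image fun i : Fin d => {x ∈ (box e a b hab).carrier | e.repr x i = b i})

/-- The length of the altitude of the cell `K` associated with the facet `F`: the largest
distance from a point of `K` to the hyperplane that contains `F`. -/
def altitude (K : Cell d) (F : Set (E d)) : ℝ :=
  sSup ((fun x => Metric.infDist x (affineSpan ℝ F : Set (E d))) '' K.carrier)

/-- The diameter `h_K`. -/
def diam (K : Cell d) : ℝ := Metric.diam K.carrier

/-- The shape-regularity parameter `κ_K = |K| / h_K ^ d`. -/
def shapeRegularity (K : Cell d) : ℝ := volume.real K.carrier / K.diam ^ d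

/-- `f` agrees a.e. in `K` with a polynomial of total degree at most `m`. -/
def IsPolyOn (K : Cell d) (m : ℕ) (f : E d → ℝ) : Prop :=
  ∃ P : MvPolynomial (Fin d) ℝ, P.totalDegree ≤ m ∧
    ∀ᵐ x ∂volume.restrict K.carrier, f x = MvPolynomial.eval (fun i => x i) P

/-- The local scalar space of order `k`: total degree at most `k` on a simplex,
degree at most `k` in each edge coordinate on a rectangle or cuboid. -/
def InScalarSpace (k : ℕ) (K : Cell d) (f : E d → ℝ) : Prop :=
  ∃ P : MvPolynomial (Fin d) ℝ,
    (match K with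
      | simplex _ => P.totalDegree ≤ k
      | box _ _ _ _ => ∀ j, P.degreeOf j ≤ k) ∧
    ∀ᵐ x ∂volume.restrict K.carrier, f x = MvPolynomial.eval (K.coords x) P

/-- The local Raviart-Thomas-Nedelec space of order `k`: fields `a + b x` with `a`, `b` of total
degree at most `k` on a simplex; fields whose `i`-th component along the edges has degree at most
`k + 1` in the `i`-th edge coordinate and at most `k` in the others on a rectangle or cuboid. -/
def InRTN (k : ℕ) (K : Cell d) (q : E d → E d) : Prop :=
  ∃ P : Fin d → MvPolynomial (Fin d) ℝ,
    (match K with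
      | simplex _ => ∃ (a : Fin d → MvPolynomial (Fin d) ℝ) (b : MvPolynomial (Fin d) ℝ),
          (∀ i, (a i).totalDegree ≤ k) ∧ b.totalDegree ≤ k ∧
            ∀ i, P i = a i + b * MvPolynomial.X i
      | box _ _ _ _ => ∀ i, (P i).degreeOf i ≤ k + 1 ∧ ∀ j, j ≠ i → (P i).degreeOf j ≤ k) ∧
    ∀ᵐ x ∂volume.restrict K.carrier, ∀ i,
      K.coords (q x) i = MvPolynomial.eval (K.coords x) (P i)

end Cell

/-- A conforming mesh of `Ω`, made of simplices or made of rectangles / cuboids: the cells cover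
`closure Ω`, have pairwise disjoint interiors, and any two of them meet along the common face
spanned by their common vertices (or not at all). -/
structure Mesh {d : ℕ} (Ω : Set (E d)) where
  cells : Finset (Cell d)
  homogeneous : (∀ K ∈ cells, K.IsSimplex) ∨ (∀ K ∈ cells, ¬ K.IsSimplex)
  cover : ⋃ K ∈ cells, K.carrier = closure Ω
  interior_subset : ∀ K ∈ cells, interior K.carrier ⊆ Ω
  disjoint : ∀ K ∈ cells, ∀ K' ∈ cells, K ≠ K' →
    Disjoint (interior K.carrier) (interior K'.carrier)
  conforming : ∀ K ∈ cells, ∀ K' ∈ cells,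
    K.carrier ∩ K'.carrier = convexHull ℝ (K.vertices ∩ K'.vertices)

/-- The union of the cells of the neighbourhood `N(K)`, i.e. of the cells `K'` such that
`∂K' ∩ ∂K` has Hausdorff dimension `d - 1` (`K` itself is one of them). -/
def Mesh.patch {d : ℕ} {Ω : Set (E d)} (T : Mesh Ω) (K : Cell d) : Set (E d) :=
  ⋃ K' ∈ {K' ∈ (T.cells : Set (Cell d)) |
    dimH (frontier K'.carrier ∩ frontier K.carrier) = ((d - 1 : ℕ) : ℝ≥0∞)}, K'.carrier

/-! ### The coefficients of the multigroup SP_N model -/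

/-- Indices of the unknowns: energy group and angular index (both zero-based). -/
abbrev Idx (G N : ℕ) : Type := Fin G × Fin N

/-- `α_0 = 1`, `α_{m+1} = (4 (m+1)^2 - 1) / ((m+1) α_m)`. -/
def alpha : ℕ → ℝ
  | 0 => 1
  | m + 1 => (4 * ((m : ℝ) + 1) ^ 2 - 1) / (((m : ℝ) + 1) * alpha m)

/-- `t_m = α_m^2 / (2 m + 1)`. -/
def tcoef (m : ℕ) : ℝ := alpha m ^ 2 / (2 * (m : ℝ) + 1)

/-- The `m`-th Legendre polynomial (Rodrigues' formula). -/
def legendreP (m : ℕ) : Polynomial ℝ :=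
  Polynomial.C (1 / (2 ^ m * (m.factorial : ℝ))) *
    Polynomial.derivative^[m] ((Polynomial.X ^ 2 - 1) ^ m)

/-- Macroscopic cross sections: `tot g` is `Σ_t^g`, and `scat m g' g` is the Legendre moment
`Σ_{s,m}^{g' → g}` of order `m` of the scattering cross section from group `g'` to group `g`. -/
structure CrossSections (d G : ℕ) where
  tot : Fin G → E d → ℝ
  scat : ℕ → Fin G → Fin G → E d → ℝ

/-- `ℍ`: block diagonal, each block having entries `δ_{i,j} + δ_{i,j-1}`. -/
def Hmat (G N : ℕ) : Matrix (Idx G N) (Idx G N) ℝ :=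
  Matrix.of fun a b =>
    if a.1 = b.1 ∧ (a.2 = b.2 ∨ (a.2 : ℕ) + 1 = (b.2 : ℕ)) then 1 else 0

/-- `Γ_e`: block diagonal, each block having entries
`α_{2i} α_{2j} ∫_0^1 x P_{2i}(x) P_{2j}(x) dx`, `0 ≤ i, j < N`. -/
def GammaE (G N : ℕ) : Matrix (Idx G N) (Idx G N) ℝ :=
  Matrix.of fun a b =>
    if a.1 = b.1 then
      alpha (2 * a.2) * alpha (2 * b.2) *
        ∫ x in (0 : ℝ)..1, x * (legendreP (2 * a.2)).eval x * (legendreP (2 * b.2)).eval x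
    else 0

/-- `Γ̃_e = ℍ Γ_e⁻¹ ℍᵀ`. -/
def GammaT (G N : ℕ) : Matrix (Idx G N) (Idx G N) ℝ :=
  Hmat G N * (GammaE G N)⁻¹ * (Hmat G N).transpose

/-- The Euclidean norm of a family of reals. -/
def vnorm {ι : Type} [Fintype ι] (X : ι → ℝ) : ℝ := Real.sqrt (X ⬝ᵥ X)

namespace CrossSections

variable {d G : ℕ}

/-- The removal cross section `Σ_{r,m}^g = Σ_t^g - Σ_{s,m}^{g → g}`. -/
def removal (S : CrossSections d G) (m : ℕ) (g : Fin G) (x : E d) : ℝ :=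
  S.tot g x - S.scat m g g x

/-- The removal-scattering matrix built on the moments of order `2 i + r`, `0 ≤ i < N`. -/
def Tmat (S : CrossSections d G) (N r : ℕ) (x : E d) : Matrix (Idx G N) (Idx G N) ℝ :=
  Matrix.of fun a b =>
    if a.2 = b.2 then
      if a.1 = b.1 then tcoef (2 * a.2 + r) * S.removal (2 * a.2 + r) a.1 x
      else -(tcoef (2 * a.2 + r) * S.scat (2 * a.2 + r) b.1 a.1 x)
    else 0

/-- The even removal-scattering matrix `𝕋_e`. -/
def Te (S : CrossSections d G) (N : ℕ) (x : E d) : Matrix (Idx G N) (Idx G N) ℝ := S.Tmat N 0 x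

/-- The odd removal-scattering matrix `𝕋_o`. -/
def To (S : CrossSections d G) (N : ℕ) (x : E d) : Matrix (Idx G N) (Idx G N) ℝ := S.Tmat N 1 x

/-- The positivity and boundedness conditions on the coefficients, for the moments of order
`0, …, 2 N - 1`. -/
structure Admissible (S : CrossSections d G) (N : ℕ) (Ω : Set (E d)) : Prop where
  removal_bounds : ∃ lo hi : ℝ, 0 < lo ∧ 0 < hi ∧ ∀ g, ∀ m < 2 * N,
    ∀ᵐ x ∂volume.restrict Ω, lo ≤ tcoef m * S.removal m g x ∧ tcoef m * S.removal m g x ≤ hi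
  scattering_small : ∃ ε : ℝ, 0 < ε ∧ ε < 1 / ((G : ℝ) - 1) ∧ ∀ m < 2 * N, ∀ g g', g' ≠ g →
    ∀ᵐ x ∂volume.restrict Ω, |S.scat m g g' x| ≤ ε * S.removal m g x
  odd_bounds : ∃ lo hi : ℝ, 0 < lo ∧ 0 < hi ∧ ∀ᵐ x ∂volume.restrict Ω, ∀ X : Idx G N → ℝ,
    lo * vnorm X ^ 2 ≤ X ⬝ᵥ ((S.To N x)⁻¹.mulVec X) ∧
      vnorm ((S.To N x)⁻¹.mulVec X) ≤ hi * vnorm X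
  even_bounds : ∃ lo hi : ℝ, 0 < lo ∧ 0 < hi ∧ ∀ᵐ x ∂volume.restrict Ω, ∀ X : Idx G N → ℝ,
    lo * vnorm X ^ 2 ≤ X ⬝ᵥ ((S.Te N x).mulVec X) ∧
      vnorm ((S.Te N x).mulVec X) ≤ hi * vnorm X

end CrossSections

/-- `max_a sup_K T_{aa}` (essential supremum). -/
def diagMax {d : ℕ} {ι : Type} (T : E d → Matrix ι ι ℝ) (K : Cell d) : ℝ :=
  ⨆ a : ι, essSup (fun x => T x a a) (volume.restrict K.carrier)

/-- `min_a inf_K T_{aa}` (essential infimum). -/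
def diagMin {d : ℕ} {ι : Type} (T : E d → Matrix ι ι ℝ) (K : Cell d) : ℝ :=
  ⨅ a : ι, essInf (fun x => T x a a) (volume.restrict K.carrier)

/-! ### Function spaces -/

/-- A smooth function with compact support in `ℝ^d`. -/
def IsTest {d : ℕ} (v : E d → ℝ) : Prop := ContDiff ℝ ∞ v ∧ HasCompactSupport v

/-- `w` is the weak divergence of `q` in `Ω`. -/
def IsWeakDiv {d : ℕ} (Ω : Set (E d)) (q : E d → E d) (w : E d → ℝ) : Prop :=
  ∀ v : E d → ℝ, IsTest v → tsupport v ⊆ Ω →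
    ∫ x in Ω, fderiv ℝ v x (q x) = -∫ x in Ω, w x * v x

/-- The normal trace on the part `Γ` of `∂Ω` of the field `q`, with divergence `w`, is the
function `g`: Green's formula holds for all smooth `v` that vanish near `∂Ω \ Γ`. -/
def IsNormalTrace {d : ℕ} (Ω Γ : Set (E d)) (q : E d → E d) (w g : E d → ℝ) : Prop :=
  ∀ v : E d → ℝ, IsTest v → tsupport v ∩ frontier Ω ⊆ Γ →
    ∫ x in Ω, (fderiv ℝ v x (q x) + w x * v x) = ∫ x in Γ, g x * v x ∂surf d

/-- `g` is the weak gradient of `f` in `Ω`. -/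
def IsWeakGrad {d : ℕ} (Ω : Set (E d)) (f : E d → ℝ) (g : E d → E d) : Prop :=
  ∀ v : E d → ℝ, IsTest v → tsupport v ⊆ Ω → ∀ e : E d,
    ∫ x in Ω, f x * fderiv ℝ v x e = -∫ x in Ω, inner ℝ (g x) e * v x

/-- `t` is the trace on `∂Ω` of the function `f` of `H^1(Ω)` with gradient `g`: it is the limit in
`L^2(∂Ω)` of the restrictions of smooth functions that converge to `f` in `H^1(Ω)`. -/
def IsTrace {d : ℕ} (Ω : Set (E d)) (f : E d → ℝ) (g : E d → E d) (t : E d → ℝ) : Prop :=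
  ∃ v : ℕ → E d → ℝ, (∀ n, IsTest (v n)) ∧
    Tendsto (fun n => eLpNorm (fun x => v n x - f x) 2 (volume.restrict Ω)) atTop (𝓝 0) ∧
    Tendsto (fun n => eLpNorm (fun x => gradient (v n) x - g x) 2 (volume.restrict Ω))
      atTop (𝓝 0) ∧
    Tendsto (fun n => eLpNorm (fun x => v n x - t x) 2 ((surf d).restrict (frontier Ω)))
      atTop (𝓝 0)

/-- A pair `(p, φ)`, where `p` is recorded together with its divergence `div` and its
normal trace `nt`. -/
structure MixedField (d : ℕ) (ι : Type) where
  p : E d → ι → E d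
  div : E d → ι → ℝ
  nt : E d → ι → ℝ
  φ : E d → ι → ℝ

instance {d : ℕ} {ι : Type} : Sub (MixedField d ι) where
  sub ζ ξ := ⟨fun x a => ζ.p x a - ξ.p x a, fun x a => ζ.div x a - ξ.div x a,
    fun x a => ζ.nt x a - ξ.nt x a, fun x a => ζ.φ x a - ξ.φ x a⟩

/-- `ζ = (p, φ)` belongs to `X_m = Q_m(Ω) × L^2(Ω)` (componentwise): `p` is in `H(div, Ω)` with
divergence `ζ.div`, its normal trace on `ΓV` is the square integrable function `ζ.nt`, and its
normal trace on `ΓN` vanishes. -/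
structure MixedField.InX {d : ℕ} {ι : Type} (D : MixedDomain d) (ζ : MixedField d ι) : Prop where
  memLp_p : ∀ a, MemLp (fun x => ζ.p x a) 2 (volume.restrict D.Ω)
  memLp_div : ∀ a, MemLp (fun x => ζ.div x a) 2 (volume.restrict D.Ω)
  memLp_nt : ∀ a, MemLp (fun x => ζ.nt x a) 2 ((surf d).restrict D.ΓV)
  memLp_φ : ∀ a, MemLp (fun x => ζ.φ x a) 2 (volume.restrict D.Ω)
  weakDiv : ∀ a, IsWeakDiv D.Ω (fun x => ζ.p x a) (fun x => ζ.div x a)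
  trace_V : ∀ a,
    IsNormalTrace D.Ω D.ΓV (fun x => ζ.p x a) (fun x => ζ.div x a) (fun x => ζ.nt x a)
  trace_N : ∀ a, IsNormalTrace D.Ω D.ΓN (fun x => ζ.p x a) (fun x => ζ.div x a) 0

/-- A scalar field recorded together with its gradient and its boundary trace. -/
structure ScalarField (d : ℕ) (ι : Type) where
  val : E d → ι → ℝ
  grad : E d → ι → E d
  tr : E d → ι → ℝ

/-- Membership in `V_m`: functions of `H^1(Ω)` with zero trace on `ΓD` (componentwise). -/
structure ScalarField.InV {d : ℕ} {ι : Type} (D : MixedDomain d) (f : ScalarField d ι) :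
    Prop where
  memLp_val : ∀ a, MemLp (fun x => f.val x a) 2 (volume.restrict D.Ω)
  memLp_grad : ∀ a, MemLp (fun x => f.grad x a) 2 (volume.restrict D.Ω)
  memLp_tr : ∀ a, MemLp (fun x => f.tr x a) 2 ((surf d).restrict (frontier D.Ω))
  weakGrad : ∀ a, IsWeakGrad D.Ω (fun x => f.val x a) (fun x => f.grad x a)
  trace : ∀ a, IsTrace D.Ω (fun x => f.val x a) (fun x => f.grad x a) (fun x => f.tr x a)
  trace_D : ∀ a, ∀ᵐ x ∂(surf d).restrict D.ΓD, f.tr x a = 0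

/-! ### Bilinear forms, continuous and discrete problems -/

section Forms

variable {d G N : ℕ} (D : MixedDomain d) (S : CrossSections d G)

/-- `(𝕋_o p, q)_{0,Ω}`. -/
def formOdd (p q : E d → Idx G N → E d) : ℝ :=
  ∫ x in D.Ω, ∑ a, inner ℝ (∑ b, S.To N x a b • p x b) (q x a)

/-- `(𝕋_e φ, ψ)_{0,Ω}`. -/
def formEven (φ ψ : E d → Idx G N → ℝ) : ℝ :=
  ∫ x in D.Ω, (S.Te N x).mulVec (φ x) ⬝ᵥ ψ x

/-- `(ψ, ℍᵀ w)_{0,Ω}`. -/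
def formDiv (ψ w : E d → Idx G N → ℝ) : ℝ :=
  ∫ x in D.Ω, ψ x ⬝ᵥ (Hmat G N).transpose.mulVec (w x)

/-- `(Γ̃_e g, g')_{0,ΓV}`. -/
def formRobin (g g' : E d → Idx G N → ℝ) : ℝ :=
  ∫ x in D.ΓV, (GammaT G N).mulVec (g x) ⬝ᵥ g' x ∂surf d

/-- The bilinear form of the mixed variational formulation. -/
def cForm (ζ ξ : MixedField d (Idx G N)) : ℝ :=
  -formOdd D S ζ.p ξ.p + formDiv D ζ.φ ξ.div + formDiv D ξ.φ ζ.div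
    + formEven D S ζ.φ ξ.φ - formRobin D ζ.nt ξ.nt

/-- The bilinear form `d(ζ, (q, ψ)) = c(ζ, (-q, ψ))`. -/
def dForm (ζ ξ : MixedField d (Idx G N)) : ℝ :=
  formOdd D S ζ.p ξ.p + formEven D S ζ.φ ξ.φ + formRobin D ζ.nt ξ.nt
    + formDiv D ξ.φ ζ.div - formDiv D ζ.φ ξ.div

/-- `ζ` solves the mixed variational formulation with source `Sf`. -/
def IsSolution (Sf : E d → Idx G N → ℝ) (ζ : MixedField d (Idx G N)) : Prop :=
  ζ.InX D ∧ ∀ ξ : MixedField d (Idx G N), ξ.InX D →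
    cForm D S ζ ξ = ∫ x in D.Ω, Sf x ⬝ᵥ ξ.φ x

/-- Membership in the conforming discrete space `X_{m,h} = Q_{m,h} × L_h` of order `k`. (The
normal traces of piecewise RTN fields are automatically square integrable on all of `∂Ω`.) -/
def MixedField.InXh (T : Mesh D.Ω) (k : ℕ) (ζ : MixedField d (Idx G N)) : Prop :=
  ζ.InX D ∧ ∀ K ∈ T.cells, ∀ a,
    K.InRTN k (fun x => ζ.p x a) ∧ K.InScalarSpace k (fun x => ζ.φ x a)

/-- `ζh` solves the discrete mixed variational formulation of order `k`. -/
def IsDiscreteSolution (T : Mesh D.Ω) (k : ℕ) (Sf : E d → Idx G N → ℝ)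
    (ζh : MixedField d (Idx G N)) : Prop :=
  ζh.InXh D T k ∧ ∀ ξh : MixedField d (Idx G N), ξh.InXh D T k →
    cForm D S ζh ξh = ∫ x in D.Ω, Sf x ⬝ᵥ ξh.φ x

/-- The reconstruction `(p_h, φ̃_h)` of `ζh = (p_h, φ_h)`. -/
def reconstruction (ζh : MixedField d (Idx G N)) (φt : ScalarField d (Idx G N)) :
    MixedField d (Idx G N) :=
  ⟨ζh.p, ζh.div, ζh.nt, φt.val⟩

/-! ### Norms and estimators -/

open Classical in
/-- The facets of the cell `K` contained in `closure ΓV`; they are boundary facets. -/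
def robinFacets (K : Cell d) : Finset (Set (E d)) :=
  K.facets.filter fun F => F ⊆ closure D.ΓV

/-- The strengthened norm `‖·‖_S`. -/
def normS (T : Mesh D.Ω) (ζ : MixedField d (Idx G N)) : ℝ :=
  Real.sqrt
    ((∫ x in D.Ω, ∑ a, S.To N x a a * ‖ζ.p x a‖ ^ 2)
      + (∫ x in D.Ω, ∑ a, S.Te N x a a * ζ.φ x a ^ 2)
      + (∑ K ∈ T.cells, diagMax (S.To N) K * K.diam ^ 2 *
          ∫ x in K.carrier, ∑ a, ζ.div x a ^ 2)
      + ∑ K ∈ T.cells, ∑ F ∈ robinFacets D K, diagMax (S.To N) K * K.altitude F *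
          ∫ x in F, (GammaT G N).mulVec (ζ.nt x) ⬝ᵥ ζ.nt x ∂surf d)

/-- Membership in the local space `X_K`: `φ` is supported in `K` and `p` in the cells of `N(K)`. -/
def MixedField.InXLocal (T : Mesh D.Ω) (K : Cell d) (ξ : MixedField d (Idx G N)) : Prop :=
  ξ.InX D ∧
    (∀ᵐ x ∂volume.restrict D.Ω, x ∉ K.carrier → ξ.φ x = 0) ∧
    (∀ᵐ x ∂volume.restrict D.Ω, x ∉ T.patch K → ξ.p x = 0)

/-- The local norm `|ζ|_{+,K} = sup {d(ζ, ξ) : ξ ∈ X_K, ‖ξ‖_S ≤ 1}`. The supremum is taken in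
`[0, ∞]`, so that no boundedness convention is involved; it is nonnegative since `ξ = 0` is
admissible. -/
def localNorm (T : Mesh D.Ω) (K : Cell d) (ζ : MixedField d (Idx G N)) : ℝ≥0∞ :=
  ⨆ (ξ : MixedField d (Idx G N)) (_ : ξ.InXLocal D T K) (_ : normS D S T ξ ≤ 1),
    ENNReal.ofReal (dForm D S ζ ξ)

/-- The residual estimator `‖δ_e^{-1/2} (S_f - ℍᵀ div p_h - 𝕋_e φ̃_h)‖_{0,K}`. -/
def etaR (Sf : E d → Idx G N → ℝ) (ζh : MixedField d (Idx G N)) (φt : ScalarField d (Idx G N))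
    (K : Cell d) : ℝ :=
  Real.sqrt (∫ x in K.carrier, ∑ a,
    (Sf x a - (Hmat G N).transpose.mulVec (ζh.div x) a - (S.Te N x).mulVec (φt.val x) a) ^ 2
      / S.Te N x a a)

/-- The flux estimator `‖δ_o^{-1/2} (𝕋_o p_h + ℍ grad φ̃_h)‖_{0,K}`. -/
def etaF (ζh : MixedField d (Idx G N)) (φt : ScalarField d (Idx G N)) (K : Cell d) : ℝ :=
  Real.sqrt (∫ x in K.carrier, ∑ a,
    ‖(∑ b, S.To N x a b • ζh.p x b) + ∑ b, Hmat G N a b • φt.grad x b‖ ^ 2 / S.To N x a a)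

/-- `e_h = ℍ φ̃_h - Γ̃_e (p_h · n)` on the Robin part of the boundary. -/
def robinResidual (ζh : MixedField d (Idx G N)) (φt : ScalarField d (Idx G N)) (x : E d) :
    Idx G N → ℝ :=
  (Hmat G N).mulVec (φt.tr x) - (GammaT G N).mulVec (ζh.nt x)

/-- The Robin boundary condition estimator
`(δ^max_{o,K} h_{⊥F})^{-1/2} ‖Γ̃_e^{-1/2} (ℍ φ̃_h - Γ̃_e (p_h · n))‖_{0,F}` of a facet `F` of `K`;
recall that `‖Γ̃_e^{-1/2} e‖^2 = (Γ̃_e⁻¹ e, e)`. -/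
def etaBC (ζh : MixedField d (Idx G N)) (φt : ScalarField d (Idx G N))
    (K : Cell d) (F : Set (E d)) : ℝ :=
  (Real.sqrt (diagMax (S.To N) K * K.altitude F))⁻¹ *
    Real.sqrt (∫ x in F,
      (GammaT G N)⁻¹.mulVec (robinResidual ζh φt x) ⬝ᵥ robinResidual ζh φt x ∂surf d)

end Forms

end SPN

end

open SPN

noncomputable section

namespace SPN

/-! ### Orthonormal frames, half spaces and Green's formula -/

/-! Each estimator is the norm of a residual of the reconstruction ζ̃_h, and d(ζ - ζ̃_h, ξ) involves
the exact solution only through the source (`dForm_sub_reconstruction`). It therefore suffices to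
exhibit, for each estimator, one ξ in the local test space whose pairing with ζ - ζ̃_h bounds the
squared residual from above and whose norm ‖ξ‖_S is bounded by the residual.

For η_r the field ξ = (0, δ_e⁻¹ r 1_K), with r the residual, does this exactly: the pairing and
‖ξ‖_S² both equal η_r² (`etaR_le`).

For η_f the residual R = 𝕋_o p_h + ℍ grad φ̃_h is a polynomial on K. The flux -bR, with b a smooth
cutoff of a ball inside K, gives the pairing ∫ b|R|², which dominates ∫|R|² over a smaller ball. On
polynomials of bounded degree that integral controls values and derivatives on all of K
(`PolyFun.exists_bound`), hence both the divergence term of ‖·‖_S and the full norm of R on K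
(`exists_fluxResidual_bound`). Only translations and dilations are used, with no reference element:
the shape of K enters through the ratio of an inscribed radius to the diameter, which κ bounds below
(`Ineq.norm_le`, `Cell.exists_inner_ball`).

For η_bc the residual e = ℍφ̃_h - Γ̃_e(p_h·n) is a polynomial in the chart of F. The flux with outer
normal component b Γ̃_e⁻¹e, extended constantly along the normal and then cut off by b near an inner
point of F, produces ∫_F b(Γ̃_e⁻¹e, e) minus a volume term against R. That term is absorbed by
Young's inequality and the previous bound (`exists_etaBC_bound`). Since Γ̃_e is block diagonal with
identical blocks, the constants depend on N̂ but not on the number of groups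
(`exists_robin_factor`).

The geometric part makes these fluxes admissible. Extended by zero outside K they remain in H(div,
Ω) because their normal trace lives on F alone (`testField_inX`). The Lipschitz property makes Ω a
half space near almost every point of a Robin facet (`mem_flatSet`), so that the abstract traces of
φ̃_h and p_h can be computed from their polynomial expressions on K, and no other cell or facet sees
the flux. -/

/-- A base point together with an orthonormal basis; the first basis vector plays the role of the
inner unit normal of a hyperplane through the base point. -/
structure Frame (n : ℕ) where
  z : E (n + 1)
  o : OrthonormalBasis (Fin (n + 1)) ℝ (E (n + 1))

namespace Frame

variable {n : ℕ} (Fr : Frame n)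

/-- The unit normal of the frame. -/
def ν : E (n + 1) := Fr.o 0

/-- The signed height above the hyperplane of the frame. -/
def height (x : E (n + 1)) : ℝ := inner ℝ Fr.ν (x - Fr.z)

/-- The closed half space above the hyperplane of the frame. -/
def half : Set (E (n + 1)) := {x | 0 ≤ Fr.height x}

/-- The hyperplane of the frame. -/
def plane : Set (E (n + 1)) := {x | Fr.height x = 0}

/-- The parametrisation of the hyperplane of the frame. -/
def chart (y : E n) : E (n + 1) := Fr.z + ∑ j, y j • Fr.o j.succ

/-- The projection onto the hyperplane of the frame, read in the chart. -/
def proj (x : E (n + 1)) : E n := WithLp.toLp 2 fun j => inner ℝ (Fr.o j.succ) (x - Fr.z)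

/-- Cartesian coordinates attached to the frame. -/
def cart (c : Fin (n + 1) → ℝ) : E (n + 1) := Fr.z + ∑ j, c j • Fr.o j

lemma norm_ν : ‖Fr.ν‖ = 1 := Fr.o.orthonormal.1 0

lemma continuous_height : Continuous Fr.height := by unfold height; fun_prop

lemma isClosed_half : IsClosed Fr.half := isClosed_le continuous_const Fr.continuous_height

lemma isClosed_plane : IsClosed Fr.plane := isClosed_eq Fr.continuous_height continuous_const

lemma plane_subset_half : Fr.plane ⊆ Fr.half := fun _ hx => (show _ = _ from hx).ge

lemma inner_basis (i j : Fin (n + 1)) : inner ℝ (Fr.o i) (Fr.o j) = if i = j then (1 : ℝ) else 0 :=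
  orthonormal_iff_ite.1 Fr.o.orthonormal i j

lemma height_cart (c : Fin (n + 1) → ℝ) : Fr.height (Fr.cart c) = c 0 := by
  simp [height, cart, ν, inner_sum, inner_smul_right, inner_basis]

lemma chart_eq_cart (y : E n) : Fr.chart y = Fr.cart (Fin.cons 0 (fun j => y j)) := by
  simp [chart, cart, Fin.sum_univ_succ]

lemma height_chart (y : E n) : Fr.height (Fr.chart y) = 0 := by
  rw [chart_eq_cart, height_cart]; simp

lemma proj_chart (y : E n) : Fr.proj (Fr.chart y) = y := by
  ext j
  simp [proj, chart, inner_sum, inner_smul_right, inner_basis]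

lemma chart_proj_add (x : E (n + 1)) : Fr.chart (Fr.proj x) + Fr.height x • Fr.ν = x := by
  have h := Fr.o.sum_repr' (x - Fr.z)
  rw [Fin.sum_univ_succ] at h
  simp only [chart, proj, height, ν]
  rw [add_assoc, add_comm (∑ j : Fin n, _), h]; abel

lemma chart_proj {x : E (n + 1)} (hx : x ∈ Fr.plane) : Fr.chart (Fr.proj x) = x := by
  have := Fr.chart_proj_add x
  rwa [show Fr.height x = 0 from hx, zero_smul, add_zero] at this

lemma range_chart : range Fr.chart = Fr.plane := by
  ext x
  exact ⟨by rintro ⟨y, rfl⟩; exact Fr.height_chart y, fun hx => ⟨_, Fr.chart_proj hx⟩⟩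

lemma chart_sub (y y' : E n) : Fr.chart y - Fr.chart y' = ∑ j, (y - y') j • Fr.o j.succ := by
  simp [chart, sub_smul, Finset.sum_sub_distrib]

lemma isometry_chart : Isometry Fr.chart := by
  refine Isometry.of_dist_eq fun y y' => ?_
  have ho : Orthonormal ℝ (fun j : Fin n => Fr.o j.succ) :=
    Fr.o.orthonormal.comp _ (Fin.succ_injective n)
  rw [dist_eq_norm, chart_sub, dist_eq_norm, ← sq_eq_sq₀ (norm_nonneg _) (norm_nonneg _),
    ← real_inner_self_eq_norm_sq, ho.inner_sum, EuclideanSpace.norm_sq_eq]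
  simp [sq]

/-- An isometric embedding transports Hausdorff measures, and with the Euclidean normalisation the
n-dimensional one on `E n` is Lebesgue measure. Facet integrals thus become integrals over subsets
of `E n`. -/
lemma map_chart : (volume : Measure (E n)).map Fr.chart = (surf (n + 1)).restrict Fr.plane := by
  rw [← range_chart, ← EuclideanSpace.euclideanHausdorffMeasure_eq_volume]
  exact Fr.isometry_chart.map_euclideanHausdorffMeasure

lemma isClosedEmbedding_chart : IsClosedEmbedding Fr.chart := Fr.isometry_chart.isClosedEmbedding

lemma surf_restrict {F : Set (E (n + 1))} (hF : F ⊆ Fr.plane) :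
    (surf (n + 1)).restrict F = (volume.restrict (Fr.chart ⁻¹' F)).map Fr.chart := by
  rw [← Fr.isClosedEmbedding_chart.measurableEmbedding.restrict_map, map_chart,
    Measure.restrict_restrict_of_subset hF]

lemma setIntegral_surf {F : Set (E (n + 1))} (hF : F ⊆ Fr.plane) (f : E (n + 1) → ℝ) :
    ∫ x in F, f x ∂surf (n + 1) = ∫ y in Fr.chart ⁻¹' F, f (Fr.chart y) := by
  rw [Fr.surf_restrict hF, Fr.isClosedEmbedding_chart.measurableEmbedding.integral_map]

lemma measurePreserving_cart : MeasurePreserving Fr.cart volume volume := by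
  have h1 := (EuclideanSpace.volume_preserving_symm_measurableEquiv_toLp (Fin (n + 1))).symm
  have h2 := Fr.o.measurePreserving_repr_symm
  have h3 := measurePreserving_add_left (volume : Measure (E (n + 1))) Fr.z
  have : Fr.cart = (fun x => Fr.z + x) ∘ Fr.o.repr.symm ∘
      (MeasurableEquiv.toLp 2 (Fin (n + 1) → ℝ)).symm.symm := by
    funext c
    simp only [cart, Function.comp_apply, ← OrthonormalBasis.sum_repr_symm]
    rfl
  rw [this]
  exact h3.comp (h2.comp h1)

lemma continuous_cart : Continuous Fr.cart := by unfold cart; fun_prop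

lemma cart_coord (x : E (n + 1)) : Fr.cart (fun j => inner ℝ (Fr.o j) (x - Fr.z)) = x := by
  rw [cart, Fr.o.sum_repr']; abel

lemma coord_cart (c : Fin (n + 1) → ℝ) (j : Fin (n + 1)) :
    inner ℝ (Fr.o j) (Fr.cart c - Fr.z) = c j := by
  simp [cart, inner_sum, inner_smul_right, inner_basis]

lemma measurableEmbedding_cart : MeasurableEmbedding Fr.cart := by
  refine MeasurableEmbedding.of_measurable_inverse (g := fun x j => inner ℝ (Fr.o j) (x - Fr.z))
    Fr.continuous_cart.measurable ?_ ?_ fun c => funext fun j => Fr.coord_cart c j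
  · rw [range_eq_univ.2 fun x => ⟨_, Fr.cart_coord x⟩]; exact MeasurableSet.univ
  · exact Continuous.measurable (by fun_prop)

lemma setIntegral_half (f : E (n + 1) → ℝ) :
    ∫ x in Fr.half, f x = ∫ c in {c : Fin (n + 1) → ℝ | 0 ≤ c 0}, f (Fr.cart c) := by
  rw [← Fr.measurePreserving_cart.setIntegral_preimage_emb Fr.measurableEmbedding_cart]
  simp [half, height_cart]

lemma hasFDerivAt_cart (c : Fin (n + 1) → ℝ) :
    HasFDerivAt Fr.cart (∑ j, (ContinuousLinearMap.proj (R := ℝ) (φ := fun _ => ℝ) j).smulRight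
      (Fr.o j)) c := by
  unfold cart
  refine HasFDerivAt.const_add _ (HasFDerivAt.fun_sum fun j _ => ?_)
  exact ((ContinuousLinearMap.proj (R := ℝ) (φ := fun _ => ℝ) j).hasFDerivAt).smul_const _

/-- Green's formula on a half space, in the direction of a vector of the frame. -/
lemma green_basis {f : E (n + 1) → ℝ} (hf : ContDiff ℝ 1 f) (hs : HasCompactSupport f)
    (i : Fin (n + 1)) :
    ∫ x in Fr.half, fderiv ℝ f x (Fr.o i) = -((if i = 0 then 1 else 0) * ∫ y, f (Fr.chart y)) := by
  set g : (Fin (n + 1) → ℝ) → ℝ := fun c => f (Fr.cart c) with hg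
  have hgd : ∀ c, HasFDerivAt g ((fderiv ℝ f (Fr.cart c)).comp
      (∑ j, (ContinuousLinearMap.proj (R := ℝ) (φ := fun _ => ℝ) j).smulRight (Fr.o j))) c :=
    fun c => ((hf.differentiable one_ne_zero _).hasFDerivAt).comp c (Fr.hasFDerivAt_cart c)
  -- A coordinate is at most the distance to the base point, so R may be the radius of a ball around
  -- it that contains the support.
  obtain ⟨R, hR0, hR⟩ : ∃ R : ℝ, 0 < R ∧ ∀ c, (∃ j, R ≤ |c j|) → Fr.cart c ∉ tsupport f := by
    obtain ⟨R, hR⟩ := hs.isCompact.isBounded.subset_ball Fr.z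
    refine ⟨max R 1, by positivity, fun c ⟨j, hj⟩ hc => ?_⟩
    have h1 := hR hc
    rw [Metric.mem_ball, dist_eq_norm] at h1
    have h2 := abs_real_inner_le_norm (Fr.o j) (Fr.cart c - Fr.z)
    rw [coord_cart, Fr.o.orthonormal.1 j, one_mul] at h2
    linarith [le_max_left R 1]
  have hg0 : ∀ c, (∃ j, R ≤ |c j|) → g c = 0 := fun c hc =>
    image_eq_zero_of_notMem_tsupport (f := f) (hR c hc)
  have hD0 : ∀ c, (∃ j, R ≤ |c j|) → fderiv ℝ f (Fr.cart c) = 0 := fun c hc =>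
    image_eq_zero_of_notMem_tsupport fun h => hR c hc (tsupport_fderiv_subset ℝ h)
  -- On the box [0, R] × [-R, R]^n the face where coordinate 0 vanishes is the only one that can
  -- meet the support.
  set a : Fin (n + 1) → ℝ := Function.update (fun _ => -R) 0 0 with ha
  set b : Fin (n + 1) → ℝ := fun _ => R with hb
  have hle : a ≤ b := fun j => by
    by_cases hj : j = 0
    · subst hj; simp [ha, hb, hR0.le]
    · simp [ha, hb, hj]; linarith
  have hcont : Continuous fun c => fderiv ℝ f (Fr.cart c) (Fr.o i) :=
    ((hf.continuous_fderiv one_ne_zero).comp Fr.continuous_cart).clm_apply continuous_const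
  -- The divergence theorem for the field whose only nonzero component is g, in position i.
  have key := integral_divergence_of_hasFDerivAt_off_countable' a b hle
    (fun j => if j = i then g else 0)
    (fun j => if j = i then fun c => ((fderiv ℝ f (Fr.cart c)).comp
      (∑ j, (ContinuousLinearMap.proj (R := ℝ) (φ := fun _ => ℝ) j).smulRight (Fr.o j))) else 0)
    ∅ countable_empty
    (fun j => by
      split_ifs
      · exact (hf.continuous.comp Fr.continuous_cart).continuousOn
      · exact continuousOn_const)
    (fun c _ j => by
      split_ifs
      · exact hgd c
      · exact hasFDerivAt_const _ _)
    (by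
      refine Continuous.integrableOn_Icc ?_
      convert hcont using 2 with c
      rw [Finset.sum_eq_single i (fun j _ hj => by simp [hj]) (by simp)]
      simp [Pi.single_apply])
  have hL : ∀ c, (∑ j, (if j = i then fun c => ((fderiv ℝ f (Fr.cart c)).comp
      (∑ j, (ContinuousLinearMap.proj (R := ℝ) (φ := fun _ => ℝ) j).smulRight (Fr.o j))) else 0 :
      (Fin (n + 1) → ℝ) → (Fin (n + 1) → ℝ) →L[ℝ] ℝ) c (Pi.single j 1)) =
      fderiv ℝ f (Fr.cart c) (Fr.o i) := fun c => by
    rw [Finset.sum_eq_single i (fun j _ hj => by simp [hj]) (by simp)]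
    simp [Pi.single_apply]
  simp only [hL] at key
  rw [setIntegral_half, setIntegral_eq_of_subset_of_forall_sdiff_eq_zero (s := Icc a b) (t := {c | 0 ≤ c 0}),
    key,    Finset.sum_eq_single i (fun j _ hj => by simp [hj]) (by simp)]
  · simp only [if_true]
    have hfront : ∀ y : Fin n → ℝ, g (i.insertNth (b i) y) = 0 := fun y => hg0 _ ⟨i, by
      simp [hb, abs_of_pos hR0]⟩
    simp only [hfront, integral_zero, zero_sub, neg_inj]
    by_cases hi : i = 0
    · subst hi
      rw [if_pos rfl, one_mul, setIntegral_eq_integral_of_forall_compl_eq_zero]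
      · rw [← (EuclideanSpace.volume_preserving_symm_measurableEquiv_toLp (Fin n)).integral_comp'
          (fun y => g (Fin.insertNth 0 (a 0) y))]
        refine integral_congr_ae (ae_of_all _ fun y => ?_)
        simp only [hg, chart_eq_cart]
        congr 2
        simp [ha]
      · intro y hy
        apply hg0
        by_contra! hc
        refine hy ⟨fun j => ?_, fun j => ?_⟩
        · have := hc j.succ
          simpa [ha] using (abs_lt.1 this).1.le
        · have := hc j.succ
          simpa [hb] using (abs_lt.1 this).2.le
    · rw [if_neg hi, zero_mul]
      refine integral_eq_zero_of_ae (ae_of_all _ fun y => hg0 _ ⟨i, ?_⟩)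
      simp [ha, hi, abs_of_pos hR0]
  · exact measurableSet_le measurable_const (measurable_pi_apply 0)
  · exact fun c hc => by simpa [ha] using hc.1 0
  · intro c hc
    rw [hD0, zero_apply]
    by_contra! h
    refine hc.2 ⟨fun j => ?_, fun j => (le_abs_self _).trans (h j).le⟩
    by_cases hj : j = 0
    · subst hj; simpa [ha] using hc.1
    · simp [ha, hj]; exact (abs_lt.1 (h j)).1.le

/-- Green's formula on a half space. -/
lemma green {f : E (n + 1) → ℝ} (hf : ContDiff ℝ 1 f) (hs : HasCompactSupport f)
    (u : E (n + 1)) :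
    ∫ x in Fr.half, fderiv ℝ f x u = -(inner ℝ Fr.ν u * ∫ y, f (Fr.chart y)) := by
  have hu := Fr.o.sum_repr' u
  have hc : ∀ w, Integrable (fun x => fderiv ℝ f x w) (volume.restrict Fr.half) := fun w =>
    (((hf.continuous_fderiv one_ne_zero).clm_apply continuous_const).integrable_of_hasCompactSupport
      ((hs.fderiv ℝ).mono fun x hx h => hx (by simp [h]))).restrict
  conv_lhs => rw [← hu]
  simp only [map_sum, map_smul, smul_eq_mul]
  rw [integral_finsetSum _ fun i _ => (hc _).const_mul _]
  simp only [integral_const_mul, Fr.green_basis hf hs]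
  rw [Finset.sum_eq_single 0 (fun j _ hj => by simp [hj]) (by simp)]
  simp [ν]

end Frame

/-- A unit vector and a point define a frame. -/
lemma exists_frame {n : ℕ} (z ν : E (n + 1)) (hν : ‖ν‖ = 1) :
    ∃ Fr : Frame n, Fr.z = z ∧ Fr.ν = ν := by
  have : Orthonormal ℝ (({0} : Set (Fin (n + 1))).domRestrict fun _ : Fin (n + 1) => ν) := by
    rw [orthonormal_iff_ite]
    rintro ⟨i, hi⟩ ⟨j, hj⟩
    obtain rfl : i = 0 := hi
    obtain rfl : j = 0 := hj
    simp [Set.domRestrict, hν]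
  obtain ⟨o, ho⟩ := this.exists_orthonormalBasis_extension_of_card_eq (by simp)
  exact ⟨⟨z, o⟩, rfl, ho 0 rfl⟩

/-- Continuous functions are in every `L^p` over a compact set of finite measure. -/
lemma memLp_restrict_of_continuous {X F : Type*} [TopologicalSpace X] [MeasurableSpace X]
    [OpensMeasurableSpace X] [NormedAddCommGroup F] [SecondCountableTopologyEither X F]
    {μ : Measure X} {K s : Set X} (hK : IsCompact K)
    (hs : MeasurableSet s) (hsK : s ⊆ K) [IsFiniteMeasure (μ.restrict s)]
    {f : X → F} (hf : Continuous f) {p : ℝ≥0∞} : MemLp f p (μ.restrict s) := by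
  obtain ⟨C, hC⟩ := hK.exists_bound_of_continuousOn hf.continuousOn
  exact MemLp.of_bound hf.aestronglyMeasurable C
    ((ae_restrict_iff' hs).2 (ae_of_all _ fun x hx => hC x (hsK hx)))

/-! ### Polynomial functions -/

/-- Polynomial functions of total degree at most `D` on `ℝ^n`. -/
def PolyFun (n D : ℕ) : Submodule ℝ (E n → ℝ) :=
  (MvPolynomial.restrictTotalDegree (Fin n) ℝ D).map
    ({ toFun := fun P x => MvPolynomial.eval (fun i => x i) P
       map_add' := fun _ _ => by ext; simp
       map_smul' := fun _ _ => by ext; simp } : MvPolynomial (Fin n) ℝ →ₗ[ℝ] E n → ℝ)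

namespace PolyFun

variable {n m D D' : ℕ} {f g : E n → ℝ}

lemma mem_iff : f ∈ PolyFun n D ↔ ∃ P : MvPolynomial (Fin n) ℝ, P.totalDegree ≤ D ∧
    ∀ x, f x = MvPolynomial.eval (fun i => x i) P := by
  simp only [PolyFun, Submodule.mem_map, MvPolynomial.mem_restrictTotalDegree]
  exact ⟨fun ⟨P, h, e⟩ => ⟨P, h, fun x => (congrFun e x).symm⟩,
    fun ⟨P, h, e⟩ => ⟨P, h, funext fun x => (e x).symm⟩⟩

instance : FiniteDimensional ℝ (PolyFun n D) := by unfold PolyFun; infer_instance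

lemma mono (h : D ≤ D') : PolyFun n D ≤ PolyFun n D' := fun f hf => by
  obtain ⟨P, hP, e⟩ := mem_iff.1 hf
  exact mem_iff.2 ⟨P, hP.trans h, e⟩

lemma mul (hf : f ∈ PolyFun n D) (hg : g ∈ PolyFun n D') :
    (fun x => f x * g x) ∈ PolyFun n (D + D') := by
  obtain ⟨P, hP, e⟩ := mem_iff.1 hf
  obtain ⟨Q, hQ, e'⟩ := mem_iff.1 hg
  exact mem_iff.2 ⟨P * Q, (MvPolynomial.totalDegree_mul _ _).trans (add_le_add hP hQ),
    fun x => by simp [e, e']⟩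

lemma const (c : ℝ) : (fun _ => c) ∈ PolyFun n D := mem_iff.2 ⟨MvPolynomial.C c, by simp, by simp⟩

lemma sum {ι : Type*} {s : Finset ι} {f : ι → E n → ℝ} (h : ∀ i ∈ s, f i ∈ PolyFun n D) :
    (fun x => ∑ i ∈ s, f i x) ∈ PolyFun n D := by
  convert Submodule.sum_mem _ h using 1; ext; simp

lemma coord (i : Fin n) : (fun x : E n => x i) ∈ PolyFun n 1 :=
  mem_iff.2 ⟨MvPolynomial.X i, by simp, by simp⟩

lemma add (hf : f ∈ PolyFun n D) (hg : g ∈ PolyFun n D) : (fun x => f x + g x) ∈ PolyFun n D :=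
  Submodule.add_mem _ hf hg

lemma sub (hf : f ∈ PolyFun n D) (hg : g ∈ PolyFun n D) : (fun x => f x - g x) ∈ PolyFun n D :=
  Submodule.sub_mem _ hf hg

lemma const_mul (c : ℝ) (hf : f ∈ PolyFun n D) : (fun x => c * f x) ∈ PolyFun n D :=
  Submodule.smul_mem _ c hf

lemma inner_left (u : E n) : (fun x : E n => inner ℝ u x) ∈ PolyFun n 1 := by
  simp only [PiLp.inner_apply]
  exact sum fun i _ => by
    simpa [mul_comm] using const_mul (u i) (coord i)

lemma pow (hf : f ∈ PolyFun n 1) (k : ℕ) : (fun x => f x ^ k) ∈ PolyFun n k := by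
  induction k with
  | zero => simpa using const 1
  | succ k ih => simpa only [pow_succ] using mul ih hf

lemma prod_pow {ι : Type*} (s : Finset ι) (g : ι → E n → ℝ) (k : ι → ℕ)
    (hg : ∀ i ∈ s, g i ∈ PolyFun n 1) :
    (fun x => ∏ i ∈ s, g i x ^ k i) ∈ PolyFun n (∑ i ∈ s, k i) := by
  classical
  induction s using Finset.induction_on with
  | empty => simpa using const 1
  | insert a s ha ih =>
    simp only [Finset.prod_insert ha, Finset.sum_insert ha]
    exact mul (pow (hg _ (Finset.mem_insert_self _ _)) _)
      (ih fun i hi => hg i (Finset.mem_insert_of_mem hi))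

/-- A polynomial of degree at most `D` in affine functions is a polynomial of degree at most `D`. -/
lemma eval_affine (P : MvPolynomial (Fin m) ℝ) (hP : P.totalDegree ≤ D) {φ : E n → Fin m → ℝ}
    (hφ : ∀ i, (fun x => φ x i) ∈ PolyFun n 1) :
    (fun x => MvPolynomial.eval (φ x) P) ∈ PolyFun n D := by
  simp only [MvPolynomial.eval_eq]
  refine sum fun s hs => const_mul _ ?_
  refine mono ?_ (prod_pow s.support (fun i x => φ x i) s fun i _ => hφ i)
  exact (MvPolynomial.le_totalDegree hs).trans hP

lemma comp (hf : f ∈ PolyFun n D) {φ : E m → E n} (hφ : ∀ i, (fun x => φ x i) ∈ PolyFun m 1) :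
    (fun x => f (φ x)) ∈ PolyFun m D := by
  obtain ⟨P, hP, e⟩ := mem_iff.1 hf
  simp only [e]
  exact eval_affine P hP (φ := fun x i => φ x i) hφ

lemma analytic (hf : f ∈ PolyFun n D) : AnalyticOnNhd ℝ f univ := by
  obtain ⟨P, hP, e⟩ := mem_iff.1 hf
  have := AnalyticOnNhd.eval_continuousLinearMap
    (EuclideanSpace.equiv (Fin n) ℝ : E n →L[ℝ] Fin n → ℝ) P
  exact (funext e : f = _) ▸ this

lemma contDiff (hf : f ∈ PolyFun n D) : ContDiff ℝ ∞ f :=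
  (contDiffOn_univ.1 (analytic hf).contDiffOn_of_completeSpace)

/-- The derivative is the pointwise limit of difference quotients, which are polynomials of degree
at most D; a finite-dimensional subspace is closed, so it contains the limit. -/
lemma fderiv_apply (hf : f ∈ PolyFun n D) (u : E n) : (fun x => fderiv ℝ f x u) ∈ PolyFun n D := by
  have hcl := (PolyFun n D).closed_of_finiteDimensional
  have hlim : Tendsto (fun (t : ℝ) (x : E n) => t⁻¹ * (f (x + t • u) - f x)) (𝓝[≠] 0)
      (𝓝 fun x => fderiv ℝ f x u) := by
    refine tendsto_pi_nhds.2 fun x => ?_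
    have := (((contDiff hf).differentiable (by simp) x).hasFDerivAt.hasLineDerivAt u)
    simpa using this.tendsto_slope_zero
  refine hcl.mem_of_tendsto hlim (Eventually.of_forall fun t => ?_)
  refine const_mul _ (sub (comp hf fun i => ?_) hf)
  simpa using add (coord i) (const ((t • u) i))

/-- By continuity the function vanishes everywhere on the ball, then everywhere by analytic
continuation. -/
lemma eq_zero_of_ae_ball (hf : f ∈ PolyFun n D) {x : E n} {r : ℝ} (hr : 0 < r)
    (h : ∀ᵐ y ∂volume.restrict (Metric.ball x r), f y = 0) : f = 0 := by
  have h1 := (contDiff hf).continuous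
  have : EqOn f 0 (Metric.ball x r) :=
    Measure.eqOn_open_of_ae_eq h Metric.isOpen_ball h1.continuousOn continuousOn_const
  funext y
  exact ((analytic hf).eqOn_of_preconnected_of_eventuallyEq (fun _ _ => analyticAt_const)
    isPreconnected_univ (mem_univ x) (Filter.eventuallyEq_of_mem (Metric.ball_mem_nhds x hr) this))
      (mem_univ y)

/-- On polynomials, the values and the derivatives on the unit ball are controlled by the
quadratic mean over any concentric ball. -/
lemma exists_bound_unit (n D : ℕ) {ρ : ℝ} (hρ : 0 < ρ) : ∃ C : ℝ, 0 < C ∧ ∀ f ∈ PolyFun n D,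
    ∀ x, ‖x‖ ≤ 1 → f x ^ 2 ≤ C * ∫ y in Metric.ball 0 ρ, f y ^ 2 ∧
      ‖fderiv ℝ f x‖ ^ 2 ≤ C * ∫ y in Metric.ball 0 ρ, f y ^ 2 := by
  set μ : Measure (E n) := volume.restrict (Metric.ball 0 ρ)
  have hmem : ∀ f ∈ PolyFun n D, MemLp f 2 μ := fun f hf => by
    have : IsFiniteMeasure μ := isFiniteMeasure_restrict.2 measure_ball_lt_top.ne
    exact memLp_restrict_of_continuous (isCompact_closedBall 0 ρ) measurableSet_ball
      Metric.ball_subset_closedBall (contDiff hf).continuous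
  let T : PolyFun n D →ₗ[ℝ] Lp ℝ 2 μ :=
    { toFun := fun f => (hmem f f.2).toLp f
      map_add' := fun _ _ => rfl
      map_smul' := fun _ _ => rfl }
  have hT : ∀ f : PolyFun n D, ‖T f‖ ^ 2 = ∫ y in Metric.ball 0 ρ, (f : E n → ℝ) y ^ 2 := fun f => by
    rw [← real_inner_self_eq_norm_sq, L2.inner_def]
    refine integral_congr_ae ((hmem f f.2).coeFn_toLp.mono fun y hy => ?_)
    have hy' : (T f : E n → ℝ) y = (f : E n → ℝ) y := hy
    simp [hy', sq]
  set b := Module.finBasis ℝ (PolyFun n D)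
  -- Injectivity of T and finite dimension make T antilipschitz in coordinates: the quadratic mean
  -- on the small ball controls the coefficients in the basis, and these control values and
  -- derivatives on the unit ball.
  have hker : LinearMap.ker (T ∘ₗ b.equivFun.symm.toLinearMap) = ⊥ := by
    rw [LinearMap.ker_eq_bot']
    intro c hc
    have h0 : (b.equivFun.symm c : E n → ℝ) = 0 := by
      refine eq_zero_of_ae_ball (b.equivFun.symm c).2 hρ (x := 0) ?_
      have : T (b.equivFun.symm c) = 0 := hc
      have h2 := (hmem _ (b.equivFun.symm c).2).coeFn_toLp
      have h3 : (hmem _ (b.equivFun.symm c).2).toLp _ = 0 := this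
      rw [h3] at h2
      exact (h2.symm.trans (Lp.coeFn_zero _ _ _))
    have : b.equivFun.symm c = 0 := Subtype.ext h0
    exact b.equivFun.symm.map_eq_zero_iff.1 this
  obtain ⟨K, hK, hKT⟩ := LinearMap.exists_antilipschitzWith _ hker
  have hbd : ∀ i, ∃ M : ℝ, ∀ x : E n, ‖x‖ ≤ 1 →
      |(b i : E n → ℝ) x| ≤ M ∧ ‖fderiv ℝ (b i : E n → ℝ) x‖ ≤ M := fun i => by
    have h1 := (contDiff (b i).2)
    obtain ⟨M1, hM1⟩ := (isCompact_closedBall (0 : E n) 1).exists_bound_of_continuousOn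
      h1.continuous.continuousOn
    obtain ⟨M2, hM2⟩ := (isCompact_closedBall (0 : E n) 1).exists_bound_of_continuousOn
      (h1.continuous_fderiv (by simp)).continuousOn
    refine ⟨max M1 M2, fun x hx => ⟨?_, ?_⟩⟩
    · exact (hM1 x (by simpa using hx)).trans (le_max_left _ _)
    · exact (hM2 x (by simpa using hx)).trans (le_max_right _ _)
  choose M hM using hbd
  set B : ℝ := ∑ i, |M i| with hB
  have hB0 : 0 ≤ B := Finset.sum_nonneg fun i _ => abs_nonneg _
  -- The added 1 only makes the constant positive.
  refine ⟨(K * B) ^ 2 + 1, by positivity, fun f hf x hx => ?_⟩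
  set c := b.equivFun ⟨f, hf⟩ with hc
  have hcf : b.equivFun.symm c = ⟨f, hf⟩ := by simp [hc]
  have hfc : f = ∑ i, c i • (b i : E n → ℝ) := by
    have := congrArg Subtype.val hcf
    rw [Module.Basis.equivFun_symm_apply] at this
    simpa using this.symm
  have hI : ‖c‖ ^ 2 ≤ K ^ 2 * ∫ y in Metric.ball 0 ρ, f y ^ 2 := by
    rw [← hT ⟨f, hf⟩, ← mul_pow]
    refine pow_le_pow_left₀ (norm_nonneg _) ?_ 2
    have := ZeroHomClass.bound_of_antilipschitz _ hKT c
    simpa [hcf] using this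
  have hI0 : 0 ≤ ∫ y in Metric.ball 0 ρ, f y ^ 2 := integral_nonneg fun y => sq_nonneg _
  have hfin : ∀ t : ℝ, 0 ≤ t → t ≤ ‖c‖ * B →
      t ^ 2 ≤ ((K * B) ^ 2 + 1) * ∫ y in Metric.ball 0 ρ, f y ^ 2 := fun t ht h => by
    calc t ^ 2 ≤ (‖c‖ * B) ^ 2 := pow_le_pow_left₀ ht h 2
      _ = ‖c‖ ^ 2 * B ^ 2 := by ring
      _ ≤ (K ^ 2 * ∫ y in Metric.ball 0 ρ, f y ^ 2) * B ^ 2 := by gcongr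
      _ ≤ _ := by nlinarith
  constructor
  · rw [← sq_abs]
    refine hfin _ (abs_nonneg _) ?_
    rw [hfc, Finset.sum_apply, hB, Finset.mul_sum]
    refine (Finset.abs_sum_le_sum_abs _ _).trans (Finset.sum_le_sum fun i _ => ?_)
    rw [Pi.smul_apply, smul_eq_mul, abs_mul]
    exact mul_le_mul (norm_le_pi_norm c i) (((hM i x hx).1).trans (le_abs_self _)) (abs_nonneg _)
      (norm_nonneg _)
  · refine hfin _ (norm_nonneg _) ?_
    have hd : ∀ i, DifferentiableAt ℝ (b i : E n → ℝ) x := fun i =>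
      (contDiff (b i).2).differentiable (by simp) x
    rw [hfc, fderiv_sum fun i _ => (hd i).const_smul _, hB, Finset.mul_sum]
    refine (norm_sum_le _ _).trans (Finset.sum_le_sum fun i _ => ?_)
    rw [fderiv_const_smul (hd i), norm_smul]
    exact mul_le_mul (norm_le_pi_norm c i) (((hM i x hx).2).trans (le_abs_self _)) (norm_nonneg _)
      (norm_nonneg _)

/-- Scaled version of `exists_bound_unit`. -/
lemma exists_bound (n D : ℕ) {ρ : ℝ} (hρ : 0 < ρ) : ∃ C : ℝ, 0 < C ∧ ∀ f ∈ PolyFun n D,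
    ∀ (x₀ : E n) (h : ℝ), 0 < h → ∀ x, dist x x₀ ≤ h →
      f x ^ 2 ≤ C / h ^ n * ∫ y in Metric.ball x₀ (ρ * h), f y ^ 2 ∧
      h ^ 2 * ‖fderiv ℝ f x‖ ^ 2 ≤ C / h ^ n * ∫ y in Metric.ball x₀ (ρ * h), f y ^ 2 := by
  obtain ⟨C, hC, H⟩ := exists_bound_unit n D hρ
  refine ⟨C, hC, fun f hf x₀ h hh x hx => ?_⟩
  -- Under this homothety the values are unchanged, the derivative gains a factor h and the integral
  -- a factor h^{-n}; one constant therefore serves all centres and all sizes.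
  set φ : E n → E n := fun y => x₀ + h • y with hφ
  have hg : (fun y => f (φ y)) ∈ PolyFun n D := comp hf fun i => by
    simpa [hφ] using add (const (D := 1) (x₀ i)) (const_mul h (coord i))
  have hint : ∫ y in Metric.ball 0 ρ, f (φ y) ^ 2 =
      (h ^ n)⁻¹ * ∫ y in Metric.ball x₀ (ρ * h), f y ^ 2 := by
    have h1 := Measure.setIntegral_comp_smul_of_pos (volume : Measure (E n))
      (fun y => f (x₀ + y) ^ 2) (Metric.ball 0 ρ) hh
    rw [finrank_euclideanSpace_fin, smul_eq_mul] at h1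
    simp only [hφ]
    rw [h1, smul_ball hh.ne', smul_zero, Real.norm_of_nonneg hh.le, mul_comm h ρ]
    congr 1
    have h2 := (measurePreserving_add_left (volume : Measure (E n)) x₀).setIntegral_preimage_emb
      (measurableEmbedding_addLeft x₀) (fun y => f y ^ 2) (Metric.ball x₀ (ρ * h))
    rw [← h2]
    congr 2
    ext y; simp
  set y := h⁻¹ • (x - x₀) with hy
  have hxy : φ y = x := by simp [hφ, hy, smul_smul, hh.ne']
  have hy1 : ‖y‖ ≤ 1 := by
    rw [hy, norm_smul, norm_inv, Real.norm_of_nonneg hh.le, ← dist_eq_norm]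
    exact (inv_mul_le_one₀ hh).2 hx
  have hd : fderiv ℝ (fun y => f (φ y)) y = h • fderiv ℝ f x := by
    have h1 : HasFDerivAt φ (h • ContinuousLinearMap.id ℝ (E n)) y :=
      ((hasFDerivAt_id y).const_smul h).const_add x₀
    have h2 : HasFDerivAt f (fderiv ℝ f x) (φ y) := by
      rw [hxy]; exact ((contDiff hf).differentiable (by simp) x).hasFDerivAt
    have h3 : HasFDerivAt (fun y => f (φ y)) _ y := h2.comp y h1
    rw [h3.fderiv]
    ext v; simp
  have := H _ hg y hy1
  rw [hint, hxy, hd, norm_smul, Real.norm_of_nonneg hh.le, mul_pow, ← mul_assoc,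
    ← div_eq_mul_inv] at this
  exact this

end PolyFun

/-! ### Geometry of the cells -/

/-- A cell is given by finitely many normalised affine inequalities, with a well-centred interior
point and a well-centred point on each facet. -/
structure Ineq {d : ℕ} (K : Cell d) (J : Type) (g : J → E d) (c : J → ℝ) (θ : ℝ) : Prop where
  mem_iff : ∀ x, x ∈ K.carrier ↔ ∀ j, 0 ≤ inner ℝ (g j) x + c j
  le_one : ∀ x ∈ K.carrier, ∀ j, inner ℝ (g j) x + c j ≤ 1
  facet : ∀ F ∈ K.facets, ∃ j, F = {x ∈ K.carrier | inner ℝ (g j) x + c j = 0}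
  face_point : ∀ j, ∃ z, inner ℝ (g j) z + c j = 0 ∧ ∀ i, i ≠ j → θ ≤ inner ℝ (g i) z + c i
  center : ∃ z, ∀ i, θ ≤ inner ℝ (g i) z + c i

/-- The normalised affine functions are the barycentric coordinates. They all equal 1/(n+2) at the
barycentre; at the barycentre of a facet the n+1 nonzero ones equal 1/(n+1), which is larger. -/
lemma exists_ineq_simplex {n : ℕ} (s : Affine.Simplex ℝ (E (n + 1)) (n + 1)) :
    ∃ g c, Ineq (Cell.simplex s) (Fin (n + 2)) g c (1 / (n + 2)) := by
  classical
  set b : AffineBasis (Fin (n + 2)) ℝ (E (n + 1)) :=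
    ⟨s.points, s.independent, s.span_eq_top (by simp)⟩ with hb
  have hbp : ∀ i, b i = s.points i := fun i => rfl
  let g : Fin (n + 2) → E (n + 1) := fun j =>
    (InnerProductSpace.toDual ℝ (E (n + 1))).symm (b.coord j).linear.toContinuousLinearMap
  have hg : ∀ j x, inner ℝ (g j) x + b.coord j 0 = b.coord j x := fun j x => by
    simp only [g, InnerProductSpace.toDual_symm_apply, LinearMap.coe_toContinuousLinearMap']
    have := (b.coord j).decomp
    rw [congrFun this x]; simp
  have hK : ∀ x, x ∈ (Cell.simplex s).carrier ↔ ∀ j, 0 ≤ b.coord j x := fun x => by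
    have := b.convexHull_eq_nonneg_coord
    show x ∈ convexHull ℝ (range b) ↔ _
    rw [this]; rfl
  have hcomb : ∀ w : Fin (n + 2) → ℝ, ∑ i, w i = 1 → ∃ z, ∀ i, b.coord i z = w i := fun w hw =>
    ⟨Finset.univ.affineCombination ℝ b w, fun i =>
      b.coord_apply_combination_of_mem (Finset.mem_univ i) hw⟩
  have hpos : (0 : ℝ) < n + 2 := by positivity
  refine ⟨g, fun j => b.coord j 0, ?_, ?_, ?_, ?_, ?_⟩ <;> simp only [hg]
  · exact hK
  · intro x hx j
    rw [← b.sum_coord_apply_eq_one x]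
    exact Finset.single_le_sum (fun i _ => (hK x).1 hx i) (Finset.mem_univ j)
  · intro F hF
    obtain ⟨i, -, rfl⟩ := Finset.mem_image.1 hF
    refine ⟨i, Subset.antisymm (convexHull_min ?_ ?_) ?_⟩
    · rintro _ ⟨j, hj, rfl⟩
      refine ⟨subset_convexHull ℝ _ ⟨j, rfl⟩, ?_⟩
      rw [← hbp, b.coord_apply_ne (Ne.symm hj)]
    · refine (convex_convexHull ℝ _).inter ?_
      exact (convex_singleton (0 : ℝ)).affine_preimage (b.coord i)
    -- A point whose i-th barycentric coordinate vanishes is a convex combination of the other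
    -- vertices.
    · rintro x ⟨hx, hxi⟩
      rw [← b.linear_combination_coord_eq_self x, ← Finset.sum_erase (s := Finset.univ) (a := i)]
      · refine (convex_convexHull ℝ _).sum_mem (fun j _ => (hK x).1 hx j) ?_ fun j hj => ?_
        · rw [Finset.sum_erase (f := fun i => b.coord i x) _ hxi, b.sum_coord_apply_eq_one]
        · exact subset_convexHull ℝ _ ⟨j, (Finset.ne_of_mem_erase hj), rfl⟩
      · rw [hxi, zero_smul]
  · intro j
    obtain ⟨z, hz⟩ := hcomb (fun i => if i = j then 0 else 1 / (n + 1)) (by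
      rw [Finset.sum_ite, Finset.sum_const_zero, Finset.sum_const, Finset.filter_ne',
        Finset.card_erase_of_mem (Finset.mem_univ j)]
      simp
      field_simp)
    refine ⟨z, by simp [hz], fun i hi => ?_⟩
    rw [hz, if_neg hi]
    gcongr; linarith
  · obtain ⟨z, hz⟩ := hcomb (fun i => 1 / (n + 2)) (by simp; field_simp)
    exact ⟨z, fun i => (hz i).ge⟩

/-- Each edge contributes (x_i - a_i)/(b_i - a_i) and its complement to 1. Both equal 1/2 ≥ 1/(n+2)
at a midpoint, and on a facet the function of the opposite facet equals 1. -/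
lemma exists_ineq_box {n : ℕ} (e : OrthonormalBasis (Fin (n + 1)) ℝ (E (n + 1)))
    (a b : Fin (n + 1) → ℝ) (hab : ∀ i, a i < b i) :
    ∃ g c, Ineq (Cell.box e a b hab) (Fin (n + 1) ⊕ Fin (n + 1)) g c (1 / (n + 2)) := by
  classical
  have hpos : ∀ i, 0 < b i - a i := fun i => sub_pos.2 (hab i)
  let g : Fin (n + 1) ⊕ Fin (n + 1) → E (n + 1) :=
    Sum.elim (fun i => (b i - a i)⁻¹ • e i) fun i => -((b i - a i)⁻¹ • e i)
  let c : Fin (n + 1) ⊕ Fin (n + 1) → ℝ :=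
    Sum.elim (fun i => -(b i - a i)⁻¹ * a i) fun i => (b i - a i)⁻¹ * b i
  have hl : ∀ i x, inner ℝ (g (Sum.inl i)) x + c (Sum.inl i) = (e.repr x i - a i) / (b i - a i) :=
    fun i x => by
      simp only [g, c, Sum.elim_inl, inner_smul_left, OrthonormalBasis.repr_apply_apply]
      simp; ring
  have hr : ∀ i x, inner ℝ (g (Sum.inr i)) x + c (Sum.inr i) = (b i - e.repr x i) / (b i - a i) :=
    fun i x => by
      simp only [g, c, Sum.elim_inr, inner_neg_left, inner_smul_left,
        OrthonormalBasis.repr_apply_apply]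
      simp; ring
  have hθ : (1 : ℝ) / (n + 2) ≤ 1 / 2 := by gcongr; linarith [(Nat.cast_nonneg n : (0 : ℝ) ≤ n)]
  have hmid1 : ∀ i, ((a i + b i) / 2 - a i) / (b i - a i) = 1 / 2 := fun i => by
    have := (hpos i).ne'; field_simp; ring
  have hmid2 : ∀ i, (b i - (a i + b i) / 2) / (b i - a i) = 1 / 2 := fun i => by
    have := (hpos i).ne'; field_simp; ring
  refine ⟨g, c, ?_, ?_, ?_, ?_, ?_⟩
  · intro x
    rw [Sum.forall]
    simp only [hl, hr]
    show (∀ i, _ ∧ _) ↔ _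
    rw [forall_and]
    refine and_congr (forall_congr' fun i => ?_) (forall_congr' fun i => ?_)
    · rw [le_div_iff₀ (hpos i)]; constructor <;> intro h <;> linarith
    · rw [le_div_iff₀ (hpos i)]; constructor <;> intro h <;> linarith
  · rintro x hx (i | i)
    · rw [hl, div_le_one (hpos i)]; linarith [(hx i).2]
    · rw [hr, div_le_one (hpos i)]; linarith [(hx i).1]
  · intro F hF
    rcases Finset.mem_union.1 hF with hF | hF
    · obtain ⟨i, -, rfl⟩ := Finset.mem_image.1 hF
      refine ⟨Sum.inl i, ?_⟩
      ext x
      simp only [hl, mem_ofPred_eq, div_eq_zero_iff, (hpos i).ne', or_false, sub_eq_zero]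
    · obtain ⟨i, -, rfl⟩ := Finset.mem_image.1 hF
      refine ⟨Sum.inr i, ?_⟩
      ext x
      simp only [hr, mem_ofPred_eq, div_eq_zero_iff, (hpos i).ne', or_false, sub_eq_zero]
      rw [eq_comm (a := b i)]
  · rintro (j | j)
    · refine ⟨e.repr.symm (WithLp.toLp 2 (Function.update (fun i => (a i + b i) / 2) j (a j))),
        ?_, ?_⟩
      · simp [hl]
      · rintro (i | i) hi
        · have : i ≠ j := fun h => hi (h ▸ rfl)
          simpa [hl, this, hmid1] using hθ
        · by_cases h : i = j
          · subst h; simp only [hr, LinearIsometryEquiv.apply_symm_apply, Function.update_self,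
              div_self (hpos i).ne']; linarith
          · simpa [hr, h, hmid2] using hθ
    · refine ⟨e.repr.symm (WithLp.toLp 2 (Function.update (fun i => (a i + b i) / 2) j (b j))),
        ?_, ?_⟩
      · simp [hr]
      · rintro (i | i) hi
        · by_cases h : i = j
          · subst h; simp only [hl, LinearIsometryEquiv.apply_symm_apply, Function.update_self,
              div_self (hpos i).ne']; linarith
          · simpa [hl, h, hmid1] using hθ
        · have : i ≠ j := fun h => hi (h ▸ rfl)
          simpa [hr, this, hmid2] using hθ
  · refine ⟨e.repr.symm (WithLp.toLp 2 fun i => (a i + b i) / 2), ?_⟩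
    rintro (i | i)
    · simpa [hl, hmid1] using hθ
    · simpa [hr, hmid2] using hθ

lemma exists_ineq {n : ℕ} (K : Cell (n + 1)) :
    ∃ (J : Type) (_ : Fintype J) (g : J → E (n + 1)) (c : J → ℝ), Nonempty J ∧
      Ineq K J g c (1 / (n + 2)) := by
  cases K with
  | simplex s =>
    obtain ⟨g, c, h⟩ := exists_ineq_simplex s
    exact ⟨_, inferInstance, g, c, inferInstance, h⟩
  | box e a b hab =>
    obtain ⟨g, c, h⟩ := exists_ineq_box e a b hab
    exact ⟨_, inferInstance, g, c, inferInstance, h⟩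

namespace Cell

variable {n : ℕ} (K : Cell (n + 1))

lemma isCompact_carrier : IsCompact K.carrier := by
  cases K with
  | simplex s => exact (finite_range s.points).isCompact_convexHull (𝕜 := ℝ)
  | box e a b hab =>
    have h : IsCompact (WithLp.toLp 2 '' Icc a b : Set (E (n + 1))) :=
      isCompact_Icc.image (PiLp.continuous_toLp 2 _)
    have hc : (Cell.box e a b hab).carrier = e.repr.symm '' (WithLp.toLp 2 '' Icc a b) := by
      ext x
      simp only [carrier, mem_ofPred_eq, mem_image, exists_exists_and_eq_and]
      constructor
      · intro hx
        exact ⟨fun i => e.repr x i, ⟨fun i => (hx i).1, fun i => (hx i).2⟩,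
          e.repr.symm_apply_apply x⟩
      · rintro ⟨y, hy, rfl⟩ i
        simpa using ⟨hy.1 i, hy.2 i⟩
    rw [hc]
    exact h.image e.repr.symm.continuous

lemma convex_carrier : Convex ℝ K.carrier := by
  cases K with
  | simplex s => exact convex_convexHull _ _
  | box e a b hab =>
    rw [show (Cell.box e a b hab).carrier = ⋂ i, {x | a i ≤ e.repr x i} ∩ {x | e.repr x i ≤ b i} by
      ext; simp [carrier]]
    have hlin : ∀ i, IsLinearMap ℝ fun x => e.repr x i := fun i =>
      ⟨fun x y => by simp, fun c x => by simp⟩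
    exact convex_iInter fun i => (convex_halfSpace_ge (hlin i) _).inter (convex_halfSpace_le (hlin i) _)

lemma measurableSet_carrier : MeasurableSet K.carrier := K.isCompact_carrier.measurableSet

lemma dist_le_diam {x y : E (n + 1)} (hx : x ∈ K.carrier) (hy : y ∈ K.carrier) :
    dist x y ≤ K.diam := Metric.dist_le_diam_of_mem K.isCompact_carrier.isBounded hx hy

lemma volume_frontier : volume (frontier K.carrier) = 0 := K.convex_carrier.addHaar_frontier _

end Cell

/-- The frame `Fr` describes the facet `F` of the cell `K`: its hyperplane supports `K` along `F`,
and the half ball of radius `r` around its base point is contained in `K`. -/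
structure IsFacetFrame {n : ℕ} (K : Cell (n + 1)) (F : Set (E (n + 1))) (Fr : Frame n) (r : ℝ) :
    Prop where
  carrier_subset : K.carrier ⊆ Fr.half
  facet_eq : F = K.carrier ∩ Fr.plane
  ball_subset : Metric.ball Fr.z r ∩ Fr.half ⊆ K.carrier

/-- The ratio of the inner radii to the diameter of a cell of shape regularity `κ`. -/
def innerRatio (n : ℕ) (κ : ℝ) : ℝ := κ / (2 ^ n * (n + 2))

lemma innerRatio_pos {n : ℕ} {κ : ℝ} (hκ : 0 < κ) : 0 < innerRatio n κ := by
  unfold innerRatio; positivity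

namespace Frame

variable {n : ℕ} (Fr : Frame n)

lemma height_z : Fr.height Fr.z = 0 := by simp [height]

lemma z_mem_plane : Fr.z ∈ Fr.plane := Fr.height_z

lemma height_add (x w : E (n + 1)) : Fr.height (x + w) = Fr.height x + inner ℝ Fr.ν w := by
  rw [height, height, add_sub_right_comm, inner_add_right]

lemma height_eq_of {x : E (n + 1)} (hx : x ∈ Fr.plane) (y : E (n + 1)) :
    Fr.height y = inner ℝ Fr.ν (y - x) := by
  have := Fr.height_add x (y - x)
  rwa [add_sub_cancel, show Fr.height x = 0 from hx, zero_add] at this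

lemma inner_ν_ν : inner ℝ Fr.ν Fr.ν = (1 : ℝ) := by
  rw [real_inner_self_eq_norm_sq, norm_ν, one_pow]

lemma dimH_plane : dimH Fr.plane = n := by
  rw [← range_chart, ← image_univ, Fr.isometry_chart.dimH_image, Real.dimH_univ_eq_finrank]
  simp

lemma norm_proj_le (x : E (n + 1)) : ‖Fr.proj x‖ ≤ ‖x - Fr.z‖ := by
  have h0 : Fr.chart 0 = Fr.z := by simp [chart]
  have h1 : ‖Fr.proj x‖ = ‖Fr.chart (Fr.proj x) - Fr.z‖ := by
    rw [← h0, ← dist_eq_norm, Fr.isometry_chart.dist_eq, dist_zero_right]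
  have h2 : x - Fr.z = (Fr.chart (Fr.proj x) - Fr.z) + Fr.height x • Fr.ν := by
    rw [sub_add_eq_add_sub, chart_proj_add]
  have h3 : inner ℝ (Fr.chart (Fr.proj x) - Fr.z) (Fr.height x • Fr.ν) = (0 : ℝ) := by
    rw [inner_smul_right, real_inner_comm]
    have := Fr.height_chart (Fr.proj x)
    rw [height] at this
    rw [this, mul_zero]
  rw [h1, ← sq_le_sq₀ (norm_nonneg _) (norm_nonneg _), h2, norm_add_sq_real, h3]
  nlinarith [sq_nonneg ‖Fr.height x • Fr.ν‖]

lemma chart_zero : Fr.chart 0 = Fr.z := by simp [chart]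

lemma preimage_ball_chart (r : ℝ) : Fr.chart ⁻¹' Metric.ball Fr.z r = Metric.ball 0 r := by
  rw [← chart_zero, Fr.isometry_chart.preimage_ball]

end Frame

/-! ### Steepness of the face functions of a shape-regular cell -/

namespace Ineq

variable {n : ℕ} {K : Cell (n + 1)} {J : Type} {g : J → E (n + 1)} {c : J → ℝ} {θ : ℝ}

lemma exists_face_mem (H : Ineq K J g c θ) (hθ : 0 < θ) (j : J) :
    ∃ z ∈ K.carrier, inner ℝ (g j) z + c j = 0 ∧ ∀ i, i ≠ j → θ ≤ inner ℝ (g i) z + c i := by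
  obtain ⟨z, h0, h⟩ := H.face_point j
  refine ⟨z, (H.mem_iff z).2 fun i => ?_, h0, h⟩
  by_cases hij : i = j
  · subst hij; exact h0.ge
  · exact hθ.le.trans (h i hij)

lemma exists_center_mem (H : Ineq K J g c θ) (hθ : 0 < θ) :
    ∃ z ∈ K.carrier, ∀ i, θ ≤ inner ℝ (g i) z + c i := by
  obtain ⟨z, h⟩ := H.center
  exact ⟨z, (H.mem_iff z).2 fun i => hθ.le.trans (h i), h⟩

lemma ne_zero (H : Ineq K J g c θ) (hθ : 0 < θ) (j : J) : g j ≠ 0 := fun h0 => by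
  obtain ⟨z, -, h1, -⟩ := H.exists_face_mem hθ j
  obtain ⟨x, -, h2⟩ := H.exists_center_mem hθ
  have := h2 j
  simp [h0] at h1 this
  linarith

lemma diam_pos [Nonempty J] (H : Ineq K J g c θ) (hθ : 0 < θ) : 0 < K.diam := by
  obtain ⟨j⟩ := ‹Nonempty J›
  obtain ⟨z, hz, h1, -⟩ := H.exists_face_mem hθ j
  obtain ⟨x, hx, h2⟩ := H.exists_center_mem hθ
  refine (dist_pos.2 ?_).trans_le (K.dist_le_diam hx hz)
  rintro rfl
  linarith [h2 j]

/-- A cell lies in the slab cut out by one of its normalised inequalities; hence these cannot be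
too steep. -/
lemma norm_le [Nonempty J] (H : Ineq K J g c θ) (hθ : 0 < θ) {κ : ℝ} (hκ : κ ≤ K.shapeRegularity)
    (j : J) : κ * K.diam * ‖g j‖ ≤ 2 ^ n := by
  have hh := H.diam_pos hθ
  have hg : 0 < ‖g j‖ := norm_pos_iff.2 (H.ne_zero hθ j)
  obtain ⟨x₀, hx₀, -⟩ := H.exists_center_mem hθ
  obtain ⟨Fr, rfl, hν⟩ := exists_frame x₀ (‖g j‖⁻¹ • g j) (by
    rw [norm_smul, norm_inv, norm_norm, inv_mul_cancel₀ hg.ne'])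
  set α := -(inner ℝ (g j) Fr.z + c j) / ‖g j‖ with hα
  -- In a frame based at an interior point with normal along g j, the first coordinate on K stays in
  -- an interval of length 1/‖g j‖, and the others are at most the diameter. The volume is then at
  -- most (2h)^n/‖g j‖, to be compared with κ h^{n+1}.
  have hsub : Fr.cart ⁻¹' K.carrier ⊆ Icc (Fin.cons α fun _ => -K.diam)
      (Fin.cons (α + 1 / ‖g j‖) fun _ => K.diam) := by
    intro t ht
    have ht0 : inner ℝ (g j) (Fr.cart t) + c j = ‖g j‖ * (t 0 - α) := by
      have h1 := Fr.height_cart t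
      rw [Frame.height, hν, inner_smul_left, inner_sub_right] at h1
      simp only [conj_trivial] at h1
      rw [← h1, hα]; field_simp; ring
    have hlo := (H.mem_iff _).1 ht j
    have hhi := H.le_one _ ht j
    rw [ht0] at hlo hhi
    have hlo' : α ≤ t 0 := by
      have := nonneg_of_mul_nonneg_right hlo hg
      linarith
    have hhi' : t 0 ≤ α + 1 / ‖g j‖ := by
      rw [← sub_le_iff_le_add', le_div_iff₀ hg]; linarith
    have hk : ∀ k, |t k| ≤ K.diam := fun k => by
      have h2 := abs_real_inner_le_norm (Fr.o k) (Fr.cart t - Fr.z)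
      rw [Frame.coord_cart, Fr.o.orthonormal.1 k, one_mul, ← dist_eq_norm] at h2
      exact h2.trans (K.dist_le_diam ht hx₀)
    constructor <;> intro k <;> refine Fin.cases ?_ (fun k => ?_) k
    · simpa using hlo'
    · simpa using (abs_le.1 (hk k.succ)).1
    · simpa using hhi'
    · simpa using (abs_le.1 (hk k.succ)).2
  have hvol : volume K.carrier ≤ ENNReal.ofReal ((1 / ‖g j‖) * (2 * K.diam) ^ n) := by
    rw [← Fr.measurePreserving_cart.measure_preimage_emb Fr.measurableEmbedding_cart]
    refine (measure_mono hsub).trans ?_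
    rw [Real.volume_Icc_pi, Fin.prod_univ_succ]
    simp only [Fin.cons_zero, Fin.cons_succ, Finset.prod_const, Finset.card_univ, Fintype.card_fin]
    rw [add_sub_cancel_left, sub_neg_eq_add, ← two_mul, ← ENNReal.ofReal_pow (by positivity),
      ← ENNReal.ofReal_mul (by positivity)]
  have h2 : volume.real K.carrier ≤ (1 / ‖g j‖) * (2 * K.diam) ^ n :=
    ENNReal.toReal_le_of_le_ofReal (by positivity) hvol
  have h3 : κ * K.diam ^ (n + 1) ≤ volume.real K.carrier := by
    rwa [Cell.shapeRegularity, le_div_iff₀ (by positivity)] at hκ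
  have h4 : κ * K.diam ^ (n + 1) * ‖g j‖ ≤ (2 * K.diam) ^ n := by
    calc κ * K.diam ^ (n + 1) * ‖g j‖ ≤ ((1 / ‖g j‖) * (2 * K.diam) ^ n) * ‖g j‖ :=
          mul_le_mul_of_nonneg_right (h3.trans h2) hg.le
      _ = _ := by field_simp
  rw [mul_pow, pow_succ] at h4
  have h5 : 0 < K.diam ^ n := by positivity
  nlinarith

end Ineq

namespace Cell

variable {n : ℕ} {K : Cell (n + 1)}

lemma diam_pos (K : Cell (n + 1)) : 0 < K.diam := by
  obtain ⟨J, _, g, c, _, H⟩ := exists_ineq K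
  exact H.diam_pos (by positivity)

lemma interior_nonempty (K : Cell (n + 1)) : (interior K.carrier).Nonempty := by
  obtain ⟨J, _, g, c, _, H⟩ := exists_ineq K
  obtain ⟨z, hz, h⟩ := H.exists_center_mem (by positivity)
  refine ⟨z, mem_interior.2 ⟨⋂ j, {x | 0 < inner ℝ (g j) x + c j}, fun x hx =>
    (H.mem_iff x).2 fun j => (mem_iInter.1 hx j).le, isOpen_iInter_of_finite fun j =>
    isOpen_lt continuous_const (by fun_prop), mem_iInter.2 fun j =>
    lt_of_lt_of_le (by positivity) (h j)⟩⟩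

/-- This is what fixes the value of `innerRatio`: over a distance `innerRatio n κ * K.diam` a
normalised face function drops by at most 1/(n+2), which is the margin available at the centre of
the cell and at the facet points. -/
lemma ball_ratio (g : E (n + 1)) {κ : ℝ} (h : κ * K.diam * ‖g‖ ≤ 2 ^ n)
    {z x : E (n + 1)} (hx : dist x z < innerRatio n κ * K.diam) :
    -(1 / ((n : ℝ) + 2)) ≤ inner ℝ g (x - z) := by
  have h1 := neg_le_of_abs_le (abs_real_inner_le_norm g (x - z))
  refine le_trans (neg_le_neg ?_) h1
  rw [← dist_eq_norm]
  calc ‖g‖ * dist x z ≤ ‖g‖ * (innerRatio n κ * K.diam) := by gcongr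
    _ = κ * K.diam * ‖g‖ * (1 / (2 ^ n * ((n : ℝ) + 2))) := by rw [innerRatio]; ring
    _ ≤ 2 ^ n * (1 / (2 ^ n * ((n : ℝ) + 2))) := by gcongr
    _ = _ := by field_simp

lemma exists_inner_ball {κ : ℝ} (hK : κ ≤ K.shapeRegularity) :
    ∃ x₀ ∈ K.carrier, Metric.ball x₀ (innerRatio n κ * K.diam) ⊆ K.carrier := by
  obtain ⟨J, _, g, c, _, H⟩ := exists_ineq K
  obtain ⟨z, hz, h⟩ := H.exists_center_mem (by positivity)
  refine ⟨z, hz, fun x hx => (H.mem_iff x).2 fun j => ?_⟩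
  have h1 := ball_ratio (g j) (H.norm_le (by positivity) hK j) hx
  rw [inner_sub_right] at h1
  linarith [h j]

/-- The frames of the facets and the covering of the boundary by the hyperplanes of frames. -/
lemma exists_frames {κ : ℝ} (hK : κ ≤ K.shapeRegularity) :
    ∃ (J : Type) (_ : Fintype J) (_ : Nonempty J) (Fr : J → Frame n),
      (∀ j, IsFacetFrame K (K.carrier ∩ (Fr j).plane) (Fr j) (innerRatio n κ * K.diam)) ∧
      (∀ F ∈ K.facets, ∃ j, F = K.carrier ∩ (Fr j).plane) ∧
      frontier K.carrier ⊆ ⋃ j, (Fr j).plane := by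
  obtain ⟨J, hJ, g, c, hne, H⟩ := exists_ineq K
  have hθ : (0 : ℝ) < 1 / (n + 2) := by positivity
  have hfr : ∀ j, ∃ Fr : Frame n, (∀ x, inner ℝ (g j) x + c j = ‖g j‖ * Fr.height x) ∧
      ∀ i, i ≠ j → 1 / ((n : ℝ) + 2) ≤ inner ℝ (g i) Fr.z + c i := fun j => by
    have hg : 0 < ‖g j‖ := norm_pos_iff.2 (H.ne_zero hθ j)
    obtain ⟨z, -, h0, h⟩ := H.exists_face_mem hθ j
    obtain ⟨Fr, rfl, hν⟩ := exists_frame z (‖g j‖⁻¹ • g j) (by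
      rw [norm_smul, norm_inv, norm_norm, inv_mul_cancel₀ hg.ne'])
    refine ⟨Fr, fun x => ?_, h⟩
    rw [Frame.height, hν, inner_smul_left, inner_sub_right]
    simp only [conj_trivial]
    rw [← mul_assoc, mul_inv_cancel₀ hg.ne']; linarith
  choose Fr h1 h2 using hfr
  have hg : ∀ j, 0 < ‖g j‖ := fun j => norm_pos_iff.2 (H.ne_zero hθ j)
  refine ⟨J, hJ, hne, Fr, fun j => ⟨fun x hx => ?_, rfl, ?_⟩, fun F hF => ?_, fun x hx => ?_⟩
  · have := (H.mem_iff x).1 hx j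
    rw [h1] at this
    exact nonneg_of_mul_nonneg_right this (hg j)
  · rintro x ⟨hx, hx'⟩
    refine (H.mem_iff x).2 fun i => ?_
    by_cases hij : i = j
    -- The inequality of the facet itself is membership in the half space; the others survive thanks
    -- to their margin at the base point.
    · subst hij; rw [h1]; exact mul_nonneg (hg i).le hx'
    · have h3 := ball_ratio (g i) (H.norm_le (by positivity) hK i) hx
      rw [inner_sub_right] at h3
      linarith [h2 j i hij]
  · obtain ⟨j, rfl⟩ := H.facet F hF
    refine ⟨j, ?_⟩
    ext x
    simp only [mem_ofPred_eq, h1, mul_eq_zero, (hg j).ne', false_or, mem_inter_iff, Frame.plane]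
  · by_contra hc
    simp only [mem_iUnion, not_exists] at hc
    have hxK : x ∈ K.carrier := K.isCompact_carrier.isClosed.frontier_subset hx
    refine hx.2 (mem_interior.2 ⟨⋂ j, {x | 0 < inner ℝ (g j) x + c j}, fun x hx =>
      (H.mem_iff x).2 fun j => (mem_iInter.1 hx j).le, isOpen_iInter_of_finite fun j =>
      isOpen_lt continuous_const (by fun_prop), mem_iInter.2 fun j => ?_⟩)
    refine lt_of_le_of_ne ((H.mem_iff x).1 hxK j) fun h => hc j ?_
    rw [h1, eq_comm, mul_eq_zero] at h
    exact h.resolve_left (hg j).ne'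

end Cell

namespace IsFacetFrame

variable {n : ℕ} {K : Cell (n + 1)} {F : Set (E (n + 1))} {Fr : Frame n} {r : ℝ}

lemma subset_plane (H : IsFacetFrame K F Fr r) : F ⊆ Fr.plane := H.facet_eq ▸ inter_subset_right

lemma subset_carrier (H : IsFacetFrame K F Fr r) : F ⊆ K.carrier := H.facet_eq ▸ inter_subset_left

lemma isCompact (H : IsFacetFrame K F Fr r) : IsCompact F :=
  H.facet_eq ▸ K.isCompact_carrier.inter_right Fr.isClosed_plane

lemma measurableSet (H : IsFacetFrame K F Fr r) : MeasurableSet F := H.isCompact.measurableSet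

lemma z_mem (H : IsFacetFrame K F Fr r) (hr : 0 < r) : Fr.z ∈ F := by
  rw [H.facet_eq]
  exact ⟨H.ball_subset ⟨Metric.mem_ball_self hr, Fr.plane_subset_half Fr.z_mem_plane⟩,
    Fr.z_mem_plane⟩

lemma ball_chart_subset (H : IsFacetFrame K F Fr r) : Metric.ball 0 r ⊆ Fr.chart ⁻¹' F := by
  rw [← Fr.preimage_ball_chart, H.facet_eq]
  intro y hy
  exact ⟨H.ball_subset ⟨hy, Fr.plane_subset_half (Fr.height_chart y)⟩, Fr.height_chart y⟩

lemma subset_frontier (H : IsFacetFrame K F Fr r) : F ⊆ frontier K.carrier := by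
  intro x hx
  refine ⟨subset_closure (H.subset_carrier hx), fun hi => ?_⟩
  obtain ⟨ε, hε, hb⟩ := Metric.mem_nhds_iff.1 (mem_interior_iff_mem_nhds.1 hi)
  have h1 : x + (-(ε / 2)) • Fr.ν ∈ K.carrier := hb (by
    rw [Metric.mem_ball, dist_self_add_left, norm_smul, Fr.norm_ν, norm_neg, mul_one,
      Real.norm_of_nonneg (by positivity)]
    linarith)
  have h2 : 0 ≤ Fr.height _ := H.carrier_subset h1
  rw [Fr.height_add, inner_smul_right, Fr.inner_ν_ν,
    show Fr.height x = 0 from H.subset_plane hx] at h2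
  linarith

end IsFacetFrame

/-- The boundary is covered by finitely many hyperplanes and contains an isometric copy of a ball of
`E n`. -/
lemma Cell.dimH_frontier {n : ℕ} {K : Cell (n + 1)} (hK : 0 < K.shapeRegularity) :
    dimH (frontier K.carrier) = n := by
  obtain ⟨J, _, ⟨j⟩, Fr, h1, -, h3⟩ := K.exists_frames le_rfl
  refine le_antisymm ((dimH_mono h3).trans ?_) ?_
  · rw [dimH_iUnion]
    exact iSup_le fun j => (Fr j).dimH_plane.le
  · have h4 := (h1 j).ball_chart_subset
    have h5 : (Fr j).chart '' Metric.ball 0 (innerRatio n K.shapeRegularity * K.diam) ⊆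
        frontier K.carrier := by
      rintro _ ⟨y, hy, rfl⟩
      exact (h1 j).subset_frontier (h4 hy)
    refine le_trans (le_of_eq ?_) (dimH_mono h5)
    rw [(Fr j).isometry_chart.dimH_image, Real.dimH_of_nonempty_interior]
    · simp
    · rw [Metric.isOpen_ball.interior_eq]
      exact ⟨0, Metric.mem_ball_self (mul_pos (innerRatio_pos hK) K.diam_pos)⟩

/-- K belongs to its own neighbourhood only through the Hausdorff dimension of its boundary. This
makes fluxes supported in K admissible in the local norm. -/
lemma Mesh.carrier_subset_patch {n : ℕ} {Ω : Set (E (n + 1))} (T : Mesh Ω) {K : Cell (n + 1)}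
    (hKT : K ∈ T.cells) (hK : 0 < K.shapeRegularity) : K.carrier ⊆ T.patch K := by
  refine subset_biUnion_of_mem (u := fun K : Cell (n + 1) => K.carrier) ⟨hKT, ?_⟩
  rw [inter_self, Cell.dimH_frontier hK]
  simp

/-! ### Flat points of the boundary -/

/-- The points near which the domain `Ω` is the open half space of the frame `Fr`, and near which
the closed half space is contained in the cell `K`. -/
def flatSet {n : ℕ} (Ω : Set (E (n + 1))) (K : Cell (n + 1)) (Fr : Frame n) : Set (E (n + 1)) :=
  {x | ∃ ε > 0, (∀ y ∈ Metric.ball x ε, (y ∈ Ω ↔ 0 < Fr.height y)) ∧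
    Metric.ball x ε ∩ Fr.half ⊆ K.carrier}

section

variable {n : ℕ} {Ω : Set (E (n + 1))} {K : Cell (n + 1)} {F : Set (E (n + 1))} {Fr : Frame n}
  {r : ℝ}

lemma isOpen_flatSet : IsOpen (flatSet Ω K Fr) := by
  refine Metric.isOpen_iff.2 fun x ⟨ε, hε, h1, h2⟩ => ⟨ε / 2, half_pos hε, fun y hy => ?_⟩
  have hsub : Metric.ball y (ε / 2) ⊆ Metric.ball x ε :=
    Metric.ball_subset_ball' (by linarith [Metric.mem_ball.1 hy])
  exact ⟨ε / 2, half_pos hε, fun z hz => h1 z (hsub hz),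
    (inter_subset_inter_left _ hsub).trans h2⟩

lemma mem_iff_of_mem_flatSet {x : E (n + 1)} (hx : x ∈ flatSet Ω K Fr) :
    x ∈ Ω ↔ 0 < Fr.height x := by
  obtain ⟨ε, hε, h1, -⟩ := hx
  exact h1 x (Metric.mem_ball_self hε)

lemma flatSet_inter_half_subset : flatSet Ω K Fr ∩ Fr.half ⊆ K.carrier := by
  rintro x ⟨⟨ε, hε, -, h2⟩, hx⟩
  exact h2 ⟨Metric.mem_ball_self hε, hx⟩

/-- At a relative interior point of a facet, the cell contains a half ball. -/
lemma IsFacetFrame.exists_half_ball (H : IsFacetFrame K F Fr r) (hr : 0 < r) {y : E n}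
    (hy : y ∈ interior (Fr.chart ⁻¹' F)) :
    ∃ ε > 0, Metric.ball (Fr.chart y) ε ∩ Fr.half ⊆ K.carrier := by
  obtain ⟨δ, hδ, hb⟩ := Metric.mem_nhds_iff.1 (mem_interior_iff_mem_nhds.1 hy)
  obtain ⟨s, hs0, hs1⟩ : ∃ s : ℝ, 0 < s ∧ s * ‖y‖ < δ :=
    ⟨δ / (2 * (‖y‖ + 1)), by positivity, by
      rw [div_mul_eq_mul_div, div_lt_iff₀ (by positivity)]; nlinarith [norm_nonneg y]⟩
  -- The point y' lies slightly beyond y on the ray from the base point and is still in the facet.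
  -- Contracting the half ball at the base point towards y' with ratio t gives, by convexity of K, a
  -- half ball at y of radius t r.
  set y' := (1 + s) • y with hy'
  have hy'F : Fr.chart y' ∈ K.carrier := H.subset_carrier (hb (by
    rw [Metric.mem_ball, dist_eq_norm, hy', add_smul, one_smul, add_sub_cancel_left, norm_smul,
      Real.norm_of_nonneg hs0.le]
    exact hs1))
  set t := s / (1 + s) with ht
  have ht0 : 0 < t := by positivity
  have ht1 : 1 - t = 1 / (1 + s) := by rw [ht]; field_simp; ring
  have ht2 : 0 < 1 - t := by rw [ht1]; positivity
  have hcomb : Fr.chart y = t • Fr.z + (1 - t) • Fr.chart y' := by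
    have h1 : Fr.chart y' = Fr.z + (1 + s) • (Fr.chart y - Fr.z) := by
      simp [Frame.chart, hy', Finset.smul_sum, smul_smul]
    rw [h1, smul_add, smul_smul, ht1, one_div, inv_mul_cancel₀ (by positivity), one_smul,
      ← one_div, ← ht1, sub_smul, one_smul]
    abel
  refine ⟨t * r, by positivity, fun x ⟨hx, hx'⟩ => ?_⟩
  have h2 : Fr.z + t⁻¹ • (x - Fr.chart y) ∈ K.carrier := by
    refine H.ball_subset ⟨?_, ?_⟩
    · rw [Metric.mem_ball, dist_self_add_left, norm_smul, norm_inv, Real.norm_of_nonneg ht0.le,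
        ← dist_eq_norm, inv_mul_lt_iff₀ ht0]
      exact hx
    · show 0 ≤ Fr.height _
      rw [Fr.height_add, Fr.height_z, zero_add, inner_smul_right,
        ← Fr.height_eq_of (Fr.height_chart y)]
      exact mul_nonneg (inv_nonneg.2 ht0.le) hx'
  have h3 := K.convex_carrier h2 hy'F ht0.le ht2.le (by ring)
  rwa [smul_add, smul_smul, mul_inv_cancel₀ ht0.ne', one_smul, add_right_comm, ← hcomb,
    add_sub_cancel] at h3

/-- If the boundary of `K` and that of the Lipschitz domain `Ω ⊇ int K` coincide on a flat facet,
then `Ω` is locally a half space. -/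
lemma mem_flatSet (hΩ : IsOpen Ω) (hL : HasLipschitzBoundary Ω) (hKΩ : interior K.carrier ⊆ Ω)
    (H : IsFacetFrame K F Fr r) (hF : F ⊆ frontier Ω) {x : E (n + 1)} (hx : x ∈ Fr.plane) {ε : ℝ}
    (hε : 0 < ε) (hb : Metric.ball x ε ∩ Fr.half ⊆ K.carrier) : x ∈ flatSet Ω K Fr := by
  have hplane : ∀ y ∈ Metric.ball x ε, y ∈ Fr.plane → y ∈ frontier Ω := fun y hy hy' =>
    hF (H.facet_eq ▸ ⟨hb ⟨hy, Fr.plane_subset_half hy'⟩, hy'⟩)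
  have hxF := hplane x (Metric.mem_ball_self hε) hx
  obtain ⟨e, he, R, hR, L, γ, hγ, hγΩ⟩ := hL x hxF
  set hor : E (n + 1) → E (n + 1) := fun y => y - inner ℝ e y • e with hhor
  have hhorc : Continuous hor := by fun_prop
  -- Near x the boundary lies in the graph of γ: points strictly below it have a neighbourhood that
  -- misses Ω, and points strictly above it are interior to Ω.
  have hgraph : ∀ y ∈ Metric.ball x R, y ∈ frontier Ω → γ (hor y) = inner ℝ e y := by
    intro y hy hyF
    refine le_antisymm ?_ ?_
    · by_contra! hlt
      have hev : ∀ᶠ w in 𝓝 y, w ∈ Metric.ball x R ∧ inner ℝ e w < γ (hor w) := by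
        refine Filter.Eventually.and (Metric.isOpen_ball.mem_nhds hy) ?_
        exact (isOpen_lt (by fun_prop) (hγ.continuous.comp hhorc)).mem_nhds hlt
      obtain ⟨w, hw3, hw1, hw2⟩ :=
        ((mem_closure_iff_frequently.1 hyF.1).and_eventually hev).exists
      exact absurd ((hγΩ w hw1).1 hw3) hw2.not_gt
    · by_contra! hlt
      exact hyF.2 (hΩ.interior_eq.symm ▸ (hγΩ y hy).2 hlt)
  have hee : inner ℝ e e = (1 : ℝ) := by rw [real_inner_self_eq_norm_sq, he, one_pow]
  have hhor_add : ∀ (y : E (n + 1)) (t : ℝ), hor (y + t • e) = hor y := fun y t => by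
    simp only [hhor, inner_add_right, inner_smul_right, hee, add_smul, mul_one]; abel
  have hie : ∀ (y : E (n + 1)) (t : ℝ), inner ℝ e (y + t • e) = inner ℝ e y + t := fun y t => by
    rw [inner_add_right, inner_smul_right, hee, mul_one]
  set η := inner ℝ Fr.ν e with hη
  -- If e were tangent to the hyperplane, x and x + t e would be two points of the graph with the
  -- same horizontal part and different heights.
  have hη0 : η ≠ 0 := fun h0 => by
    set t := min ε R / 2 with ht
    have ht0 : 0 < t := by positivity
    have htε : t < ε := (half_lt_self (by positivity)).trans_le (min_le_left _ _)
    have htR : t < R := (half_lt_self (by positivity)).trans_le (min_le_right _ _)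
    have hd : dist (x + t • e) x = t := by
      rw [dist_self_add_left, norm_smul, he, mul_one, Real.norm_of_nonneg ht0.le]
    have h1 : x + t • e ∈ Fr.plane := by
      show Fr.height _ = 0
      rw [Fr.height_add, inner_smul_right, ← hη, h0, mul_zero, add_zero]; exact hx
    have h2 := hgraph _ (by rwa [Metric.mem_ball, hd]) (hplane _ (by rwa [Metric.mem_ball, hd]) h1)
    have h3 := hgraph x (Metric.mem_ball_self hR) hxF
    rw [hhor_add, hie] at h2
    linarith
  -- Sliding a point of `Metric.ball x q` along e onto the hyperplane moves it by at most q|η|⁻¹, so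
  -- it stays within distance min ε R of x.
  set q := min ε R / (1 + |η|⁻¹) with hq
  have hq0 : 0 < q := by positivity
  have hqm : q * (1 + |η|⁻¹) = min ε R := by rw [hq]; field_simp
  have hqε : q ≤ ε := by
    have := min_le_left ε R
    nlinarith [inv_nonneg.2 (abs_nonneg η)]
  have hqR : q ≤ R := by
    have := min_le_right ε R
    nlinarith [inv_nonneg.2 (abs_nonneg η)]
  -- The point of the hyperplane obtained by sliding y along e is on the graph and has the
  -- horizontal part of y. This computes γ there and turns the epigraph condition into a sign
  -- condition on height/η.
  have key : ∀ y ∈ Metric.ball x q, (y ∈ Ω ↔ 0 < Fr.height y / η) := by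
    intro y hy
    rw [Metric.mem_ball, dist_eq_norm] at hy
    set y' := y + (-(Fr.height y / η)) • e with hy'
    have h1 : y' ∈ Fr.plane := by
      show Fr.height _ = 0
      rw [hy', Fr.height_add, inner_smul_right, ← hη]; field_simp; ring
    have h2 : dist y' x < min ε R := by
      rw [dist_eq_norm, hy', add_sub_right_comm, ← hqm]
      refine (norm_add_le _ _).trans_lt ?_
      rw [norm_smul, he, mul_one, norm_neg, norm_div, Real.norm_eq_abs, Real.norm_eq_abs,
        div_eq_mul_inv, mul_add, mul_one]
      have h3 : |Fr.height y| ≤ ‖y - x‖ := by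
        rw [Fr.height_eq_of hx]
        simpa [Fr.norm_ν] using abs_real_inner_le_norm Fr.ν (y - x)
      have h4 : |Fr.height y| * |η|⁻¹ ≤ q * |η|⁻¹ := by gcongr; linarith
      linarith
    have h5 := hgraph y' (h2.trans_le (min_le_right _ _))
      (hplane y' (h2.trans_le (min_le_left _ _)) h1)
    rw [hy', hhor_add, hie] at h5
    rw [hγΩ y (by rw [Metric.mem_ball, dist_eq_norm]; linarith)]
    change γ (hor y) < _ ↔ _
    rw [h5]
    constructor <;> intro h <;> linarith
  -- Points just above the hyperplane are interior to K, hence in Ω, which decides the sign of η.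
  have hηpos : 0 < η := by
    set y := x + (q / 2) • Fr.ν with hy
    have hh : Fr.height y = q / 2 := by
      rw [hy, Fr.height_add, inner_smul_right, Fr.inner_ν_ν, show Fr.height x = 0 from hx]; ring
    have hd : dist y x < q := by
      rw [hy, dist_self_add_left, norm_smul, Fr.norm_ν, mul_one,
        Real.norm_of_nonneg (by positivity)]
      linarith
    have hyK : y ∈ interior K.carrier := by
      refine mem_interior.2 ⟨Metric.ball x ε ∩ {y | 0 < Fr.height y}, ?_,
        Metric.isOpen_ball.inter (isOpen_lt continuous_const Fr.continuous_height),
        hd.trans_le hqε, by rw [mem_ofPred_eq, hh]; positivity⟩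
      rintro w ⟨hw, hw'⟩
      exact hb ⟨hw, (show 0 < Fr.height w from hw').le⟩
    have := (key y hd).1 (hKΩ hyK)
    rw [hh] at this
    exact (div_pos_iff_of_pos_left (by positivity)).1 this
  refine ⟨q, hq0, fun y hy => ?_, (inter_subset_inter_left _ (Metric.ball_subset_ball hqε)).trans hb⟩
  rw [key y hy, div_pos_iff_of_pos_right hηpos]

/-- Almost all points of a boundary facet are flat boundary points. -/
lemma ae_mem_flatSet (hΩ : IsOpen Ω) (hL : HasLipschitzBoundary Ω) (hKΩ : interior K.carrier ⊆ Ω)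
    (H : IsFacetFrame K F Fr r) (hr : 0 < r) (hF : F ⊆ frontier Ω) :
    ∀ᵐ x ∂(surf (n + 1)).restrict F, x ∈ flatSet Ω K Fr := by
  rw [Fr.surf_restrict H.subset_plane, Fr.isClosedEmbedding_chart.measurableEmbedding.ae_map_iff]
  -- A convex set has a null boundary, so almost every point of the facet is a relative interior
  -- point.
  have hconv : Convex ℝ (Fr.chart ⁻¹' F) := by
    have h1 : Convex ℝ F := by
      rw [H.facet_eq]
      refine K.convex_carrier.inter ?_
      have hlin : IsLinearMap ℝ fun x => (inner ℝ Fr.ν x : ℝ) :=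
        ⟨fun x y => inner_add_right _ _ _, fun c x => inner_smul_right _ _ _⟩
      have hpl : Fr.plane = {x | inner ℝ Fr.ν x = inner ℝ Fr.ν Fr.z} := by
        ext x
        show inner ℝ Fr.ν (x - Fr.z) = 0 ↔ inner ℝ Fr.ν x = inner ℝ Fr.ν Fr.z
        rw [inner_sub_right, sub_eq_zero]
      rw [hpl]
      exact convex_hyperplane hlin (inner ℝ Fr.ν Fr.z)
    intro x hx y hy a b ha hb hab
    have : Fr.chart (a • x + b • y) = a • Fr.chart x + b • Fr.chart y := by
      obtain rfl : b = 1 - a := by linarith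
      simp only [Frame.chart, PiLp.add_apply, PiLp.smul_apply, smul_eq_mul, add_smul,
        Finset.sum_add_distrib, mul_smul, ← Finset.smul_sum]
      module
    rw [mem_preimage, this]
    exact h1 hx hy ha hb hab
  have hfr := hconv.addHaar_frontier (volume : Measure (E n))
  have hcl : IsClosed (Fr.chart ⁻¹' F) :=
    H.isCompact.isClosed.preimage Fr.isometry_chart.continuous
  rw [ae_restrict_iff' (Fr.isometry_chart.continuous.measurable H.measurableSet)]
  refine (measure_eq_zero_iff_ae_notMem.1 hfr).mono fun y hy hyF => ?_
  have hyi : y ∈ interior (Fr.chart ⁻¹' F) := by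
    rw [hcl.frontier_eq] at hy
    by_contra h
    exact hy ⟨hyF, h⟩
  obtain ⟨ε, hε, hb⟩ := H.exists_half_ball hr hyi
  exact mem_flatSet hΩ hL hKΩ H hF (Fr.height_chart y) hε hb

/-- Flat boundary points of a facet belong to no other cell. -/
lemma Mesh.notMem_of_mem_flatSet (T : Mesh Ω) (hK : K ∈ T.cells) {K' : Cell (n + 1)}
    (hK' : K' ∈ T.cells) (hne : K ≠ K') {x : E (n + 1)} (hx : x ∈ flatSet Ω K Fr) :
    x ∉ K'.carrier := fun hxK' => by
  obtain ⟨ε, hε, h1, h2⟩ := hx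
  -- A convex cell with nonempty interior lies in the closure of its interior, so interior points of
  -- K' accumulate at x. They are in Ω, hence in the open half ball at x, which is interior to K:
  -- the two interiors would meet.
  have hcl : x ∈ closure (interior K'.carrier) := by
    rw [K'.convex_carrier.closure_interior_eq_closure_of_nonempty_interior K'.interior_nonempty]
    exact subset_closure hxK'
  obtain ⟨y, hy, hyx⟩ := Metric.mem_closure_iff.1 hcl ε hε
  rw [dist_comm] at hyx
  have hyh := (h1 y hyx).1 (T.interior_subset K' hK' hy)
  refine (T.disjoint K hK K' hK' hne).le_bot ⟨mem_interior.2 ⟨Metric.ball x ε ∩ {y | 0 < Fr.height y},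
    ?_, Metric.isOpen_ball.inter (isOpen_lt continuous_const Fr.continuous_height), hyx, hyh⟩, hy⟩
  rintro w ⟨hw, hw'⟩
  exact h2 ⟨hw, (show 0 < Fr.height w from hw').le⟩

/-- Flat boundary points of a facet belong to no other facet of the cell. -/
lemma IsFacetFrame.eq_of_mem (H : IsFacetFrame K F Fr r) {F' : Set (E (n + 1))} {Fr' : Frame n}
    {r' : ℝ} (H' : IsFacetFrame K F' Fr' r') {x : E (n + 1)} (hxF : x ∈ F) (hxF' : x ∈ F')
    (hx : x ∈ flatSet Ω K Fr) : F' = F := by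
  obtain ⟨ε, hε, -, hb⟩ := hx
  have hx1 := H.subset_plane hxF
  have hx2 := H'.subset_plane hxF'
  -- K contains a half ball of the first frame at x and lies in the half space of the second, so
  -- every direction pointing into the first half space points into the second.
  have hdir : ∀ w : E (n + 1), 0 ≤ (inner ℝ Fr.ν w : ℝ) → 0 ≤ (inner ℝ Fr'.ν w : ℝ) := by
    intro w hw
    obtain ⟨t, ht0, ht⟩ : ∃ t : ℝ, 0 < t ∧ t * ‖w‖ < ε :=
      ⟨ε / (2 * (‖w‖ + 1)), by positivity, by
        rw [div_mul_eq_mul_div, div_lt_iff₀ (by positivity)]; nlinarith [norm_nonneg w]⟩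
    have h1 : x + t • w ∈ K.carrier := hb ⟨by
      rwa [Metric.mem_ball, dist_self_add_left, norm_smul, Real.norm_of_nonneg ht0.le], by
      show 0 ≤ Fr.height _
      rw [Fr.height_add, show Fr.height x = 0 from hx1, zero_add, inner_smul_right]
      positivity⟩
    have h2 : 0 ≤ Fr'.height _ := H'.carrier_subset h1
    rw [Fr'.height_add, show Fr'.height x = 0 from hx2, zero_add, inner_smul_right] at h2
    exact nonneg_of_mul_nonneg_right h2 ht0
  set m := inner ℝ Fr.ν Fr'.ν with hm
  have hm0 : 0 ≤ m := by
    rw [hm, real_inner_comm]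
    exact hdir Fr.ν (by rw [Fr.inner_ν_ν]; exact zero_le_one)
  -- This direction is tangent to the first hyperplane; the conclusion reads m² ≥ 1, which forces
  -- the two unit normals to coincide.
  have hm1 := hdir (m • Fr.ν - Fr'.ν) (by
    rw [inner_sub_right, inner_smul_right, Fr.inner_ν_ν, ← hm]; simp)
  rw [inner_sub_right, inner_smul_right, Fr'.inner_ν_ν, real_inner_comm, ← hm] at hm1
  have hm2 : m = 1 := by
    have : m ≤ 1 := by
      simpa [Fr.norm_ν, Fr'.norm_ν] using real_inner_le_norm Fr.ν Fr'.ν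
    nlinarith
  have hνν : Fr.ν = Fr'.ν := (inner_eq_one_iff_of_norm_eq_one Fr.norm_ν Fr'.norm_ν).1 hm2
  rw [H.facet_eq, H'.facet_eq]
  congr 1
  ext y
  show Fr'.height y = 0 ↔ Fr.height y = 0
  rw [Fr.height_eq_of hx1, Fr'.height_eq_of hx2, hνν]

end

/-! ### Local test fluxes -/

section

variable {n : ℕ}

/-- The vector field with Cartesian components `f`. -/
def fluxVec (f : Fin (n + 1) → E (n + 1) → ℝ) (x : E (n + 1)) : E (n + 1) :=
  WithLp.toLp 2 fun i => f i x

/-- The divergence of the vector field with Cartesian components `f`. -/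
def fluxDiv (f : Fin (n + 1) → E (n + 1) → ℝ) (x : E (n + 1)) : ℝ :=
  ∑ i, fderiv ℝ (f i) x (EuclideanSpace.single i 1)

/-- The outer normal component of the vector field with Cartesian components `f`. -/
def fluxNormal (Fr : Frame n) (f : Fin (n + 1) → E (n + 1) → ℝ) (x : E (n + 1)) : ℝ :=
  -∑ i, Fr.ν i * f i x

/-- Compatibility of a cell `K`, a part `F` of the Robin boundary, and a frame. -/
structure FluxGeometry (D : MixedDomain (n + 1)) (K : Cell (n + 1)) (F : Set (E (n + 1)))
    (Fr : Frame n) : Prop where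
  interior_subset : interior K.carrier ⊆ D.Ω
  subset_plane : F ⊆ Fr.plane
  subset_closure : F ⊆ closure D.ΓV
  isCompact : IsCompact F

/-- The Cartesian components of a smooth flux whose restriction to the cell `K` has a normal
trace supported in `F`. -/
structure IsTestFlux (K : Cell (n + 1)) (F : Set (E (n + 1))) (Fr : Frame n)
    (f : Fin (n + 1) → E (n + 1) → ℝ) : Prop where
  contDiff : ∀ i, ContDiff ℝ ∞ (f i)
  compact : ∀ i, HasCompactSupport (f i)
  half : ∀ i, ∀ x ∈ tsupport (f i), (x ∈ K.carrier ↔ x ∈ Fr.half)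
  facet : ∀ i, ∀ x ∈ tsupport (f i), x ∈ Fr.plane → x ∈ F

lemma fderiv_fluxVec (L : E (n + 1) →L[ℝ] ℝ) (f : Fin (n + 1) → E (n + 1) → ℝ) (x : E (n + 1)) :
    L (fluxVec f x) = ∑ i, f i x * L (EuclideanSpace.single i 1) := by
  have : fluxVec f x = ∑ i, f i x • EuclideanSpace.single i (1 : ℝ) := by
    ext j; simp [fluxVec, Pi.single_apply]
  rw [this, map_sum]
  simp

lemma continuous_fluxVec {f : Fin (n + 1) → E (n + 1) → ℝ} (hf : ∀ i, Continuous (f i)) :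
    Continuous (fluxVec f) := by
  unfold fluxVec
  exact (PiLp.continuous_toLp 2 _).comp (continuous_pi hf)

lemma continuous_fluxDiv {f : Fin (n + 1) → E (n + 1) → ℝ} (hf : ∀ i, ContDiff ℝ ∞ (f i)) :
    Continuous (fluxDiv f) :=
  continuous_finsetSum _ fun i _ =>
    ((hf i).continuous_fderiv (by simp)).clm_apply continuous_const

lemma continuous_fluxNormal {Fr : Frame n} {f : Fin (n + 1) → E (n + 1) → ℝ}
    (hf : ∀ i, Continuous (f i)) : Continuous (fluxNormal Fr f) :=
  (continuous_finsetSum _ fun i _ => continuous_const.mul (hf i)).neg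

variable {D : MixedDomain (n + 1)} {K : Cell (n + 1)} {F : Set (E (n + 1))} {Fr : Frame n}

lemma MixedDomain.measurableSet_part {Ω Γ : Set (E (n + 1))} (h : IsBoundaryPart Ω Γ) :
    MeasurableSet Γ := by
  obtain ⟨U, hU, rfl⟩ := h.isOpen
  exact hU.measurableSet.inter isClosed_frontier.measurableSet

lemma MixedDomain.closure_ΓV_subset (D : MixedDomain (n + 1)) : closure D.ΓV ⊆ frontier D.Ω := by
  obtain ⟨U, -, h⟩ := D.partV.isOpen
  exact closure_minimal (h ▸ inter_subset_right) isClosed_frontier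

lemma MixedDomain.closure_ΓV_ae_eq (D : MixedDomain (n + 1)) :
    (closure D.ΓV : Set (E (n + 1))) =ᵐ[surf (n + 1)] D.ΓV := by
  refine Filter.EventuallyLE.antisymm ?_ (LE.le.eventuallyLE subset_closure)
  exact ae_le_set.2 D.partV.null_boundary

/-- Integrals over the Robin boundary of functions that vanish outside a part `F` of it. -/
lemma setIntegral_ΓV_eq (hF : MeasurableSet F) (hFV : F ⊆ closure D.ΓV) {g : E (n + 1) → ℝ}
    (hg : ∀ x ∈ D.ΓV, x ∉ F → g x = 0) :
    ∫ x in D.ΓV, g x ∂surf (n + 1) = ∫ x in F, g x ∂surf (n + 1) := by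
  calc ∫ x in D.ΓV, g x ∂surf (n + 1) = ∫ x in D.ΓV, F.indicator g x ∂surf (n + 1) := by
        refine setIntegral_congr_fun (MixedDomain.measurableSet_part D.partV) fun x hx => ?_
        by_cases h : x ∈ F
        · rw [indicator_of_mem h]
        · rw [indicator_of_notMem h, hg x hx h]
    _ = ∫ x in closure D.ΓV, F.indicator g x ∂surf (n + 1) :=
        (setIntegral_congr_set D.closure_ΓV_ae_eq).symm
    _ = _ := by rw [setIntegral_indicator hF, inter_eq_self_of_subset_right hFV]

instance (K : Cell (n + 1)) : IsFiniteMeasure (volume.restrict K.carrier) :=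
  isFiniteMeasure_restrict.2 K.isCompact_carrier.measure_lt_top.ne

lemma volume_carrier_sdiff {Ω : Set (E (n + 1))} (h : interior K.carrier ⊆ Ω) :
    volume (K.carrier \ Ω) = 0 := by
  refine measure_mono_null (fun x hx => ?_) K.volume_frontier
  exact ⟨subset_closure hx.1, fun hi => hx.2 (h hi)⟩

/-- Integrals over `Ω` of functions supported in a cell. -/
lemma setIntegral_indicator_cell {Ω : Set (E (n + 1))} (h : interior K.carrier ⊆ Ω)
    {G : Type*} [NormedAddCommGroup G] [NormedSpace ℝ G] (g : E (n + 1) → G) :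
    ∫ x in Ω, K.carrier.indicator g x = ∫ x in K.carrier, g x := by
  rw [setIntegral_indicator K.measurableSet_carrier]
  refine setIntegral_congr_set (Filter.EventuallyLE.antisymm
    (LE.le.eventuallyLE inter_subset_right) (ae_le_set.2 ?_))
  rw [sdiff_inter_self_eq_sdiff]
  exact volume_carrier_sdiff h

lemma ae_restrict_cell_of_ae {Ω : Set (E (n + 1))} (h : interior K.carrier ⊆ Ω)
    {p : E (n + 1) → Prop} (hp : ∀ᵐ x ∂volume.restrict Ω, p x) :
    ∀ᵐ x ∂volume.restrict K.carrier, p x := by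
  refine ae_mono ?_ hp
  refine Measure.restrict_mono_ae (ae_le_set.2 ?_)
  exact volume_carrier_sdiff h

/-- Green's formula on a cell for a test flux. -/
lemma IsTestFlux.green (G : FluxGeometry D K F Fr) {f : Fin (n + 1) → E (n + 1) → ℝ}
    (hf : IsTestFlux K F Fr f) {g : E (n + 1) → ℝ} (hg : ContDiff ℝ ∞ g) :
    ∫ x in K.carrier, (fderiv ℝ g x (fluxVec f x) + fluxDiv f x * g x) =
      ∫ x in F, fluxNormal Fr f x * g x ∂surf (n + 1) := by
  have hfg : ∀ i, ContDiff ℝ 1 (fun x => f i x * g x) := fun i =>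
    ((hf.contDiff i).mul hg).of_le (by simp)
  have hsub : ∀ i, tsupport (fun x => f i x * g x) ⊆ tsupport (f i) := fun i =>
    tsupport_mul_subset_left
  have hcs : ∀ i, HasCompactSupport (fun x => f i x * g x) := fun i => (hf.compact i).mul_right
  have hd : ∀ i x, DifferentiableAt ℝ (f i) x := fun i =>
    (hf.contDiff i).differentiable (by simp)
  have hdg : Differentiable ℝ g := hg.differentiable (by simp)
  have hsum : ∀ x, fderiv ℝ g x (fluxVec f x) + fluxDiv f x * g x =
      ∑ i, fderiv ℝ (fun x => f i x * g x) x (EuclideanSpace.single i 1) := fun x => by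
    rw [fderiv_fluxVec, fluxDiv, Finset.sum_mul, ← Finset.sum_add_distrib]
    refine Finset.sum_congr rfl fun i _ => ?_
    rw [fderiv_fun_mul (hd i x) (hdg x)]
    simp; ring
  have hint : ∀ (s : Set (E (n + 1))) i, IntegrableOn
      (fun x => fderiv ℝ (fun x => f i x * g x) x (EuclideanSpace.single i 1)) s := fun s i =>
    ((((hfg i).continuous_fderiv one_ne_zero).clm_apply
      continuous_const).integrable_of_hasCompactSupport
      (((hcs i).fderiv ℝ).mono fun x hx h => hx (by simp [h]))).integrableOn
  -- On the support of f i the cell and the half space coincide, so Green's formula on a half space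
  -- is all that is required.
  have hKH : ∀ i, ∫ x in K.carrier, fderiv ℝ (fun x => f i x * g x) x
      (EuclideanSpace.single i 1) = ∫ x in Fr.half, fderiv ℝ (fun x => f i x * g x) x
      (EuclideanSpace.single i 1) := fun i => by
    rw [← integral_indicator K.measurableSet_carrier, ← integral_indicator
      Fr.isClosed_half.measurableSet]
    congr 1
    funext x
    by_cases hx : x ∈ tsupport (f i)
    · have := hf.half i x hx
      by_cases h : x ∈ Fr.half
      · rw [indicator_of_mem h, indicator_of_mem (this.2 h)]
      · rw [indicator_of_notMem h, indicator_of_notMem (mt this.1 h)]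
    · have : fderiv ℝ (fun x => f i x * g x) x = 0 :=
        image_eq_zero_of_notMem_tsupport fun h => hx (hsub i (tsupport_fderiv_subset ℝ h))
      simp [indicator, this]
  simp only [hsum]
  rw [integral_finsetSum _ fun i _ => hint _ i]
  simp only [hKH, Fr.green (hfg _) (hcs _), EuclideanSpace.inner_single_right, one_mul]
  rw [Finset.sum_neg_distrib, Fr.setIntegral_surf G.subset_plane]
  simp only [fluxNormal, neg_mul, integral_neg, Finset.sum_mul]
  rw [integral_finsetSum]
  · congr 1
    refine Finset.sum_congr rfl fun i _ => ?_
    simp only [conj_trivial, mul_assoc, integral_const_mul]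
    congr 1
    refine (setIntegral_eq_integral_of_forall_compl_eq_zero fun y hy => ?_).symm
    rw [image_eq_zero_of_notMem_tsupport (f := f i), zero_mul]
    exact fun h => hy (hf.facet i _ h (Fr.height_chart y))
  · intro i _
    simp only [mul_assoc]
    refine ContinuousOn.integrableOn_compact
      (Fr.isClosedEmbedding_chart.isCompact_preimage G.isCompact) (Continuous.continuousOn ?_)
    exact continuous_const.mul (((hf.contDiff i).continuous.mul hg.continuous).comp
      Fr.isometry_chart.continuous)

/-- Green's formula on the domain for the test flux cut off outside a cell. -/
lemma IsTestFlux.green_domain (G : FluxGeometry D K F Fr) {f : Fin (n + 1) → E (n + 1) → ℝ}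
    (hf : IsTestFlux K F Fr f) {g : E (n + 1) → ℝ} (hg : ContDiff ℝ ∞ g) :
    ∫ x in D.Ω, (fderiv ℝ g x (K.carrier.indicator (fluxVec f) x) +
        K.carrier.indicator (fluxDiv f) x * g x) =
      ∫ x in D.ΓV, F.indicator (fluxNormal Fr f) x * g x ∂surf (n + 1) := by
  rw [setIntegral_ΓV_eq G.isCompact.measurableSet G.subset_closure fun x _ hx => by
    rw [indicator_of_notMem hx, zero_mul]]
  rw [← setIntegral_congr_fun G.isCompact.measurableSet fun x hx => by
    rw [indicator_of_mem hx], ← hf.green G hg, ← setIntegral_indicator_cell G.interior_subset]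
  congr 1
  funext x
  by_cases hx : x ∈ K.carrier
  · simp only [indicator_of_mem hx]
  · simp only [indicator_of_notMem hx, map_zero, zero_mul, add_zero]

/-- The element of the local test space given by test fluxes. -/
def testField {ι : Type} (K : Cell (n + 1)) (F : Set (E (n + 1))) (Fr : Frame n)
    (f : ι → Fin (n + 1) → E (n + 1) → ℝ) : MixedField (n + 1) ι where
  p x a := K.carrier.indicator (fluxVec (f a)) x
  div x a := K.carrier.indicator (fluxDiv (f a)) x
  nt x a := F.indicator (fluxNormal Fr (f a)) x
  φ _ _ := 0

lemma isFiniteMeasure_surf_restrict (G : FluxGeometry D K F Fr) :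
    IsFiniteMeasure ((surf (n + 1)).restrict F) := by
  rw [Fr.surf_restrict G.subset_plane]
  have : IsFiniteMeasure (volume.restrict (Fr.chart ⁻¹' F)) :=
    isFiniteMeasure_restrict.2
      (Fr.isClosedEmbedding_chart.isCompact_preimage G.isCompact).measure_lt_top.ne
  infer_instance

lemma integrable_inner_of_memLp {X H : Type*} [MeasurableSpace X] [NormedAddCommGroup H]
    [InnerProductSpace ℝ H] {μ : Measure X} {u w : X → H} (hu : MemLp u 2 μ) (hw : MemLp w 2 μ) :
    Integrable (fun x => (inner ℝ (u x) (w x) : ℝ)) μ := by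
  refine (L2.integrable_inner (𝕜 := ℝ) (hu.toLp _) (hw.toLp _)).congr ?_
  filter_upwards [hu.coeFn_toLp, hw.coeFn_toLp] with x hx1 hx2
  rw [hx1, hx2]

lemma inner_gradient {v : E (n + 1) → ℝ} (x y : E (n + 1)) :
    inner ℝ (gradient v x) y = fderiv ℝ v x y := by
  rw [← toDual_gradient (𝕜 := ℝ), InnerProductSpace.toDual_apply_apply]

lemma continuous_gradient {v : E (n + 1) → ℝ} (hv : ContDiff ℝ ∞ v) : Continuous (gradient v) :=
  (InnerProductSpace.toDual ℝ (E (n + 1))).symm.continuous.comp (hv.continuous_fderiv (by simp))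

/-- Continuity of the `L^2` pairing with respect to its first argument. -/
lemma tendsto_integral_inner {X H : Type*} [MeasurableSpace X] [NormedAddCommGroup H]
    [InnerProductSpace ℝ H] {μ : Measure X} {u : ℕ → X → H} {u₀ w : X → H}
    (hu : ∀ k, AEStronglyMeasurable (u k) μ) (hu₀ : MemLp u₀ 2 μ) (hw : MemLp w 2 μ)
    (h : Tendsto (fun k => eLpNorm (fun x => u k x - u₀ x) 2 μ) atTop (𝓝 0)) :
    Tendsto (fun k => ∫ x, inner ℝ (u k x) (w x) ∂μ) atTop (𝓝 (∫ x, inner ℝ (u₀ x) (w x) ∂μ)) ∧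
      ∀ᶠ k in atTop, Integrable (fun x => inner ℝ (u k x) (w x)) μ := by
  have hev : ∀ᶠ k in atTop, MemLp (fun x => u k x - u₀ x) 2 μ :=
    (h.eventually_lt_const ENNReal.zero_lt_top).mono fun k hk =>
      ⟨(hu k).sub hu₀.aestronglyMeasurable, hk⟩
  have hint : ∀ᶠ k in atTop, Integrable (fun x => inner ℝ (u k x) (w x)) μ :=
    hev.mono fun k hk => by
      have := hk.add hu₀
      refine integrable_inner_of_memLp ?_ hw
      rwa [show (fun x => u k x - u₀ x) + u₀ = u k by ext x; simp] at this
  refine ⟨?_, hint⟩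
  rw [tendsto_iff_norm_sub_tendsto_zero]
  have hbd : Tendsto (fun k => (eLpNorm (fun x => u k x - u₀ x) 2 μ).toReal *
      (eLpNorm w 2 μ).toReal) atTop (𝓝 0) := by
    have := (ENNReal.tendsto_toReal ENNReal.zero_ne_top).comp h
    simpa using this.mul_const (eLpNorm w 2 μ).toReal
  refine squeeze_zero' (Eventually.of_forall fun _ => norm_nonneg _) ?_ hbd
  filter_upwards [hev, hint] with k hk hki
  rw [← integral_sub hki (integrable_inner_of_memLp hu₀ hw)]
  have h1 := norm_inner_le_norm (𝕜 := ℝ) (hk.toLp _) (hw.toLp _)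
  rw [L2.inner_def, Lp.norm_toLp, Lp.norm_toLp] at h1
  refine le_trans (le_of_eq ?_) h1
  congr 1
  refine integral_congr_ae ?_
  filter_upwards [hk.coeFn_toLp, hw.coeFn_toLp] with x hx1 hx2
  rw [hx1, hx2, inner_sub_left]

/-- Green's formula on K has a boundary term on F only, so extension by zero creates no jump across
the rest of ∂K. The same identity gives the weak divergence (the test function vanishes on ∂Ω), the
trace on ΓV, and the zero trace on ΓN (the test function vanishes on ΓV, disjoint from ΓN). -/
lemma testField_inX {ι : Type} (G : FluxGeometry D K F Fr)
    {f : ι → Fin (n + 1) → E (n + 1) → ℝ} (hf : ∀ a, IsTestFlux K F Fr (f a)) :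
    (testField K F Fr f).InX D := by
  have hp : ∀ a, MemLp (K.carrier.indicator (fluxVec (f a))) 2 (volume.restrict D.Ω) := fun a => by
    have h : MemLp (fluxVec (f a)) 2 (volume.restrict K.carrier) :=
      memLp_restrict_of_continuous K.isCompact_carrier K.measurableSet_carrier subset_rfl
        (continuous_fluxVec fun i => ((hf a).contDiff i).continuous)
    exact ((memLp_indicator_iff_restrict K.measurableSet_carrier).2 h).restrict _
  have hdiv : ∀ a, MemLp (K.carrier.indicator (fluxDiv (f a))) 2 (volume.restrict D.Ω) := fun a => by
    have h : MemLp (fluxDiv (f a)) 2 (volume.restrict K.carrier) :=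
      memLp_restrict_of_continuous K.isCompact_carrier K.measurableSet_carrier subset_rfl
        (continuous_fluxDiv (hf a).contDiff)
    exact ((memLp_indicator_iff_restrict K.measurableSet_carrier).2 h).restrict _
  refine { memLp_p := hp, memLp_div := hdiv, memLp_nt := fun a => ?_, memLp_φ := fun a => MemLp.zero',
           weakDiv := fun a v hv hvΩ => ?_, trace_V := fun a v hv _ => (hf a).green_domain G hv.1,
           trace_N := fun a v hv hvN => ?_ }
  · have := isFiniteMeasure_surf_restrict G
    have h : MemLp (fluxNormal Fr (f a)) 2 ((surf (n + 1)).restrict F) :=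
      memLp_restrict_of_continuous G.isCompact G.isCompact.measurableSet subset_rfl
        (continuous_fluxNormal fun i => ((hf a).contDiff i).continuous)
    exact ((memLp_indicator_iff_restrict G.isCompact.measurableSet).2 h).restrict _
  · have h := (hf a).green_domain G hv.1
    have h0 : ∫ x in D.ΓV, F.indicator (fluxNormal Fr (f a)) x * v x ∂surf (n + 1) = 0 := by
      refine setIntegral_eq_zero_of_forall_eq_zero fun x hx => ?_
      have hxf : x ∈ frontier D.Ω := D.closure_ΓV_subset (subset_closure hx)
      rw [image_eq_zero_of_notMem_tsupport (f := v), mul_zero]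
      exact fun hxv => hxf.2 (D.isOpen.interior_eq.symm ▸ hvΩ hxv)
    rw [h0, integral_add, add_eq_zero_iff_eq_neg] at h
    · exact h
    · have h1 : MemLp (gradient v) 2 (volume.restrict D.Ω) :=
        ((continuous_gradient hv.1).memLp_of_hasCompactSupport (hv.2.fderiv ℝ |>.comp_left
          (map_zero (InnerProductSpace.toDual ℝ (E (n + 1))).symm))).restrict _
      simpa only [inner_gradient] using integrable_inner_of_memLp h1 (hp a)
    · have h1 : MemLp v 2 (volume.restrict D.Ω) :=
        (hv.1.continuous.memLp_of_hasCompactSupport hv.2).restrict _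
      exact (hdiv a).integrable_mul h1
  · refine ((hf a).green_domain G hv.1).trans ?_
    simp only [Pi.zero_apply, zero_mul, integral_zero]
    refine setIntegral_eq_zero_of_forall_eq_zero fun x hx => ?_
    rw [image_eq_zero_of_notMem_tsupport (f := v), mul_zero]
    exact fun hxv => disjoint_left.1 D.disjointVN hx
      (hvN ⟨hxv, D.closure_ΓV_subset (subset_closure hx)⟩)

lemma testField_inXLocal {Gr N : ℕ} {T : Mesh D.Ω} (G : FluxGeometry D K F Fr) (hKT : K ∈ T.cells)
    (hK : 0 < K.shapeRegularity)
    {f : Idx Gr N → Fin (n + 1) → E (n + 1) → ℝ} (hf : ∀ a, IsTestFlux K F Fr (f a)) :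
    (testField K F Fr f).InXLocal D T K :=
  ⟨testField_inX G hf, ae_of_all _ fun _ _ => rfl, ae_of_all _ fun x hx => by
    funext a
    exact indicator_of_notMem (fun h => hx (T.carrier_subset_patch hKT hK h)) _⟩

/-- Green's formula for the test flux and a function of `H^1(Ω)`. -/
lemma IsTestFlux.green_trace (G : FluxGeometry D K F Fr) {f : Fin (n + 1) → E (n + 1) → ℝ}
    (hf : IsTestFlux K F Fr f) {u : E (n + 1) → ℝ} {g : E (n + 1) → E (n + 1)}
    {t : E (n + 1) → ℝ} (hu : MemLp u 2 (volume.restrict D.Ω))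
    (hg : MemLp g 2 (volume.restrict D.Ω))
    (ht : MemLp t 2 ((surf (n + 1)).restrict (frontier D.Ω))) (htr : IsTrace D.Ω u g t) :
    (∫ x in D.Ω, inner ℝ (g x) (K.carrier.indicator (fluxVec f) x)) +
        ∫ x in D.Ω, u x * K.carrier.indicator (fluxDiv f) x =
      ∫ x in F, t x * fluxNormal Fr f x ∂surf (n + 1) := by
  obtain ⟨v, hv, h1, h2, h3⟩ := htr
  have hX := testField_inX (ι := Unit) G fun _ => hf
  have hΓ : (surf (n + 1)).restrict D.ΓV ≤ (surf (n + 1)).restrict (frontier D.Ω) :=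
    Measure.restrict_mono (subset_closure.trans D.closure_ΓV_subset) le_rfl
  obtain ⟨l1, i1⟩ := tendsto_integral_inner (fun k => (hv k).1.continuous.aestronglyMeasurable) hu
    (hX.memLp_div ()) h1
  obtain ⟨l2, i2⟩ := tendsto_integral_inner (fun k => (continuous_gradient (hv k).1).aestronglyMeasurable) hg
    (hX.memLp_p ()) h2
  obtain ⟨l3, -⟩ := tendsto_integral_inner (fun k => (hv k).1.continuous.aestronglyMeasurable)
    (ht.mono_measure hΓ) (hX.memLp_nt ())
    (tendsto_of_tendsto_of_tendsto_of_le_of_le tendsto_const_nhds h3 (fun _ => zero_le)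
      fun k => eLpNorm_mono_measure _ hΓ)
  -- The formula holds for the smooth approximants that define the trace, and both of its sides
  -- converge.
  have hlim := tendsto_nhds_unique (l2.add l1) (l3.congr' ?_)
  · rw [show (∫ x in F, t x * fluxNormal Fr f x ∂surf (n + 1)) = ∫ x in D.ΓV,
      inner ℝ (t x) ((testField K F Fr fun _ : Unit => f).nt x ()) ∂surf (n + 1) from ?_, ← hlim]
    · simp [testField, mul_comm]
    · rw [setIntegral_ΓV_eq G.isCompact.measurableSet G.subset_closure fun x _ hx => by
        simp [testField, hx]]
      refine setIntegral_congr_fun G.isCompact.measurableSet fun x hx => ?_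
      simp [testField, hx, mul_comm]
  · filter_upwards [i1, i2] with k hk1 hk2
    rw [← integral_add hk2 hk1]
    refine Eq.trans ?_ ((hf.green_domain G (hv k).1).symm.trans ?_)
    · simp [testField]
    · refine integral_congr_ae (ae_of_all _ fun x => ?_)
      simp [testField, mul_comm]

end

/-! ### Polynomial data on the cells -/

section

variable {n : ℕ} {K : Cell (n + 1)}

lemma Cell.IsPolyOn.exists_polyFun {m : ℕ} {f : E (n + 1) → ℝ} (h : K.IsPolyOn m f) :
    ∃ Φ ∈ PolyFun (n + 1) m, ∀ᵐ x ∂volume.restrict K.carrier, f x = Φ x := by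
  obtain ⟨P, hP, h⟩ := h
  exact ⟨_, PolyFun.mem_iff.2 ⟨P, hP, fun _ => rfl⟩, h⟩

lemma totalDegree_le_of_degreeOf_le {d k : ℕ} {P : MvPolynomial (Fin d) ℝ}
    (h : ∀ j, P.degreeOf j ≤ k) : P.totalDegree ≤ d * k := by
  refine Finset.sup_le fun s hs => ?_
  rw [Finsupp.sum_fintype _ _ fun _ => rfl]
  refine (Finset.sum_le_card_nsmul _ _ k fun j _ =>
    (MvPolynomial.monomial_le_degreeOf j hs).trans (h j)).trans ?_
  simp

lemma Cell.coords_polyFun (K : Cell (n + 1)) (i : Fin (n + 1)) :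
    (fun x => K.coords x i) ∈ PolyFun (n + 1) 1 := by
  cases K with
  | simplex s => exact PolyFun.coord i
  | box e a b hab =>
    simp only [Cell.coords, OrthonormalBasis.repr_apply_apply]
    exact PolyFun.inner_left (e i)

lemma Cell.InScalarSpace.exists_polyFun {k : ℕ} {f : E (n + 1) → ℝ} (h : K.InScalarSpace k f) :
    ∃ Φ ∈ PolyFun (n + 1) ((n + 1) * k), ∀ᵐ x ∂volume.restrict K.carrier, f x = Φ x := by
  obtain ⟨P, hP, h⟩ := h
  refine ⟨_, PolyFun.eval_affine P ?_ (K.coords_polyFun), h⟩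
  cases K with
  | simplex s => exact (show P.totalDegree ≤ k from hP).trans (Nat.le_mul_of_pos_left _ n.succ_pos)
  | box e a b hab => exact totalDegree_le_of_degreeOf_le hP

/-- A bound k + 1 on the degree in each of the n + 1 edge coordinates bounds the total degree by
(n+1)(k+1), and an orthonormal change of coordinates preserves total degree. Simplices and cuboids
then share one polynomial space. -/
lemma Cell.InRTN.exists_polyFun {k : ℕ} {q : E (n + 1) → E (n + 1)} (h : K.InRTN k q) :
    ∃ P : Fin (n + 1) → E (n + 1) → ℝ, (∀ i, P i ∈ PolyFun (n + 1) ((n + 1) * (k + 1))) ∧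
      ∀ᵐ x ∂volume.restrict K.carrier, q x = fluxVec P x := by
  obtain ⟨P, hP, h⟩ := h
  have hdeg : ∀ i, (P i).totalDegree ≤ (n + 1) * (k + 1) := by
    cases K with
    | simplex s =>
      obtain ⟨a, b, ha, hb, hab⟩ := hP
      intro i
      rw [hab]
      refine le_trans ?_ (Nat.le_mul_of_pos_left _ n.succ_pos)
      refine (MvPolynomial.totalDegree_add _ _).trans (max_le ((ha i).trans k.le_succ) ?_)
      refine (MvPolynomial.totalDegree_mul _ _).trans (add_le_add hb ?_)
      simp
    | box e a b hab =>
      refine fun i => totalDegree_le_of_degreeOf_le fun j => ?_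
      by_cases hj : j = i
      · subst hj; exact (hP j).1
      · exact ((hP i).2 j hj).trans k.le_succ
  have hQ : ∀ i, (fun x => MvPolynomial.eval (K.coords x) (P i)) ∈
      PolyFun (n + 1) ((n + 1) * (k + 1)) := fun i => PolyFun.eval_affine (P i) (hdeg i) K.coords_polyFun
  cases K with
  | simplex s =>
    refine ⟨_, hQ, h.mono fun x hx => ?_⟩
    ext i
    exact hx i
  | box e a b hab =>
    refine ⟨fun j x => ∑ i, e i j * MvPolynomial.eval ((Cell.box e a b hab).coords x) (P i),
      fun j => PolyFun.sum fun i _ => PolyFun.const_mul _ (hQ i), h.mono fun x hx => ?_⟩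
    have h1 := e.sum_repr (q x)
    ext j
    rw [← h1]
    have h2 : ∀ i, e.repr (q x) i = MvPolynomial.eval ((Cell.box e a b hab).coords x) (P i) := hx
    simp [h2, fluxVec, Finset.sum_apply, mul_comm]

end

/-! ### Weak derivatives and traces of fields that are smooth on a cell -/

section

variable {n : ℕ} {D : MixedDomain (n + 1)} {K : Cell (n + 1)} {F : Set (E (n + 1))} {Fr : Frame n}

lemma ae_restrict_carrier_of_interior {p : E (n + 1) → Prop}
    (h : ∀ᵐ x, x ∈ interior K.carrier → p x) : ∀ᵐ x ∂volume.restrict K.carrier, p x := by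
  rw [ae_restrict_iff' K.measurableSet_carrier]
  filter_upwards [h, measure_eq_zero_iff_ae_notMem.1 K.volume_frontier] with x hx hx' hxK
  exact hx (by_contra fun hi => hx' ⟨subset_closure hxK, hi⟩)

lemma integrable_mul_compact {f g : E (n + 1) → ℝ} (hf : Continuous f) (hg : Continuous g)
    (hs : HasCompactSupport g) : Integrable (fun x => f x * g x) :=
  (hf.mul hg).integrable_of_hasCompactSupport hs.mul_left

lemma integral_mul_fderiv_test {f v : E (n + 1) → ℝ} (hf : ContDiff ℝ ∞ f) (hv : IsTest v)
    (e : E (n + 1)) : ∫ x, f x * fderiv ℝ v x e = -∫ x, fderiv ℝ f x e * v x := by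
  have h1 : Continuous fun x => fderiv ℝ v x e :=
    (hv.1.continuous_fderiv (by simp)).clm_apply continuous_const
  have h2 : HasCompactSupport fun x => fderiv ℝ v x e :=
    (hv.2.fderiv ℝ).mono fun x hx h => hx (by simp [h])
  refine integral_mul_fderiv_eq_neg_fderiv_mul_of_integrable ?_ ?_ ?_
    (fun x _ => hf.differentiable (by simp) x) fun x _ => hv.1.differentiable (by simp) x
  · exact integrable_mul_compact ((hf.continuous_fderiv (by simp)).clm_apply continuous_const)
      hv.1.continuous hv.2
  · exact integrable_mul_compact hf.continuous h1 h2
  · exact integrable_mul_compact hf.continuous hv.1.continuous hv.2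

/-- Integrals over the domain of functions supported inside a cell. -/
lemma setIntegral_eq_of_support {f : E (n + 1) → ℝ} (hK : interior K.carrier ⊆ D.Ω)
    (h : ∀ x, x ∉ interior K.carrier → f x = 0) : ∫ x in D.Ω, f x = ∫ x, f x :=
  setIntegral_eq_integral_of_forall_compl_eq_zero fun x hx => h x fun hi => hx (hK hi)

lemma integral_eq_cell_of_support {f g : E (n + 1) → ℝ}
    (hf : ∀ x, x ∉ interior K.carrier → f x = 0) (hg : ∀ x, x ∉ interior K.carrier → g x = 0)
    (h : ∀ᵐ x ∂volume.restrict K.carrier, f x = g x) : ∫ x, f x = ∫ x, g x := by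
  rw [← setIntegral_eq_integral_of_forall_compl_eq_zero (s := K.carrier) fun x hx =>
      hf x fun hi => hx (interior_subset hi),
    ← setIntegral_eq_integral_of_forall_compl_eq_zero (s := K.carrier) fun x hx =>
      hg x fun hi => hx (interior_subset hi)]
  exact integral_congr_ae h

/-- The fundamental lemma of the calculus of variations in the interior of a cell. -/
lemma ae_eq_of_integral_test {f g : E (n + 1) → ℝ} (hK : interior K.carrier ⊆ D.Ω)
    (hf : MemLp f 2 (volume.restrict D.Ω)) (hg : Continuous g)
    (h : ∀ v, IsTest v → tsupport v ⊆ interior K.carrier →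
      ∫ x in D.Ω, f x * v x = ∫ x, g x * v x) :
    ∀ᵐ x ∂volume.restrict K.carrier, f x = g x := by
  have hfi : LocallyIntegrableOn f (interior K.carrier) := by
    have : IsFiniteMeasure (volume.restrict D.Ω) :=
      isFiniteMeasure_restrict.2 D.isBounded.measure_lt_top.ne
    have h1 : IntegrableOn f D.Ω := hf.integrable one_le_two
    exact (h1.mono_set hK).locallyIntegrableOn
  have key := isOpen_interior.ae_eq_zero_of_integral_contDiff_smul_eq_zero
    (μ := volume) (f := fun x => f x - g x) (U := interior K.carrier)
    (hfi.sub (hg.locallyIntegrable.locallyIntegrableOn _)) fun v hv hvs hvK => by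
      have hv0 : ∀ x, x ∉ interior K.carrier → v x = 0 := fun x hx =>
        image_eq_zero_of_notMem_tsupport fun h => hx (hvK h)
      have h1 := h v ⟨hv, hvs⟩ hvK
      have h2 : IntegrableOn (fun x => f x * v x) D.Ω := by
        have : MemLp v 2 (volume.restrict D.Ω) :=
          (hv.continuous.memLp_of_hasCompactSupport hvs).restrict _
        exact hf.integrable_mul this
      have h3 := integrable_mul_compact hg hv.continuous hvs
      rw [← setIntegral_eq_of_support hK fun x hx => by rw [hv0 x hx, mul_zero]] at h1
      rw [← setIntegral_eq_of_support hK fun x hx => by rw [hv0 x hx, zero_smul]]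
      simp only [smul_eq_mul, mul_sub]
      simp only [mul_comm (v _)]
      rw [integral_sub h2 h3.integrableOn, h1, sub_self]
  exact ae_restrict_carrier_of_interior (key.mono fun x hx hxi => sub_eq_zero.1 (hx hxi))

lemma fderiv_eq_zero_of_tsupport {v : E (n + 1) → ℝ} {s : Set (E (n + 1))} (hv : tsupport v ⊆ s)
    {x : E (n + 1)} (hx : x ∉ s) : fderiv ℝ v x = 0 :=
  image_eq_zero_of_notMem_tsupport fun h => hx (hv (tsupport_fderiv_subset ℝ h))

/-- The weak gradient of a function that is smooth on a cell is the gradient there. -/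
lemma IsWeakGrad.ae_eq {u Φ : E (n + 1) → ℝ} {g : E (n + 1) → E (n + 1)}
    (hK : interior K.carrier ⊆ D.Ω) (hg : MemLp g 2 (volume.restrict D.Ω))
    (h : IsWeakGrad D.Ω u g) (hΦ : ContDiff ℝ ∞ Φ)
    (hu : ∀ᵐ x ∂volume.restrict K.carrier, u x = Φ x) :
    ∀ᵐ x ∂volume.restrict K.carrier, ∀ i, g x i = fderiv ℝ Φ x (EuclideanSpace.single i 1) := by
  rw [ae_all_iff]
  intro i
  set e : E (n + 1) := EuclideanSpace.single i 1
  have hgi : ∀ x, inner ℝ (g x) e = g x i := fun x => by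
    simp [e, EuclideanSpace.inner_single_right]
  refine ae_eq_of_integral_test (D := D) hK ?_
    ((hΦ.continuous_fderiv (by simp)).clm_apply continuous_const) fun v hv hvK => ?_
  · simp only [← hgi]
    exact hg.inner_const e
  have h1 := h v hv (hvK.trans hK) e
  have hv0 : ∀ x, x ∉ interior K.carrier → v x = 0 := fun x hx =>
    image_eq_zero_of_notMem_tsupport fun h => hx (hvK h)
  have hdv0 : ∀ x, x ∉ interior K.carrier → fderiv ℝ v x = 0 := fun x hx =>
    fderiv_eq_zero_of_tsupport hvK hx
  rw [setIntegral_eq_of_support hK fun x hx => by simp [hdv0 x hx],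
    integral_eq_cell_of_support (g := fun x => Φ x * fderiv ℝ v x e)
      (fun x hx => by simp [hdv0 x hx]) (fun x hx => by simp [hdv0 x hx])
      (hu.mono fun x hx => by rw [hx]), integral_mul_fderiv_test hΦ hv, neg_inj] at h1
  simp only [hgi] at h1
  exact h1.symm

/-- The weak divergence of a field that is smooth on a cell is the divergence there. -/
lemma IsWeakDiv.ae_eq {q : E (n + 1) → E (n + 1)} {w : E (n + 1) → ℝ}
    {P : Fin (n + 1) → E (n + 1) → ℝ} (hK : interior K.carrier ⊆ D.Ω)
    (hw : MemLp w 2 (volume.restrict D.Ω)) (h : IsWeakDiv D.Ω q w) (hP : ∀ i, ContDiff ℝ ∞ (P i))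
    (hq : ∀ᵐ x ∂volume.restrict K.carrier, q x = fluxVec P x) :
    ∀ᵐ x ∂volume.restrict K.carrier, w x = fluxDiv P x := by
  refine ae_eq_of_integral_test (D := D) hK hw (continuous_fluxDiv hP) fun v hv hvK => ?_
  have hv0 : ∀ x, x ∉ interior K.carrier → v x = 0 := fun x hx =>
    image_eq_zero_of_notMem_tsupport fun h => hx (hvK h)
  have hdv0 : ∀ x, x ∉ interior K.carrier → fderiv ℝ v x = 0 := fun x hx =>
    fderiv_eq_zero_of_tsupport hvK hx
  have h1 := h v hv (hvK.trans hK)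
  have h2 : ∀ i, Integrable fun x => P i x * fderiv ℝ v x (EuclideanSpace.single i 1) := fun i =>
    integrable_mul_compact (hP i).continuous
      ((hv.1.continuous_fderiv (by simp)).clm_apply continuous_const)
      ((hv.2.fderiv ℝ).mono fun x hx h => hx (by simp [h]))
  have h3 : ∀ i, Integrable fun x => fderiv ℝ (P i) x (EuclideanSpace.single i 1) * v x := fun i =>
    integrable_mul_compact (((hP i).continuous_fderiv (by simp)).clm_apply continuous_const)
      hv.1.continuous hv.2
  rw [setIntegral_eq_of_support hK fun x hx => by simp [hdv0 x hx],
    integral_eq_cell_of_support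
      (g := fun x => ∑ i, P i x * fderiv ℝ v x (EuclideanSpace.single i 1))
      (fun x hx => by simp [hdv0 x hx]) (fun x hx => by simp [hdv0 x hx])
      (hq.mono fun x hx => by rw [hx, fderiv_fluxVec]), integral_finsetSum _ fun i _ => h2 i] at h1
  simp only [integral_mul_fderiv_test (hP _) hv, fluxDiv, Finset.sum_mul,
    Finset.sum_neg_distrib, neg_inj] at h1 ⊢
  rw [integral_finsetSum _ fun i _ => h3 i, h1]

/-- The fundamental lemma of the calculus of variations on a facet. -/
lemma ae_eq_of_integral_facet {U : Set (E (n + 1))} (G : FluxGeometry D K F Fr)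
    {f g : E (n + 1) → ℝ}
    (hU : IsOpen U) (hFU : ∀ᵐ x ∂(surf (n + 1)).restrict F, x ∈ U)
    (hf : MemLp f 2 ((surf (n + 1)).restrict F)) (hg : Continuous g)
    (h : ∀ v, IsTest v → tsupport v ⊆ U →
      ∫ x in F, f x * v x ∂surf (n + 1) = ∫ x in F, g x * v x ∂surf (n + 1)) :
    ∀ᵐ x ∂(surf (n + 1)).restrict F, f x = g x := by
  have := isFiniteMeasure_surf_restrict G
  have hgm : MemLp g 2 ((surf (n + 1)).restrict F) :=
    memLp_restrict_of_continuous G.isCompact G.isCompact.measurableSet subset_rfl hg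
  have hi : Integrable (fun x => f x - g x) ((surf (n + 1)).restrict F) :=
    (hf.sub hgm).integrable one_le_two
  have key := hU.ae_eq_zero_of_integral_contDiff_smul_eq_zero
    (μ := (surf (n + 1)).restrict F) (f := fun x => f x - g x)
    (hi.locallyIntegrable.locallyIntegrableOn _) fun v hv hvs hvK => by
      have hvm : MemLp v 2 ((surf (n + 1)).restrict F) :=
        memLp_restrict_of_continuous G.isCompact G.isCompact.measurableSet subset_rfl hv.continuous
      have h2 : Integrable (fun x => f x * v x) ((surf (n + 1)).restrict F) := hf.integrable_mul hvm
      have h3 : Integrable (fun x => g x * v x) ((surf (n + 1)).restrict F) := hgm.integrable_mul hvm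
      simp only [smul_eq_mul, mul_sub]
      simp only [mul_comm (v _)]
      rw [integral_sub h2 h3, h v ⟨hv, hvs⟩ hvK, sub_self]
  filter_upwards [key, hFU] with x hx hxU
  exact sub_eq_zero.1 (hx hxU)

lemma memLp_surf_mono {G' : Type*} [NormedAddCommGroup G'] {t : E (n + 1) → G'} {Γ : Set (E (n + 1))}
    (h : MemLp t 2 ((surf (n + 1)).restrict Γ)) (hF : F ≤ᵐ[surf (n + 1)] Γ) :
    MemLp t 2 ((surf (n + 1)).restrict F) := h.mono_measure (Measure.restrict_mono_ae hF)

lemma FluxGeometry.ae_le_ΓV (G : FluxGeometry D K F Fr) : F ≤ᵐ[surf (n + 1)] D.ΓV :=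
  (LE.le.eventuallyLE G.subset_closure).trans D.closure_ΓV_ae_eq.le

variable {r : ℝ}

/-- Tests supported in the flat part of the facet produce test fluxes. -/
lemma isTestFlux_mul (H : IsFacetFrame K F Fr r) {v : E (n + 1) → ℝ} (hv : IsTest v)
    (hvU : tsupport v ⊆ flatSet D.Ω K Fr) {P : Fin (n + 1) → E (n + 1) → ℝ}
    (hP : ∀ i, ContDiff ℝ ∞ (P i)) : IsTestFlux K F Fr fun i x => P i x * v x where
  contDiff i := (hP i).mul hv.1
  compact _ := hv.2.mul_left
  half _ _ hx := ⟨fun h => H.carrier_subset h, fun h =>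
    flatSet_inter_half_subset ⟨hvU (tsupport_mul_subset_right hx), h⟩⟩
  facet _ _ hx hxp := H.facet_eq ▸ ⟨flatSet_inter_half_subset
    ⟨hvU (tsupport_mul_subset_right hx), Fr.plane_subset_half hxp⟩, hxp⟩

lemma ae_domain_of_cell {Ω : Set (E (n + 1))} {p : E (n + 1) → Prop}
    (h : ∀ᵐ x ∂volume.restrict K.carrier, p x) (h' : ∀ x, x ∉ K.carrier → p x) :
    ∀ᵐ x ∂volume.restrict Ω, p x := by
  refine ae_restrict_of_ae (((ae_restrict_iff' K.measurableSet_carrier).1 h).mono fun x hx => ?_)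
  by_cases hxK : x ∈ K.carrier
  exacts [hx hxK, h' x hxK]

lemma sum_ν_sq (Fr : Frame n) : ∑ i, Fr.ν i * Fr.ν i = 1 := by
  rw [← Fr.inner_ν_ν, PiLp.inner_apply]
  simp [sq]

/-- The trace on a facet of a function of `H^1(Ω)` that is smooth on the adjacent cell. -/
lemma IsTrace.ae_eq (G : FluxGeometry D K F Fr) (H : IsFacetFrame K F Fr r)
    (hFU : ∀ᵐ x ∂(surf (n + 1)).restrict F, x ∈ flatSet D.Ω K Fr)
    {u Φ : E (n + 1) → ℝ} {g : E (n + 1) → E (n + 1)}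
    {t : E (n + 1) → ℝ} (hu : MemLp u 2 (volume.restrict D.Ω))
    (hg : MemLp g 2 (volume.restrict D.Ω)) (hw : IsWeakGrad D.Ω u g)
    (ht : MemLp t 2 ((surf (n + 1)).restrict (frontier D.Ω))) (htr : IsTrace D.Ω u g t)
    (hΦ : ContDiff ℝ ∞ Φ) (huΦ : ∀ᵐ x ∂volume.restrict K.carrier, u x = Φ x) :
    ∀ᵐ x ∂(surf (n + 1)).restrict F, t x = Φ x := by
  have hgΦ := hw.ae_eq G.interior_subset hg hΦ huΦ
  refine ae_eq_of_integral_facet G isOpen_flatSet hFU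
    (ht.mono_measure (Measure.restrict_mono (G.subset_closure.trans D.closure_ΓV_subset) le_rfl))
    hΦ.continuous fun v hv hvU => ?_
  -- The flux v ν has outer normal component -v, because ν points inwards. Green's formulas for u on
  -- Ω and for Φ on K have the same volume side with this flux, so their boundary sides agree.
  have hf := isTestFlux_mul H hv hvU (P := fun i _ => Fr.ν i) fun i => contDiff_const
  have hN : ∀ x, fluxNormal Fr (fun i x => Fr.ν i * v x) x = -v x := fun x => by
    simp only [fluxNormal, ← mul_assoc, ← Finset.sum_mul, sum_ν_sq, one_mul]
  have h1 := hf.green_trace G hu hg ht htr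
  have h2 := hf.green G hΦ
  simp only [hN, mul_neg, neg_mul, integral_neg] at h1 h2
  have hX := testField_inX (ι := Unit) G fun _ => hf
  rw [← neg_inj, ← h1]
  simp only [mul_comm (Φ _) (v _)]
  rw [← h2, ← setIntegral_indicator_cell G.interior_subset, ← integral_add]
  · refine integral_congr_ae ?_
    refine ae_domain_of_cell (K := K) ?_ fun x hx => by simp [indicator_of_notMem hx]
    filter_upwards [huΦ, hgΦ, ae_restrict_mem K.measurableSet_carrier] with x h1 h2 hx
    simp only [indicator_of_mem hx, h1, fderiv_fluxVec, ← h2]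
    simp [PiLp.inner_apply, fluxVec, mul_comm]
  · exact integrable_inner_of_memLp hg (hX.memLp_p ())
  · exact hu.integrable_mul (hX.memLp_div ())

/-- Near a flat point Ω is the set of positive heights, whose boundary is the set of zero height. -/
lemma mem_plane_of_mem_frontier {Ω : Set (E (n + 1))} (hΩ : IsOpen Ω) {x : E (n + 1)}
    (hx : x ∈ flatSet Ω K Fr) (hxΩ : x ∈ frontier Ω) : x ∈ Fr.plane := by
  refine le_antisymm ?_ ?_
  · by_contra! h
    exact hxΩ.2 (hΩ.interior_eq.symm ▸ (mem_iff_of_mem_flatSet hx).2 h)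
  · by_contra! h
    obtain ⟨y, ⟨hy1, hy2⟩, hy3⟩ := mem_closure_iff.1 hxΩ.1 (flatSet Ω K Fr ∩ {y | Fr.height y < 0})
      (isOpen_flatSet.inter (isOpen_lt Fr.continuous_height continuous_const)) ⟨hx, h⟩
    have h1 := (mem_iff_of_mem_flatSet hy1).1 hy3
    exact lt_asymm h1 hy2

/-- The normal trace on a boundary facet of a field that is smooth on the adjacent cell. -/
lemma IsNormalTrace.ae_eq (G : FluxGeometry D K F Fr) (H : IsFacetFrame K F Fr r)
    (hFU : ∀ᵐ x ∂(surf (n + 1)).restrict F, x ∈ flatSet D.Ω K Fr)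
    {q : E (n + 1) → E (n + 1)} {w t : E (n + 1) → ℝ} {P : Fin (n + 1) → E (n + 1) → ℝ}
    (hw : MemLp w 2 (volume.restrict D.Ω)) (hdiv : IsWeakDiv D.Ω q w)
    (ht : MemLp t 2 ((surf (n + 1)).restrict D.ΓV)) (htr : IsNormalTrace D.Ω D.ΓV q w t)
    (hP : ∀ i, ContDiff ℝ ∞ (P i))
    (hq : ∀ᵐ x ∂volume.restrict K.carrier, q x = fluxVec P x) :
    ∀ᵐ x ∂(surf (n + 1)).restrict F, t x = fluxNormal Fr P x := by
  have hwP := hdiv.ae_eq G.interior_subset hw hP hq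
  obtain ⟨W, hW, hWV⟩ := D.partV.isOpen
  have hFV : ∀ᵐ x ∂(surf (n + 1)).restrict F, x ∈ D.ΓV := by
    refine (ae_restrict_iff' G.isCompact.measurableSet).2 ?_
    refine (measure_eq_zero_iff_ae_notMem.1 (ae_le_set.1 G.ae_le_ΓV)).mono fun x hx hxF => ?_
    exact by_contra fun h => hx ⟨hxF, h⟩
  -- Confining the tests to W, where ΓV = W ∩ ∂Ω, makes them admissible in the definition of the
  -- normal trace on ΓV.
  refine ae_eq_of_integral_facet G (isOpen_flatSet.inter hW)
    (hFU.and (hFV.mono fun x hx => (hWV ▸ hx : x ∈ W ∩ frontier D.Ω).1))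
    (memLp_surf_mono ht G.ae_le_ΓV) (continuous_fluxNormal fun i => (hP i).continuous)
    fun v hv hvU => ?_
  have hvU1 : tsupport v ⊆ flatSet D.Ω K Fr := hvU.trans inter_subset_left
  have h1 := htr v hv (hWV ▸ inter_subset_inter_left _ (hvU.trans inter_subset_right))
  rw [setIntegral_ΓV_eq G.isCompact.measurableSet G.subset_closure] at h1
  · rw [← h1]
    have hf := isTestFlux_mul H hv hvU1 hP
    -- The function v is put into the flux, so Green's formula is applied to v P against the
    -- constant 1.
    have h2 := hf.green G (g := fun _ => 1) contDiff_const
    have hN : ∀ x, fluxNormal Fr (fun i x => P i x * v x) x = fluxNormal Fr P x * v x := fun x => by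
      simp only [fluxNormal, neg_mul, Finset.sum_mul, mul_assoc]
    simp only [hN, mul_one, fderiv_fun_const, Pi.zero_apply, zero_apply,
      zero_add] at h2
    rw [← h2, ← setIntegral_indicator_cell G.interior_subset]
    refine (setIntegral_congr_fun (g := K.carrier.indicator fun x => fderiv ℝ v x (q x) + w x * v x)
      D.isOpen.measurableSet fun x hx => ?_).trans ?_
    · by_cases hxK : x ∈ K.carrier
      · rw [indicator_of_mem hxK]
      -- Flatness enters here: inside Ω the support of v lies in K, so the values of q in other
      -- cells are irrelevant.
      · have hxv : x ∉ tsupport v := fun h => hxK (flatSet_inter_half_subset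
          ⟨hvU1 h, ((mem_iff_of_mem_flatSet (hvU1 h)).1 hx).le⟩)
        rw [indicator_of_notMem hxK, image_eq_zero_of_notMem_tsupport hxv,
          fderiv_eq_zero_of_tsupport subset_rfl hxv]
        simp
    · refine integral_congr_ae (ae_domain_of_cell (K := K) ?_ fun x hx => by
        simp [indicator_of_notMem hx])
      filter_upwards [hq, hwP, ae_restrict_mem K.measurableSet_carrier] with x h1 h2 hx
      simp only [indicator_of_mem hx, h1, h2, fderiv_fluxVec, fluxDiv, Finset.sum_mul,
        ← Finset.sum_add_distrib]
      refine Finset.sum_congr rfl fun i _ => ?_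
      rw [fderiv_fun_mul ((hP i).differentiable (by simp) x) (hv.1.differentiable (by simp) x)]
      simp; ring
  · intro x hx hxF
    have hxv : x ∉ tsupport v := fun h => hxF (by
      have hxp := mem_plane_of_mem_frontier D.isOpen (hvU1 h)
        (D.closure_ΓV_subset (subset_closure hx))
      exact H.facet_eq ▸ ⟨flatSet_inter_half_subset ⟨hvU1 h, Fr.plane_subset_half hxp⟩, hxp⟩)
    rw [image_eq_zero_of_notMem_tsupport hxv, mul_zero]

end

/-! ### The residual of the discrete solution -/

section

variable {n Gr N : ℕ} {D : MixedDomain (n + 1)} {S : CrossSections (n + 1) Gr}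

/-- A function that is continuous on each cell is essentially bounded in the domain. -/
lemma Mesh.memLp_top (T : Mesh D.Ω) {f : E (n + 1) → ℝ}
    (h : ∀ K ∈ T.cells, ∃ Φ : E (n + 1) → ℝ, Continuous Φ ∧
      ∀ᵐ x ∂volume.restrict K.carrier, f x = Φ x) : MemLp f ∞ (volume.restrict D.Ω) := by
  have hle : volume.restrict D.Ω ≤ volume.restrict (⋃ K ∈ T.cells, K.carrier) :=
    Measure.restrict_mono (T.cover ▸ subset_closure) le_rfl
  refine MemLp.mono_measure hle ?_
  have hK : ∀ K ∈ T.cells, MemLp f ∞ (volume.restrict K.carrier) := fun K hKT => by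
    obtain ⟨Φ, hΦ, h⟩ := h K hKT
    refine (memLp_congr_ae h).2 ?_
    exact memLp_restrict_of_continuous K.isCompact_carrier K.measurableSet_carrier subset_rfl hΦ
  have hmeas : AEStronglyMeasurable f (volume.restrict (⋃ K ∈ T.cells, K.carrier)) := by
    rw [show (⋃ K ∈ T.cells, K.carrier) = ⋃ K : T.cells, (K : Cell (n + 1)).carrier by
      rw [iUnion_subtype]]
    exact AEStronglyMeasurable.iUnion fun K => (hK K K.2).aestronglyMeasurable
  refine memLp_top_of_bound hmeas
    (∑ K ∈ T.cells, (eLpNorm f ∞ (volume.restrict K.carrier)).toReal) ?_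
  rw [ae_restrict_biUnion_finset_iff]
  intro K hKT
  have h1 := ae_le_eLpNormEssSup (f := f) (μ := volume.restrict K.carrier)
  filter_upwards [h1] with x hx
  refine le_trans ?_ (Finset.single_le_sum (f := fun K : Cell (n + 1) =>
    (eLpNorm f ∞ (volume.restrict K.carrier)).toReal) (fun _ _ => ENNReal.toReal_nonneg) hKT)
  rw [eLpNorm_exponent_top, ← ENNReal.toReal_ofReal (norm_nonneg (f x))]
  refine ENNReal.toReal_mono ?_ (by rwa [ofReal_norm])
  rw [← eLpNorm_exponent_top]
  exact (hK K hKT).eLpNorm_lt_top.ne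

lemma isFiniteMeasure_domain (D : MixedDomain (n + 1)) : IsFiniteMeasure (volume.restrict D.Ω) :=
  isFiniteMeasure_restrict.2 D.isBounded.measure_lt_top.ne

/-- The components of a mixed field are square integrable. -/
structure MixedField.MemL2 (D : MixedDomain (n + 1)) (ζ : MixedField (n + 1) (Idx Gr N)) :
    Prop where
  p : ∀ a, MemLp (fun x => ζ.p x a) 2 (volume.restrict D.Ω)
  div : ∀ a, MemLp (fun x => ζ.div x a) 2 (volume.restrict D.Ω)
  nt : ∀ a, MemLp (fun x => ζ.nt x a) 2 ((surf (n + 1)).restrict D.ΓV)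
  φ : ∀ a, MemLp (fun x => ζ.φ x a) 2 (volume.restrict D.Ω)

lemma MixedField.InX.memL2 {ζ : MixedField (n + 1) (Idx Gr N)} (h : ζ.InX D) : ζ.MemL2 D :=
  ⟨h.memLp_p, h.memLp_div, h.memLp_nt, h.memLp_φ⟩

/-- The entries of the removal-scattering matrices are essentially bounded. -/
structure BoundedCoeffs (D : MixedDomain (n + 1)) (S : CrossSections (n + 1) Gr) (N : ℕ) :
    Prop where
  odd : ∀ a b, MemLp (fun x => S.To N x a b) ∞ (volume.restrict D.Ω)
  even : ∀ a b, MemLp (fun x => S.Te N x a b) ∞ (volume.restrict D.Ω)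

lemma memLp_matrix_smul {X H ι : Type*} [MeasurableSpace X] [Fintype ι] {μ : Measure X}
    [NormedAddCommGroup H] [NormedSpace ℝ H] {A : X → ι → ι → ℝ} {p : X → ι → H}
    (hA : ∀ a b, MemLp (fun x => A x a b) ∞ μ) (hp : ∀ a, MemLp (fun x => p x a) 2 μ) (a : ι) :
    MemLp (fun x => ∑ b, A x a b • p x b) 2 μ :=
  memLp_finsetSum _ fun b _ => MemLp.smul (r := 2) (hp b) (hA a b)

lemma integral_sum_sum_mul {X ι : Type*} [MeasurableSpace X] [Fintype ι] {μ : Measure X}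
    (c : ι → ι → ℝ) {g : ι → ι → X → ℝ} (hg : ∀ a b, Integrable (g a b) μ) :
    ∫ x, ∑ a, ∑ b, c a b * g a b x ∂μ = ∑ a, ∑ b, c a b * ∫ x, g a b x ∂μ := by
  rw [integral_finsetSum _ fun a _ => integrable_finsetSum _ fun b _ => (hg a b).const_mul _]
  refine Finset.sum_congr rfl fun a _ => ?_
  rw [integral_finsetSum _ fun b _ => (hg a b).const_mul _]
  exact Finset.sum_congr rfl fun b _ => integral_const_mul _ _

lemma integrable_dotProduct {X ι : Type*} [MeasurableSpace X] [Fintype ι] {μ : Measure X}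
    {u v : X → ι → ℝ} (hu : ∀ a, MemLp (fun x => u x a) 2 μ) (hv : ∀ a, MemLp (fun x => v x a) 2 μ) :
    Integrable (fun x => u x ⬝ᵥ v x) μ :=
  integrable_finsetSum _ fun a _ => (hu a).integrable_mul (hv a)

lemma memLp_mulVec {X ι : Type*} [MeasurableSpace X] [Fintype ι] {μ : Measure X}
    {A : X → Matrix ι ι ℝ} {p : X → ι → ℝ}
    (hA : ∀ a b, MemLp (fun x => A x a b) ∞ μ) (hp : ∀ a, MemLp (fun x => p x a) 2 μ) (a : ι) :
    MemLp (fun x => (A x).mulVec (p x) a) 2 μ :=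
  memLp_matrix_smul hA hp a

lemma memLp_const_mulVec {X ι : Type*} [MeasurableSpace X] [Fintype ι] {μ : Measure X}
    (A : Matrix ι ι ℝ) {p : X → ι → ℝ} (hp : ∀ a, MemLp (fun x => p x a) 2 μ) (a : ι) :
    MemLp (fun x => A.mulVec (p x) a) 2 μ :=
  memLp_mulVec (A := fun _ => A) (fun _ _ => memLp_top_const _) hp a

lemma integrable_formOdd (hS : BoundedCoeffs D S N) {p q : E (n + 1) → Idx Gr N → E (n + 1)}
    (hp : ∀ a, MemLp (fun x => p x a) 2 (volume.restrict D.Ω))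
    (hq : ∀ a, MemLp (fun x => q x a) 2 (volume.restrict D.Ω)) :
    Integrable (fun x => ∑ a, (inner ℝ (∑ b, S.To N x a b • p x b) (q x a) : ℝ))
      (volume.restrict D.Ω) :=
  integrable_finsetSum _ fun a _ =>
    integrable_inner_of_memLp (memLp_matrix_smul (A := fun x => S.To N x) hS.odd hp a) (hq a)

lemma dForm_sub (hS : BoundedCoeffs D S N) {ζ ζ' ξ : MixedField (n + 1) (Idx Gr N)}
    (hζ : ζ.MemL2 D) (hζ' : ζ'.MemL2 D) (hξ : ξ.MemL2 D) :
    dForm D S (ζ - ζ') ξ = dForm D S ζ ξ - dForm D S ζ' ξ := by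
  have h1 : formOdd D S (ζ - ζ').p ξ.p = formOdd D S ζ.p ξ.p - formOdd D S ζ'.p ξ.p := by
    simp only [formOdd]
    rw [← integral_sub (integrable_formOdd hS hζ.p hξ.p) (integrable_formOdd hS hζ'.p hξ.p)]
    refine integral_congr_ae (ae_of_all _ fun x => ?_)
    simp only [← Finset.sum_sub_distrib, ← inner_sub_left, ← smul_sub]
    rfl
  have h2 : formEven D S (ζ - ζ').φ ξ.φ = formEven D S ζ.φ ξ.φ - formEven D S ζ'.φ ξ.φ := by
    simp only [formEven]
    rw [← integral_sub (integrable_dotProduct (memLp_mulVec hS.even hζ.φ) hξ.φ)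
      (integrable_dotProduct (memLp_mulVec hS.even hζ'.φ) hξ.φ)]
    refine integral_congr_ae (ae_of_all _ fun x => ?_)
    dsimp only
    rw [← sub_dotProduct, ← Matrix.mulVec_sub]
    rfl
  have h3 : formRobin D (ζ - ζ').nt ξ.nt = formRobin D ζ.nt ξ.nt - formRobin D ζ'.nt ξ.nt := by
    simp only [formRobin]
    rw [← integral_sub (integrable_dotProduct (memLp_const_mulVec _ hζ.nt) hξ.nt)
      (integrable_dotProduct (memLp_const_mulVec _ hζ'.nt) hξ.nt)]
    refine integral_congr_ae (ae_of_all _ fun x => ?_)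
    dsimp only
    rw [← sub_dotProduct, ← Matrix.mulVec_sub]
    rfl
  have h4 : formDiv D ξ.φ (ζ - ζ').div = formDiv D ξ.φ ζ.div - formDiv D ξ.φ ζ'.div := by
    simp only [formDiv]
    rw [← integral_sub (integrable_dotProduct hξ.φ (memLp_const_mulVec _ hζ.div))
      (integrable_dotProduct hξ.φ (memLp_const_mulVec _ hζ'.div))]
    refine integral_congr_ae (ae_of_all _ fun x => ?_)
    dsimp only
    rw [← dotProduct_sub, ← Matrix.mulVec_sub]
    rfl
  have h5 : formDiv D (ζ - ζ').φ ξ.div = formDiv D ζ.φ ξ.div - formDiv D ζ'.φ ξ.div := by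
    simp only [formDiv]
    rw [← integral_sub (integrable_dotProduct hζ.φ (memLp_const_mulVec _ hξ.div))
      (integrable_dotProduct hζ'.φ (memLp_const_mulVec _ hξ.div))]
    refine integral_congr_ae (ae_of_all _ fun x => ?_)
    dsimp only
    rw [← sub_dotProduct]
    rfl
  simp only [dForm, h1, h2, h3, h4, h5]
  ring

/-- Reversing the sign of the flux component exchanges the forms c and d, and the source pairs only
with the scalar component. -/
lemma IsSolution.dForm_eq {Sf : E (n + 1) → Idx Gr N → ℝ} {ζ ξ : MixedField (n + 1) (Idx Gr N)}
    (h : IsSolution D S Sf ζ) (hξ : ξ.InX D) :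
    dForm D S ζ ξ = ∫ x in D.Ω, Sf x ⬝ᵥ ξ.φ x := by
  let ξ' : MixedField (n + 1) (Idx Gr N) :=
    ⟨fun x a => -ξ.p x a, fun x a => -ξ.div x a, fun x a => -ξ.nt x a, ξ.φ⟩
  have hξ' : ξ'.InX D :=
    { memLp_p := fun a => (hξ.memLp_p a).neg
      memLp_div := fun a => (hξ.memLp_div a).neg
      memLp_nt := fun a => (hξ.memLp_nt a).neg
      memLp_φ := hξ.memLp_φ
      weakDiv := fun a v hv hvΩ => by
        have := hξ.weakDiv a v hv hvΩ
        simp only [ξ', map_neg, neg_mul, integral_neg, this]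
      trace_V := fun a v hv hvV => by
        have := hξ.trace_V a v hv hvV
        simp only [ξ', map_neg, neg_mul, integral_neg, ← this, ← neg_add]
      trace_N := fun a v hv hvV => by
        have := hξ.trace_N a v hv hvV
        simp only [ξ', map_neg, neg_mul, integral_neg, ← neg_add, this]
        simp }
  have h1 : dForm D S ζ ξ = cForm D S ζ ξ' := by
    have e1 : formOdd D S ζ.p ξ'.p = -formOdd D S ζ.p ξ.p := by
      simp only [formOdd, ξ', inner_neg_right, Finset.sum_neg_distrib, integral_neg]
    have e2 : formDiv D ζ.φ ξ'.div = -formDiv D ζ.φ ξ.div := by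
      simp only [formDiv, ← integral_neg, ← dotProduct_neg, ← Matrix.mulVec_neg]
      rfl
    have e3 : formRobin D ζ.nt ξ'.nt = -formRobin D ζ.nt ξ.nt := by
      simp only [formRobin, ← integral_neg, ← dotProduct_neg]
      rfl
    simp only [dForm, cForm, e1, e2, e3]
    ring
  rw [h1, h.2 ξ' hξ']

/-- The error becomes a residual: the exact solution survives only through the source. -/
lemma dForm_sub_reconstruction (hS : BoundedCoeffs D S N) {Sf : E (n + 1) → Idx Gr N → ℝ}
    {ζ ζh ξ : MixedField (n + 1) (Idx Gr N)} {φt : ScalarField (n + 1) (Idx Gr N)}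
    (h : IsSolution D S Sf ζ) (hζh : ζh.InX D) (hφt : φt.InV D) (hξ : ξ.InX D) :
    dForm D S (ζ - reconstruction ζh φt) ξ =
      (∫ x in D.Ω, Sf x ⬝ᵥ ξ.φ x) - dForm D S (reconstruction ζh φt) ξ := by
  have h2 : (reconstruction ζh φt).MemL2 D :=
    ⟨hζh.memLp_p, hζh.memLp_div, hζh.memLp_nt, hφt.memLp_val⟩
  rw [dForm_sub hS h.1.memL2 h2 hξ.memL2, h.dForm_eq hξ]

/-- The residual tested with a scalar field. -/
lemma dForm_scalar (hS : BoundedCoeffs D S N) {Sf : E (n + 1) → Idx Gr N → ℝ}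
    (hSf : ∀ a, MemLp (fun x => Sf x a) 2 (volume.restrict D.Ω))
    {ζ ζh ξ : MixedField (n + 1) (Idx Gr N)} {φt : ScalarField (n + 1) (Idx Gr N)}
    (h : IsSolution D S Sf ζ) (hζh : ζh.InX D) (hφt : φt.InV D) (hξ : ξ.InX D)
    (hp : ξ.p = 0) (hd : ξ.div = 0) (hn : ξ.nt = 0) :
    dForm D S (ζ - reconstruction ζh φt) ξ =
      ∫ x in D.Ω, (Sf x - (Hmat Gr N).transpose.mulVec (ζh.div x) -
        (S.Te N x).mulVec (φt.val x)) ⬝ᵥ ξ.φ x := by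
  have i1 := integrable_dotProduct hSf hξ.memLp_φ
  have i2 := integrable_dotProduct hξ.memLp_φ
    (memLp_const_mulVec (Hmat Gr N).transpose hζh.memLp_div)
  have i3 := integrable_dotProduct (memLp_mulVec hS.even hφt.memLp_val) hξ.memLp_φ
  rw [dForm_sub_reconstruction hS h hζh hφt hξ]
  simp only [dForm, reconstruction, hp, hd, hn, formOdd, formEven, formRobin, formDiv,
    Pi.zero_apply, inner_zero_right, Finset.sum_const_zero, integral_zero, dotProduct_zero,
    Matrix.mulVec_zero, zero_add, add_zero, sub_zero]
  have i4 : Integrable (fun x => (S.Te N x).mulVec (φt.val x) ⬝ᵥ ξ.φ x +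
      ξ.φ x ⬝ᵥ (Hmat Gr N).transpose.mulVec (ζh.div x)) (volume.restrict D.Ω) := i3.add i2
  rw [← integral_add i3 i2, ← integral_sub i1 i4]
  refine integral_congr_ae (ae_of_all _ fun x => ?_)
  dsimp only
  rw [dotProduct_comm (ξ.φ x), sub_dotProduct, sub_dotProduct]
  ring

variable {K : Cell (n + 1)} {F : Set (E (n + 1))} {Fr : Frame n}

/-- The residual tested with a local flux. -/
lemma dForm_flux (hS : BoundedCoeffs D S N) {Sf : E (n + 1) → Idx Gr N → ℝ}
    {ζ ζh : MixedField (n + 1) (Idx Gr N)} {φt : ScalarField (n + 1) (Idx Gr N)}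
    (h : IsSolution D S Sf ζ) (hζh : ζh.InX D) (hφt : φt.InV D)
    (G : FluxGeometry D K F Fr) {f : Idx Gr N → Fin (n + 1) → E (n + 1) → ℝ}
    (hf : ∀ a, IsTestFlux K F Fr (f a)) :
    dForm D S (ζ - reconstruction ζh φt) (testField K F Fr f) =
      -(∫ x in K.carrier, ∑ a, inner ℝ ((∑ b, S.To N x a b • ζh.p x b) +
        ∑ b, Hmat Gr N a b • φt.grad x b) (fluxVec (f a) x)) +
      ∫ x in F, robinResidual ζh φt x ⬝ᵥ fun a => fluxNormal Fr (f a) x ∂surf (n + 1) := by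
  have hξ := testField_inX G hf
  rw [dForm_sub_reconstruction hS h hζh hφt hξ]
  have := isFiniteMeasure_surf_restrict G
  have hN : ∀ a, MemLp (fluxNormal Fr (f a)) 2 ((surf (n + 1)).restrict F) := fun a =>
    memLp_restrict_of_continuous G.isCompact G.isCompact.measurableSet subset_rfl
      (continuous_fluxNormal fun i => ((hf a).contDiff i).continuous)
  have htrF : ∀ a, MemLp (fun x => φt.tr x a) 2 ((surf (n + 1)).restrict F) := fun a =>
    (hφt.memLp_tr a).mono_measure
      (Measure.restrict_mono (G.subset_closure.trans D.closure_ΓV_subset) le_rfl)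
  have hntF : ∀ a, MemLp (fun x => ζh.nt x a) 2 ((surf (n + 1)).restrict F) := fun a =>
    memLp_surf_mono (hζh.memLp_nt a) G.ae_le_ΓV
  have hgrad : ∀ a, MemLp (fun x => ∑ b, Hmat Gr N a b • φt.grad x b) 2 (volume.restrict D.Ω) :=
    fun a => memLp_matrix_smul (A := fun _ => Hmat Gr N) (fun _ _ => memLp_top_const _)
      hφt.memLp_grad a
  have i1 := integrable_formOdd hS hζh.memLp_p hξ.memLp_p
  have i2 : Integrable (fun x => ∑ a, (inner ℝ (∑ b, Hmat Gr N a b • φt.grad x b)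
      ((testField K F Fr f).p x a) : ℝ)) (volume.restrict D.Ω) :=
    integrable_finsetSum _ fun a _ => integrable_inner_of_memLp (hgrad a) (hξ.memLp_p a)
  have i3 : Integrable (fun x => (Hmat Gr N).mulVec (φt.tr x) ⬝ᵥ fun a => fluxNormal Fr (f a) x)
      ((surf (n + 1)).restrict F) := integrable_dotProduct (memLp_const_mulVec _ htrF) hN
  have i4 : Integrable (fun x => (GammaT Gr N).mulVec (ζh.nt x) ⬝ᵥ fun a => fluxNormal Fr (f a) x)
      ((surf (n + 1)).restrict F) := integrable_dotProduct (memLp_const_mulVec _ hntF) hN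
  -- The H¹ regularity of the reconstruction is what allows moving the divergence onto a gradient
  -- and a boundary trace, after transposing ℍ.
  have hdiv : formDiv D φt.val (testField K F Fr f).div =
      (∫ x in F, (Hmat Gr N).mulVec (φt.tr x) ⬝ᵥ fun a => fluxNormal Fr (f a) x ∂surf (n + 1)) -
      ∫ x in D.Ω, ∑ a, inner ℝ (∑ b, Hmat Gr N a b • φt.grad x b)
        ((testField K F Fr f).p x a) := by
    have e1 : ∀ x, φt.val x ⬝ᵥ (Hmat Gr N).transpose.mulVec ((testField K F Fr f).div x) =
        ∑ a, ∑ b, Hmat Gr N a b * (φt.val x b * (testField K F Fr f).div x a) := fun x => by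
      rw [Matrix.mulVec_transpose, dotProduct_comm, ← Matrix.dotProduct_mulVec]
      simp only [dotProduct, Matrix.mulVec, Finset.mul_sum]
      refine Finset.sum_congr rfl fun a _ => Finset.sum_congr rfl fun b _ => ?_
      ring
    have e2 : ∀ x, ((Hmat Gr N).mulVec (φt.tr x) ⬝ᵥ fun a => fluxNormal Fr (f a) x) =
        ∑ a, ∑ b, Hmat Gr N a b * (φt.tr x b * fluxNormal Fr (f a) x) := fun x => by
      simp only [dotProduct, Matrix.mulVec, Finset.sum_mul]
      refine Finset.sum_congr rfl fun a _ => Finset.sum_congr rfl fun b _ => ?_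
      ring
    have e3 : ∀ x, (∑ a, (inner ℝ (∑ b, Hmat Gr N a b • φt.grad x b)
        ((testField K F Fr f).p x a) : ℝ)) = ∑ a, ∑ b, Hmat Gr N a b *
          inner ℝ (φt.grad x b) (K.carrier.indicator (fluxVec (f a)) x) := fun x => by
      simp only [sum_inner, inner_smul_left]
      rfl
    have j1 : ∀ a b, Integrable (fun x => φt.val x b * (testField K F Fr f).div x a)
        (volume.restrict D.Ω) := fun a b => (hφt.memLp_val b).integrable_mul (hξ.memLp_div a)
    have j2 : ∀ a b, Integrable (fun x => φt.tr x b * fluxNormal Fr (f a) x)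
        ((surf (n + 1)).restrict F) := fun a b => (htrF b).integrable_mul (hN a)
    have j3 : ∀ a b, Integrable (fun x => (inner ℝ (φt.grad x b)
        (K.carrier.indicator (fluxVec (f a)) x) : ℝ)) (volume.restrict D.Ω) := fun a b =>
      integrable_inner_of_memLp (hφt.memLp_grad b) (hξ.memLp_p a)
    simp only [formDiv, e1, e2, e3]
    rw [integral_sum_sum_mul (fun a b => Hmat Gr N a b) j1,
      integral_sum_sum_mul (fun a b => Hmat Gr N a b) j2,
      integral_sum_sum_mul (fun a b => Hmat Gr N a b) j3]
    simp only [← Finset.sum_sub_distrib, ← mul_sub]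
    refine Finset.sum_congr rfl fun a _ => Finset.sum_congr rfl fun b _ => ?_
    congr 1
    rw [← (hf a).green_trace G (hφt.memLp_val b) (hφt.memLp_grad b) (hφt.memLp_tr b) (hφt.trace b)]
    simp [testField]
  have hrob : formRobin D ζh.nt (testField K F Fr f).nt =
      ∫ x in F, (GammaT Gr N).mulVec (ζh.nt x) ⬝ᵥ fun a => fluxNormal Fr (f a) x ∂surf (n + 1) := by
    rw [formRobin, setIntegral_ΓV_eq G.isCompact.measurableSet G.subset_closure]
    · refine setIntegral_congr_fun G.isCompact.measurableSet fun x hx => ?_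
      simp only [testField, indicator_of_mem hx]
    · intro x _ hx
      simp only [testField, indicator_of_notMem hx]
      exact dotProduct_zero _
  have hφ0 : ∀ v : E (n + 1) → Idx Gr N → ℝ, ∀ x, v x ⬝ᵥ (testField K F Fr f).φ x = 0 := fun v x =>
    dotProduct_zero _
  have hφ1 : formEven D S φt.val (testField K F Fr f).φ = 0 := by
    simp only [formEven, hφ0 (fun x => (S.Te N x).mulVec (φt.val x)), integral_zero]
  have hφ2 : formDiv D (testField K F Fr f).φ ζh.div = 0 := by
    simp only [formDiv, fun x => dotProduct_comm ((testField K F Fr f).φ x),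
      hφ0 (fun x => (Hmat Gr N).transpose.mulVec (ζh.div x)), integral_zero]
  simp only [dForm, reconstruction, hrob, hdiv, hφ1, hφ2, hφ0 Sf, integral_zero]
  have e4 : ∀ x, robinResidual ζh φt x ⬝ᵥ (fun a => fluxNormal Fr (f a) x) =
      ((Hmat Gr N).mulVec (φt.tr x) ⬝ᵥ fun a => fluxNormal Fr (f a) x) -
      ((GammaT Gr N).mulVec (ζh.nt x) ⬝ᵥ fun a => fluxNormal Fr (f a) x) := fun x => by
    rw [robinResidual, sub_dotProduct]
  simp only [e4]
  rw [integral_sub i3 i4, ← setIntegral_indicator_cell G.interior_subset]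
  have e5 : (∫ x in D.Ω, K.carrier.indicator (fun x => ∑ a, (inner ℝ ((∑ b, S.To N x a b • ζh.p x b)
      + ∑ b, Hmat Gr N a b • φt.grad x b) (fluxVec (f a) x) : ℝ)) x) =
      formOdd D S ζh.p (testField K F Fr f).p + ∫ x in D.Ω, ∑ a,
        inner ℝ (∑ b, Hmat Gr N a b • φt.grad x b) ((testField K F Fr f).p x a) := by
    rw [formOdd, ← integral_add i1 i2]
    refine integral_congr_ae (ae_of_all _ fun x => ?_)
    simp only [← Finset.sum_add_distrib, ← inner_add_left, testField]
    by_cases hx : x ∈ K.carrier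
    · simp only [indicator_of_mem hx]
    · simp only [indicator_of_notMem hx, inner_zero_right, Finset.sum_const_zero]
  rw [e5]
  ring

end

/-! ### The local norm -/

section

variable {d Gr N : ℕ} {D : MixedDomain d} {S : CrossSections d Gr} {T : Mesh D.Ω} {K : Cell d}

instance {ι : Type} : SMul ℝ (MixedField d ι) where
  smul c ξ := ⟨fun x a => c • ξ.p x a, fun x a => c * ξ.div x a, fun x a => c * ξ.nt x a,
    fun x a => c * ξ.φ x a⟩

lemma MixedField.InX.smul {ι : Type} {ξ : MixedField d ι} (h : ξ.InX D) (c : ℝ) :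
    (c • ξ).InX D where
  memLp_p a := (h.memLp_p a).const_smul c
  memLp_div a := (h.memLp_div a).const_mul c
  memLp_nt a := (h.memLp_nt a).const_mul c
  memLp_φ a := (h.memLp_φ a).const_mul c
  weakDiv a v hv hvΩ := by
    have := congrArg (c * ·) (h.weakDiv a v hv hvΩ)
    simp only [mul_neg, ← integral_const_mul] at this
    simpa only [HSMul.hSMul, SMul.smul, map_smul, mul_assoc] using
      (by simpa only [map_smul, smul_eq_mul, mul_assoc] using this :
        ∫ x in D.Ω, fderiv ℝ v x (c • ξ.p x a) = -∫ x in D.Ω, c * ξ.div x a * v x)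
  trace_V a v hv hvV := by
    have := congrArg (c * ·) (h.trace_V a v hv hvV)
    simp only [← integral_const_mul] at this
    exact (by simpa only [map_smul, smul_eq_mul, mul_assoc, mul_add] using this :
      ∫ x in D.Ω, (fderiv ℝ v x (c • ξ.p x a) + c * ξ.div x a * v x) =
        ∫ x in D.ΓV, c * ξ.nt x a * v x ∂surf d)
  trace_N a v hv hvV := by
    have := congrArg (c * ·) (h.trace_N a v hv hvV)
    simp only [← integral_const_mul] at this
    exact (by simpa only [map_smul, smul_eq_mul, mul_assoc, mul_add, Pi.zero_apply, zero_mul,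
      mul_zero] using this :
      ∫ x in D.Ω, (fderiv ℝ v x (c • ξ.p x a) + c * ξ.div x a * v x) =
        ∫ x in D.ΓN, (0 : E d → ℝ) x * v x ∂surf d)

lemma MixedField.InXLocal.smul {ξ : MixedField d (Idx Gr N)} (h : ξ.InXLocal D T K) (c : ℝ) :
    (c • ξ).InXLocal D T K := by
  refine ⟨h.1.smul c, ?_, ?_⟩
  · filter_upwards [h.2.1] with x hx hxK
    funext a
    change c * ξ.φ x a = 0
    rw [hx hxK, Pi.zero_apply, mul_zero]
  · filter_upwards [h.2.2] with x hx hxK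
    funext a
    change c • ξ.p x a = 0
    rw [hx hxK, Pi.zero_apply, smul_zero]

lemma dForm_smul (c : ℝ) (ζ ξ : MixedField d (Idx Gr N)) :
    dForm D S ζ (c • ξ) = c * dForm D S ζ ξ := by
  have h1 : formOdd D S ζ.p (c • ξ).p = c * formOdd D S ζ.p ξ.p := by
    simp only [formOdd, ← integral_const_mul, Finset.mul_sum, ← real_inner_smul_right]
    rfl
  have h2 : formEven D S ζ.φ (c • ξ).φ = c * formEven D S ζ.φ ξ.φ := by
    rw [formEven, formEven, ← integral_const_mul]
    exact integral_congr_ae (ae_of_all _ fun x => dotProduct_smul c _ (ξ.φ x))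
  have h3 : formRobin D ζ.nt (c • ξ).nt = c * formRobin D ζ.nt ξ.nt := by
    rw [formRobin, formRobin, ← integral_const_mul]
    exact integral_congr_ae (ae_of_all _ fun x => dotProduct_smul c _ (ξ.nt x))
  have h4 : formDiv D (c • ξ).φ ζ.div = c * formDiv D ξ.φ ζ.div := by
    rw [formDiv, formDiv, ← integral_const_mul]
    exact integral_congr_ae (ae_of_all _ fun x => smul_dotProduct c (ξ.φ x) _)
  have h5 : formDiv D ζ.φ (c • ξ).div = c * formDiv D ζ.φ ξ.div := by
    rw [formDiv, formDiv, ← integral_const_mul]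
    refine integral_congr_ae (ae_of_all _ fun x => ?_)
    dsimp only
    rw [show (c • ξ).div x = c • ξ.div x from rfl, Matrix.mulVec_smul, dotProduct_smul, smul_eq_mul]
  simp only [dForm, h1, h2, h3, h4, h5]
  ring

/-- No sign of the radicand is needed: it is quadratic in ξ, and c² can be taken out of `Real.sqrt`
whatever the sign of the other factor. -/
lemma normS_smul (c : ℝ) (ξ : MixedField d (Idx Gr N)) :
    normS D S T (c • ξ) = |c| * normS D S T ξ := by
  have e1 : ∀ x, ∑ a, S.To N x a a * ‖(c • ξ).p x a‖ ^ 2 =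
      c ^ 2 * ∑ a, S.To N x a a * ‖ξ.p x a‖ ^ 2 := fun x => by
    rw [Finset.mul_sum]
    refine Finset.sum_congr rfl fun a _ => ?_
    rw [show (c • ξ).p x a = c • ξ.p x a from rfl, norm_smul, mul_pow, Real.norm_eq_abs, sq_abs]
    ring
  have e2 : ∀ x, ∑ a, S.Te N x a a * (c • ξ).φ x a ^ 2 =
      c ^ 2 * ∑ a, S.Te N x a a * ξ.φ x a ^ 2 := fun x => by
    rw [Finset.mul_sum]
    refine Finset.sum_congr rfl fun a _ => ?_
    rw [show (c • ξ).φ x a = c * ξ.φ x a from rfl]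
    ring
  have e3 : ∀ x, ∑ a, (c • ξ).div x a ^ 2 = c ^ 2 * ∑ a, ξ.div x a ^ 2 := fun x => by
    rw [Finset.mul_sum]
    refine Finset.sum_congr rfl fun a _ => ?_
    rw [show (c • ξ).div x a = c * ξ.div x a from rfl]
    ring
  have e4 : ∀ x, (GammaT Gr N).mulVec ((c • ξ).nt x) ⬝ᵥ (c • ξ).nt x =
      c ^ 2 * ((GammaT Gr N).mulVec (ξ.nt x) ⬝ᵥ ξ.nt x) := fun x => by
    rw [show (c • ξ).nt x = c • ξ.nt x from rfl, Matrix.mulVec_smul, smul_dotProduct,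
      dotProduct_smul]
    simp only [smul_eq_mul]
    ring
  simp only [normS, e1, e2, e3, e4, integral_const_mul]
  rw [← Real.sqrt_sq_eq_abs, ← Real.sqrt_mul (sq_nonneg c)]
  congr 1
  simp only [mul_add, Finset.mul_sum]
  congr 1
  · congr 1
    exact Finset.sum_congr rfl fun _ _ => by ring
  · exact Finset.sum_congr rfl fun _ _ => Finset.sum_congr rfl fun _ _ => by ring

/-- The residual is bounded by the local norm. -/
lemma MixedField.InXLocal.dForm_le {ζ ξ : MixedField d (Idx Gr N)} (h : ξ.InXLocal D T K)
    (hL : localNorm D S T K ζ ≠ ⊤) :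
    dForm D S ζ ξ ≤ normS D S T ξ * (localNorm D S T K ζ).toReal := by
  -- The norm of ξ may vanish, so ξ is normalised by any s > 0 that is at least the norm, and s is
  -- then decreased to the norm.
  have key : ∀ s : ℝ, 0 < s → normS D S T ξ ≤ s →
      dForm D S ζ ξ ≤ s * (localNorm D S T K ζ).toReal := by
    intro s hs hξ
    have h1 : ENNReal.ofReal (dForm D S ζ (s⁻¹ • ξ)) ≤ localNorm D S T K ζ := by
      refine le_iSup₂_of_le (s⁻¹ • ξ) (h.smul _) (le_iSup_of_le ?_ le_rfl)
      rw [normS_smul, abs_of_pos (inv_pos.2 hs)]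
      rwa [inv_mul_le_one₀ hs]
    rw [dForm_smul, ENNReal.ofReal_le_iff_le_toReal hL, inv_mul_le_iff₀ hs] at h1
    exact h1
  have hn : 0 ≤ normS D S T ξ := Real.sqrt_nonneg _
  have hlim : Tendsto (fun ε : ℝ => (normS D S T ξ + ε) * (localNorm D S T K ζ).toReal)
      (𝓝[>] 0) (𝓝 ((normS D S T ξ + 0) * (localNorm D S T K ζ).toReal)) :=
    ((continuous_const.add continuous_id).mul continuous_const).continuousWithinAt
  rw [add_zero] at hlim
  refine ge_of_tendsto hlim ?_
  filter_upwards [self_mem_nhdsWithin] with ε hε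
  have hε : 0 < ε := hε
  exact key _ (by linarith) (by linarith)

end

/-! ### Coefficients -/

section

variable {d : ℕ} {ι : Type} [Finite ι] [Nonempty ι] {K : Cell d}
  {T : E d → Matrix ι ι ℝ} {lo hi : ℝ}

/-- For real functions `essSup` and `essInf` have their usual meaning only under boundedness, which
lo and hi supply. The positive volume of K provides a point where both bounds hold. -/
lemma diag_bounds (h0 : volume K.carrier ≠ 0) (hlo : 0 < lo)
    (h : ∀ a, ∀ᵐ x ∂volume.restrict K.carrier, lo ≤ T x a a ∧ T x a a ≤ hi) :
    0 < diagMin T K ∧ diagMin T K ≤ diagMax T K ∧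
      ∀ᵐ x ∂volume.restrict K.carrier, ∀ a, diagMin T K ≤ T x a a ∧ T x a a ≤ diagMax T K := by
  have hne : (ae (volume.restrict K.carrier)).NeBot := by
    rw [ae_neBot]
    intro h
    exact h0 (Measure.restrict_eq_zero.1 h)
  have hb1 : ∀ a, IsBoundedUnder (· ≤ ·) (ae (volume.restrict K.carrier)) (fun x => T x a a) :=
    fun a => ⟨hi, by
      rw [eventually_map]
      filter_upwards [h a] with x hx using hx.2⟩
  have hb2 : ∀ a, IsBoundedUnder (· ≥ ·) (ae (volume.restrict K.carrier)) (fun x => T x a a) :=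
    fun a => ⟨lo, by
      rw [eventually_map]
      filter_upwards [h a] with x hx using hx.1⟩
  have hx : ∀ᵐ x ∂volume.restrict K.carrier,
      ∀ a, diagMin T K ≤ T x a a ∧ T x a a ≤ diagMax T K := by
    rw [ae_all_iff]
    intro a
    filter_upwards [ae_le_essSup (hf := hb1 a), ae_essInf_le (hf := hb2 a)] with x h1 h2
    refine ⟨le_trans (ciInf_le (finite_range _).bddBelow a) h2, le_trans h1 ?_⟩
    exact le_ciSup (f := fun a => essSup (fun x => T x a a) (volume.restrict K.carrier))
      (finite_range _).bddAbove a
  refine ⟨?_, ?_, hx⟩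
  · refine lt_of_lt_of_le hlo (le_ciInf fun a => ?_)
    exact le_liminf_of_le (hb1 a).isCoboundedUnder_ge (by filter_upwards [h a] with x hx using hx.1)
  · obtain ⟨x, hx⟩ := hx.exists
    obtain ⟨a⟩ := ‹Nonempty ι›
    exact (hx a).1.trans (hx a).2

end

section

variable {n Gr N : ℕ} {D : MixedDomain (n + 1)} {S : CrossSections (n + 1) Gr} {T : Mesh D.Ω}
  {K : Cell (n + 1)}

lemma Cell.volume_ne_zero (K : Cell (n + 1)) : volume K.carrier ≠ 0 := fun h =>
  (isOpen_interior.measure_pos volume K.interior_nonempty).ne'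
    (measure_mono_null interior_subset h)

/-- The positivity of the diagonal of the coefficient matrices on a cell. -/
structure DiagBounds (S : CrossSections (n + 1) Gr) (N : ℕ) (K : Cell (n + 1)) : Prop where
  odd_pos : 0 < diagMin (S.To N) K
  odd_le : diagMin (S.To N) K ≤ diagMax (S.To N) K
  odd : ∀ᵐ x ∂volume.restrict K.carrier, ∀ a,
    diagMin (S.To N) K ≤ S.To N x a a ∧ S.To N x a a ≤ diagMax (S.To N) K
  even_pos : 0 < diagMin (S.Te N) K
  even_le : diagMin (S.Te N) K ≤ diagMax (S.Te N) K
  even : ∀ᵐ x ∂volume.restrict K.carrier, ∀ a,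
    diagMin (S.Te N) K ≤ S.Te N x a a ∧ S.Te N x a a ≤ diagMax (S.Te N) K

lemma CrossSections.Admissible.diagBounds (hS : S.Admissible N D.Ω) [Nonempty (Idx Gr N)]
    (hK : interior K.carrier ⊆ D.Ω) : DiagBounds S N K := by
  obtain ⟨lo, hi, hlo, -, h⟩ := hS.removal_bounds
  have key : ∀ r < 2, ∀ a, ∀ᵐ x ∂volume.restrict K.carrier,
      lo ≤ S.Tmat N r x a a ∧ S.Tmat N r x a a ≤ hi := by
    intro r hr a
    have h1 := h a.1 (2 * a.2 + r) (by have := a.2.2; omega)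
    filter_upwards [ae_restrict_cell_of_ae hK h1] with x hx
    simpa [CrossSections.Tmat] using hx
  obtain ⟨h1, h2, h3⟩ := diag_bounds (T := S.Tmat N 1) K.volume_ne_zero hlo (key 1 (by norm_num))
  obtain ⟨h4, h5, h6⟩ := diag_bounds (T := S.Tmat N 0) K.volume_ne_zero hlo (key 0 (by norm_num))
  exact ⟨h1, h2, h3, h4, h5, h6⟩

lemma Cell.IsPolyOn.exists_continuous {m : ℕ} {f : E (n + 1) → ℝ} (h : K.IsPolyOn m f) :
    ∃ Φ : E (n + 1) → ℝ, Continuous Φ ∧ ∀ᵐ x ∂volume.restrict K.carrier, f x = Φ x := by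
  obtain ⟨Φ, h1, h2⟩ := h.exists_polyFun
  exact ⟨Φ, (PolyFun.contDiff h1).continuous, h2⟩

lemma boundedCoeffs_of_isPolyOn {mo me : ℕ}
    (ho : ∀ K ∈ T.cells, ∀ a b, K.IsPolyOn mo (fun x => S.To N x a b))
    (he : ∀ K ∈ T.cells, ∀ a b, K.IsPolyOn me (fun x => S.Te N x a b)) : BoundedCoeffs D S N :=
  ⟨fun a b => T.memLp_top fun K hK => (ho K hK a b).exists_continuous,
    fun a b => T.memLp_top fun K hK => (he K hK a b).exists_continuous⟩

lemma memLp_of_inScalarSpace {k : ℕ} {f : E (n + 1) → ℝ}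
    (h : ∀ K ∈ T.cells, K.InScalarSpace k f) : MemLp f 2 (volume.restrict D.Ω) := by
  have := isFiniteMeasure_domain D
  refine (T.memLp_top fun K hK => ?_).mono_exponent le_top
  obtain ⟨Φ, h1, h2⟩ := (h K hK).exists_polyFun
  exact ⟨Φ, (PolyFun.contDiff h1).continuous, h2⟩

/-! ### Efficiency of the residual estimator -/

/-- With r the residual, the test field (0, δ_e⁻¹ r 1_K) has pairing η_r² and norm η_r. The constant
is 1, and no inverse inequality is involved. -/
lemma etaR_le (hS : BoundedCoeffs D S N) {Sf : E (n + 1) → Idx Gr N → ℝ}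
    (hSf : ∀ a, MemLp (fun x => Sf x a) 2 (volume.restrict D.Ω))
    {ζ ζh : MixedField (n + 1) (Idx Gr N)} {φt : ScalarField (n + 1) (Idx Gr N)}
    (h : IsSolution D S Sf ζ) (hζh : ζh.InX D) (hφt : φt.InV D) (hKT : K ∈ T.cells)
    (hK : DiagBounds S N K)
    (hL : localNorm D S T K (ζ - reconstruction ζh φt) ≠ ⊤) :
    etaR S Sf ζh φt K ≤ (localNorm D S T K (ζ - reconstruction ζh φt)).toReal := by
  have hKΩ := T.interior_subset K hKT
  set r : E (n + 1) → Idx Gr N → ℝ := fun x a => Sf x a -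
    (Hmat Gr N).transpose.mulVec (ζh.div x) a - (S.Te N x).mulVec (φt.val x) a with hr
  have hr2 : ∀ a, MemLp (fun x => r x a) 2 (volume.restrict D.Ω) := fun a =>
    ((hSf a).sub (memLp_const_mulVec _ hζh.memLp_div a)).sub
      (memLp_mulVec hS.even hφt.memLp_val a)
  set ξ : MixedField (n + 1) (Idx Gr N) := ⟨0, 0, 0, fun x a =>
    K.carrier.indicator (fun x => r x a / S.Te N x a a) x⟩ with hξd
  -- The positive lower bound of the diagonal makes δ_e⁻¹ a bounded multiplier on K, so the test
  -- function is square integrable.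
  have hTm : ∀ a, MemLp (K.carrier.indicator fun x => (S.Te N x a a)⁻¹) ∞
      (volume.restrict D.Ω) := fun a => by
    refine memLp_top_of_bound (((hS.even a a).aestronglyMeasurable.inv₀).indicator
      K.measurableSet_carrier) (diagMin (S.Te N) K)⁻¹ ?_
    refine ae_domain_of_cell (K := K) ?_ fun x hx => ?_
    · filter_upwards [hK.even, ae_restrict_mem K.measurableSet_carrier] with x hx hxK
      rw [indicator_of_mem hxK, Real.norm_eq_abs,
        abs_of_pos (inv_pos.2 (hK.even_pos.trans_le (hx a).1))]
      exact inv_anti₀ hK.even_pos (hx a).1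
    · rw [indicator_of_notMem hx, norm_zero]
      exact (inv_pos.2 hK.even_pos).le
  have hφ : ∀ a, MemLp (fun x => ξ.φ x a) 2 (volume.restrict D.Ω) := fun a => by
    have := MemLp.smul (r := 2) (hr2 a) (hTm a)
    refine (memLp_congr_ae (ae_of_all _ fun x => ?_)).1 this
    by_cases hx : x ∈ K.carrier
    · simp only [hξd, Pi.smul_apply', indicator_of_mem hx, smul_eq_mul]
      ring
    · simp only [hξd, Pi.smul_apply', indicator_of_notMem hx, zero_smul]
  have hξX : ξ.InX D :=
    { memLp_p := fun a => MemLp.zero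
      memLp_div := fun a => MemLp.zero
      memLp_nt := fun a => MemLp.zero
      memLp_φ := hφ
      weakDiv := fun a v _ _ => by simp [hξd]
      trace_V := fun a v _ _ => by simp [hξd]
      trace_N := fun a v _ _ => by simp [hξd] }
  have hloc : ξ.InXLocal D T K :=
    ⟨hξX, ae_of_all _ fun x hx => funext fun a => by
      simp only [hξd, indicator_of_notMem hx, Pi.zero_apply],
      ae_of_all _ fun x _ => rfl⟩
  have h1 := hloc.dForm_le hL
  rw [dForm_scalar hS hSf h hζh hφt hξX rfl rfl rfl] at h1
  set Q := ∫ x in K.carrier, ∑ a, r x a ^ 2 / S.Te N x a a with hQ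
  have h2 : ∫ x in D.Ω, (Sf x - (Hmat Gr N).transpose.mulVec (ζh.div x) -
      (S.Te N x).mulVec (φt.val x)) ⬝ᵥ ξ.φ x = Q := by
    rw [hQ, ← setIntegral_indicator_cell hKΩ]
    refine integral_congr_ae (ae_of_all _ fun x => ?_)
    by_cases hx : x ∈ K.carrier
    · simp only [dotProduct, hξd, indicator_of_mem hx, hr, Pi.sub_apply]
      exact Finset.sum_congr rfl fun a _ => by ring
    · simp only [dotProduct, hξd, indicator_of_notMem hx, mul_zero, Finset.sum_const_zero]
  have h3 : normS D S T ξ = Real.sqrt Q := by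
    have e1 : ∫ x in D.Ω, ∑ a, S.Te N x a a * ξ.φ x a ^ 2 = Q := by
      rw [hQ, ← setIntegral_indicator_cell hKΩ]
      refine integral_congr_ae (ae_domain_of_cell (K := K) ?_ fun x hx => ?_)
      · filter_upwards [hK.even, ae_restrict_mem K.measurableSet_carrier] with x hx hxK
        simp only [hξd, indicator_of_mem hxK]
        refine Finset.sum_congr rfl fun a _ => ?_
        have := (hK.even_pos.trans_le (hx a).1).ne'
        field_simp
      · simp only [hξd, indicator_of_notMem hx]
        simp
    rw [normS, e1]
    simp [hξd]
  have h4 : etaR S Sf ζh φt K = Real.sqrt Q := rfl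
  have hQ0 : 0 ≤ Q := by
    refine integral_nonneg_of_ae ?_
    filter_upwards [hK.even] with x hx
    exact Finset.sum_nonneg fun a _ => div_nonneg (sq_nonneg _) (hK.even_pos.le.trans (hx a).1)
  rw [h2, h3] at h1
  rw [h4]
  -- The inequality Q ≤ √Q · l is divided by √Q, unless that is zero.
  rcases (Real.sqrt_nonneg Q).eq_or_lt with h5 | h5
  · rw [← h5]
    exact ENNReal.toReal_nonneg
  · nlinarith [Real.mul_self_sqrt hQ0]

end

/-! ### Localised polynomial fluxes -/

section

variable {n : ℕ}

/-- A smooth cutoff function of the ball of center `x₀` and radius `R`. -/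
structure IsCutoff {m : ℕ} (b : E m → ℝ) (x₀ : E m) (R M : ℝ) : Prop where
  contDiff : ContDiff ℝ ∞ b
  nonneg : ∀ x, 0 ≤ b x
  le_one : ∀ x, b x ≤ 1
  eq_one : ∀ x ∈ Metric.ball x₀ (R / 2), b x = 1
  tsupport_subset : tsupport b ⊆ Metric.closedBall x₀ R
  norm_fderiv_le : ∀ x, ‖fderiv ℝ b x‖ ≤ M / R

/-- All cutoffs are translated dilations of one bump function, whence a gradient constant M common
to all balls. -/
lemma exists_isCutoff (m : ℕ) : ∃ M : ℝ, 0 < M ∧ ∀ (x₀ : E m) (R : ℝ), 0 < R →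
    ∃ b : E m → ℝ, IsCutoff b x₀ R M := by
  let b₀ : ContDiffBump (0 : E m) := ⟨1 / 2, 1, by norm_num, by norm_num⟩
  have hb₀ : ContDiff ℝ ∞ b₀ := b₀.contDiff
  obtain ⟨M, hM⟩ := (hb₀.continuous_fderiv (by simp)).bounded_above_of_compact_support
    (b₀.hasCompactSupport.fderiv ℝ)
  refine ⟨|M| + 1, by positivity, fun x₀ R hR => ?_⟩
  have hd : ∀ x, HasFDerivAt (fun x => b₀ (R⁻¹ • (x - x₀)))
      ((fderiv ℝ b₀ (R⁻¹ • (x - x₀))).comp (R⁻¹ • ContinuousLinearMap.id ℝ (E m))) x := fun x =>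
    ((hb₀.differentiable (by simp)) _).hasFDerivAt.comp x
      (((hasFDerivAt_id x).sub_const x₀).const_smul R⁻¹)
  have hnorm : ∀ x, ‖R⁻¹ • (x - x₀)‖ = R⁻¹ * dist x x₀ := fun x => by
    rw [norm_smul, norm_inv, Real.norm_of_nonneg hR.le, dist_eq_norm]
  refine ⟨fun x => b₀ (R⁻¹ • (x - x₀)), ⟨by fun_prop, fun x => b₀.nonneg, fun x => b₀.le_one,
    fun x hx => b₀.one_of_mem_closedBall ?_, closure_minimal (fun x hx => ?_)
    Metric.isClosed_closedBall, fun x => ?_⟩⟩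
  · rw [mem_closedBall_zero_iff, hnorm, inv_mul_le_iff₀ hR]
    have := Metric.mem_ball.1 hx
    change dist x x₀ ≤ R * (1 / 2)
    linarith
  · by_contra h
    refine hx (b₀.zero_of_le_dist ?_)
    rw [dist_zero_right, hnorm, le_inv_mul_iff₀ hR]
    change R * 1 ≤ _
    rw [Metric.mem_closedBall, not_le] at h
    linarith
  · rw [(hd x).fderiv]
    refine (ContinuousLinearMap.opNorm_comp_le _ _).trans ?_
    rw [norm_smul, norm_inv, Real.norm_of_nonneg hR.le, div_eq_mul_inv]
    refine mul_le_mul ((hM _).trans ((le_abs_self M).trans (by linarith))) ?_ (by positivity)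
      (by positivity)
    exact mul_le_of_le_one_right (by positivity) ContinuousLinearMap.norm_id_le

/-- The opposite of the flux with components `R`, cut off by the function `b`. -/
def cutFlux (b : E (n + 1) → ℝ) (R : Fin (n + 1) → E (n + 1) → ℝ) (i : Fin (n + 1))
    (x : E (n + 1)) : ℝ := -(b x * R i x)

variable {b : E (n + 1) → ℝ} {x₀ : E (n + 1)} {σ h M A : ℝ} {R : Fin (n + 1) → E (n + 1) → ℝ}

lemma fluxVec_cutFlux (x : E (n + 1)) : fluxVec (cutFlux b R) x = -(b x • fluxVec R x) := by
  ext i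
  simp [fluxVec, cutFlux]

lemma norm_fluxVec_sq (f : Fin (n + 1) → E (n + 1) → ℝ) (x : E (n + 1)) :
    ‖fluxVec f x‖ ^ 2 = ∑ i, f i x ^ 2 := by
  rw [EuclideanSpace.norm_sq_eq]
  simp [fluxVec]

lemma IsCutoff.norm_fluxVec_le (hb : IsCutoff b x₀ (σ * h) M) {x : E (n + 1)}
    (hR : ∀ i, R i x ^ 2 ≤ A) : ‖fluxVec (cutFlux b R) x‖ ^ 2 ≤ (n + 1) * A := by
  rw [norm_fluxVec_sq]
  calc ∑ i, cutFlux b R i x ^ 2 ≤ ∑ _i : Fin (n + 1), A := by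
        refine Finset.sum_le_sum fun i _ => le_trans ?_ (hR i)
        have h1 : b x ^ 2 ≤ 1 := pow_le_one₀ (hb.nonneg x) (hb.le_one x)
        rw [cutFlux, neg_sq, mul_pow]
        exact mul_le_of_le_one_left (sq_nonneg _) h1
    _ = _ := by simp

/-- Differentiating the cutoff costs M/(σh), which the weight h² compensates. The factor 2 comes
from (x+y)² ≤ 2x² + 2y² in the product rule, and (n+1)² from Cauchy-Schwarz over the n+1 partial
derivatives followed by their summation. -/
lemma IsCutoff.fluxDiv_le (hb : IsCutoff b x₀ (σ * h) M) (hσ : 0 < σ) (hh : 0 < h)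
    (hRc : ∀ i, ContDiff ℝ ∞ (R i)) {x : E (n + 1)}
    (hR : ∀ i, R i x ^ 2 ≤ A) (hR' : ∀ i, h ^ 2 * ‖fderiv ℝ (R i) x‖ ^ 2 ≤ A) :
    h ^ 2 * fluxDiv (cutFlux b R) x ^ 2 ≤ 2 * (n + 1) ^ 2 * (1 + (M / σ) ^ 2) * A := by
  have hterm : ∀ i, h ^ 2 * (fderiv ℝ (cutFlux b R i) x (EuclideanSpace.single i 1)) ^ 2 ≤
      2 * (1 + (M / σ) ^ 2) * A := fun i => by
    have hd : HasFDerivAt (cutFlux b R i) (-(b x • fderiv ℝ (R i) x + R i x • fderiv ℝ b x)) x :=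
      (((hb.contDiff.differentiable (by simp)) x).hasFDerivAt.mul
        (((hRc i).differentiable (by simp)) x).hasFDerivAt).neg
    rw [hd.fderiv]
    set e : E (n + 1) := EuclideanSpace.single i 1
    have he : ‖e‖ = 1 := by simp [e]
    have h1 : |fderiv ℝ (R i) x e| ≤ ‖fderiv ℝ (R i) x‖ := by
      simpa [he] using (fderiv ℝ (R i) x).le_opNorm e
    have h2 : |fderiv ℝ b x e| ≤ M / (σ * h) := by
      have := (fderiv ℝ b x).le_opNorm e
      rw [he, mul_one] at this
      exact this.trans (hb.norm_fderiv_le x)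
    have h3 : h ^ 2 * (b x * fderiv ℝ (R i) x e) ^ 2 ≤ A := by
      refine le_trans ?_ (hR' i)
      refine mul_le_mul_of_nonneg_left ?_ (sq_nonneg h)
      rw [mul_pow, ← sq_abs (fderiv ℝ (R i) x e)]
      calc b x ^ 2 * |fderiv ℝ (R i) x e| ^ 2 ≤ 1 * ‖fderiv ℝ (R i) x‖ ^ 2 := by
            gcongr
            exact pow_le_one₀ (hb.nonneg x) (hb.le_one x)
        _ = _ := one_mul _
    have h4 : h ^ 2 * (R i x * fderiv ℝ b x e) ^ 2 ≤ (M / σ) ^ 2 * A := by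
      rw [mul_pow, ← sq_abs (fderiv ℝ b x e)]
      calc h ^ 2 * (R i x ^ 2 * |fderiv ℝ b x e| ^ 2) ≤ h ^ 2 * (A * (M / (σ * h)) ^ 2) := by
            gcongr
            · exact (sq_nonneg _).trans (hR i)
            · exact hR i
        _ = _ := by field_simp
    have h5 : (-(b x • fderiv ℝ (R i) x + R i x • fderiv ℝ b x)) e =
        -(b x * fderiv ℝ (R i) x e + R i x * fderiv ℝ b x e) := by simp
    rw [h5]
    nlinarith [sq_nonneg (h * (b x * fderiv ℝ (R i) x e - R i x * fderiv ℝ b x e))]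
  rw [fluxDiv]
  calc h ^ 2 * (∑ i, fderiv ℝ (cutFlux b R i) x (EuclideanSpace.single i 1)) ^ 2
      ≤ h ^ 2 * ((n + 1) *
        ∑ i, (fderiv ℝ (cutFlux b R i) x (EuclideanSpace.single i 1)) ^ 2) := by
        gcongr
        have := sq_sum_le_card_mul_sum_sq (s := Finset.univ)
          (f := fun i => fderiv ℝ (cutFlux b R i) x (EuclideanSpace.single i 1))
        simpa using this
    _ = (n + 1) * ∑ i, h ^ 2 * (fderiv ℝ (cutFlux b R i) x (EuclideanSpace.single i 1)) ^ 2 := by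
        rw [Finset.mul_sum, Finset.mul_sum, Finset.mul_sum]
        exact Finset.sum_congr rfl fun i _ => by ring
    _ ≤ (n + 1) * ∑ _i : Fin (n + 1), 2 * (1 + (M / σ) ^ 2) * A := by
        exact mul_le_mul_of_nonneg_left (Finset.sum_le_sum fun i _ => hterm i) (by positivity)
    _ = _ := by
        simp only [Finset.sum_const, Finset.card_univ, Fintype.card_fin, nsmul_eq_mul]
        push_cast
        ring

/-- The volume of the unit ball. -/
def unitBallVolume (m : ℕ) : ℝ := volume.real (Metric.ball (0 : E m) 1)

lemma unitBallVolume_pos (m : ℕ) : 0 < unitBallVolume m :=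
  ENNReal.toReal_pos (Metric.measure_ball_pos volume _ one_pos).ne' measure_ball_lt_top.ne

lemma volume_closedBall (m : ℕ) (x : E m) {r : ℝ} (hr : 0 ≤ r) :
    volume.real (Metric.closedBall x r) = unitBallVolume m * r ^ m := by
  rw [measureReal_def, Measure.addHaar_closedBall _ _ hr, ENNReal.toReal_mul,
    ENNReal.toReal_ofReal (by positivity), finrank_euclideanSpace_fin, mul_comm]
  rfl

lemma Cell.volume_le (K : Cell (n + 1)) :
    volume.real K.carrier ≤ unitBallVolume (n + 1) * K.diam ^ (n + 1) := by
  obtain ⟨x, hx⟩ := K.interior_nonempty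
  rw [← volume_closedBall _ x K.diam_pos.le]
  refine measureReal_mono (fun y hy => ?_) (measure_closedBall_lt_top).ne
  exact K.dist_le_diam hy (interior_subset hx)

lemma setIntegral_le_of_le {X : Type*} [MeasurableSpace X] {μ : Measure X} {s : Set X}
    (hμ : μ s ≠ ⊤) {g : X → ℝ} {c : ℝ} (h0 : ∀ᵐ x ∂μ.restrict s, 0 ≤ g x)
    (h : ∀ᵐ x ∂μ.restrict s, g x ≤ c) : ∫ x in s, g x ∂μ ≤ μ.real s * c := by
  have : IsFiniteMeasure (μ.restrict s) := isFiniteMeasure_restrict.2 hμ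
  calc ∫ x in s, g x ∂μ ≤ ∫ _x in s, c ∂μ := integral_mono_of_nonneg h0 (integrable_const c) h
    _ = _ := by rw [setIntegral_const, smul_eq_mul]

variable {Gr N : ℕ} {D : MixedDomain (n + 1)} {S : CrossSections (n + 1) Gr} {T : Mesh D.Ω}
  {K : Cell (n + 1)} {F : Set (E (n + 1))} {Fr : Frame n}

/-- The boundary part of the norm `‖·‖_S`. -/
def robinNormSq (T : Mesh D.Ω) (S : CrossSections (n + 1) Gr)
    (g : E (n + 1) → Idx Gr N → ℝ) : ℝ :=
  ∑ K ∈ T.cells, ∑ F ∈ robinFacets D K, diagMax (S.To N) K * K.altitude F *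
    ∫ x in F, (GammaT Gr N).mulVec (g x) ⬝ᵥ g x ∂surf (n + 1)

/-- The constant in the bound of the norm of localised fluxes. -/
def fluxConst (n : ℕ) (σ M : ℝ) : ℝ :=
  unitBallVolume (n + 1) * ((n + 1) + 2 * (n + 1) ^ 2 * (1 + (M / σ) ^ 2))

lemma fluxConst_pos (n : ℕ) (σ M : ℝ) : 0 < fluxConst n σ M :=
  mul_pos (unitBallVolume_pos _) (by positivity)

lemma Mesh.volume_inter (T : Mesh D.Ω) {K' : Cell (n + 1)} (hK : K ∈ T.cells) (hK' : K' ∈ T.cells)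
    (hne : K ≠ K') : volume (K'.carrier ∩ K.carrier) = 0 := by
  have h : K'.carrier ∩ K.carrier ⊆ frontier K'.carrier ∪ frontier K.carrier := by
    intro x hx
    by_contra hc
    have h1 : x ∈ interior K'.carrier := by
      by_contra h
      exact hc (Or.inl ⟨subset_closure hx.1, h⟩)
    have h2 : x ∈ interior K.carrier := by
      by_contra h
      exact hc (Or.inr ⟨subset_closure hx.2, h⟩)
    exact disjoint_left.1 (T.disjoint K hK K' hK' hne) h2 h1
  exact measure_mono_null h (measure_union_null K'.volume_frontier K.volume_frontier)

/-- The strengthened norm of a localised flux. -/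
lemma normS_testField_le (hKT : K ∈ T.cells) (hK : DiagBounds S N K)
    {R : Idx Gr N → Fin (n + 1) → E (n + 1) → ℝ} {A : Idx Gr N → ℝ}
    (hb : IsCutoff b x₀ (σ * K.diam) M) (hσ : 0 < σ) (hRc : ∀ a i, ContDiff ℝ ∞ (R a i))
    (hR : ∀ a i, ∀ x ∈ K.carrier, R a i x ^ 2 ≤ A a)
    (hR' : ∀ a i, ∀ x ∈ K.carrier, K.diam ^ 2 * ‖fderiv ℝ (R a i) x‖ ^ 2 ≤ A a) :
    normS D S T (testField K F Fr fun a => cutFlux b (R a)) ≤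
      Real.sqrt (diagMax (S.To N) K * (fluxConst n σ M * K.diam ^ (n + 1) * ∑ a, A a) +
        robinNormSq T S (testField K F Fr fun a => cutFlux b (R a)).nt) := by
  set f : Idx Gr N → Fin (n + 1) → E (n + 1) → ℝ := fun a => cutFlux b (R a) with hf
  set m := diagMax (S.To N) K
  have hm : 0 ≤ m := hK.odd_pos.le.trans hK.odd_le
  have hKΩ := T.interior_subset K hKT
  have hKm := K.measurableSet_carrier
  have hKf : volume K.carrier ≠ ⊤ := K.isCompact_carrier.measure_lt_top.ne
  obtain ⟨y, hy⟩ := K.interior_nonempty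
  have hA : 0 ≤ ∑ a, A a := Finset.sum_nonneg fun a _ =>
    (sq_nonneg _).trans (hR a 0 y (interior_subset hy))
  have e1 : ∫ x in D.Ω, ∑ a, S.To N x a a * ‖(testField K F Fr f).p x a‖ ^ 2 ≤
      volume.real K.carrier * (m * ((n + 1) * ∑ a, A a)) := by
    calc ∫ x in D.Ω, ∑ a, S.To N x a a * ‖(testField K F Fr f).p x a‖ ^ 2
        = ∫ x in K.carrier, ∑ a, S.To N x a a * ‖fluxVec (f a) x‖ ^ 2 := by
          rw [← setIntegral_indicator_cell hKΩ]
          refine integral_congr_ae (ae_of_all _ fun x => ?_)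
          by_cases hx : x ∈ K.carrier
          · simp only [testField, indicator_of_mem hx]
          · simp [testField, indicator_of_notMem hx]
      _ ≤ _ := by
          refine setIntegral_le_of_le hKf ?_ ?_
          · filter_upwards [hK.odd] with x hx
            exact Finset.sum_nonneg fun a _ =>
              mul_nonneg (hK.odd_pos.le.trans (hx a).1) (sq_nonneg _)
          · filter_upwards [hK.odd, ae_restrict_mem hKm] with x hx hxK
            rw [Finset.mul_sum, Finset.mul_sum]
            refine Finset.sum_le_sum fun a _ => ?_
            exact mul_le_mul (hx a).2 (hb.norm_fluxVec_le fun i => hR a i x hxK) (sq_nonneg _) hm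
  have e2 : ∫ x in D.Ω, ∑ a, S.Te N x a a * (testField K F Fr f).φ x a ^ 2 = 0 := by
    simp [testField]
  -- Distinct cells overlap in a null set, so only the weight of K itself enters and coefficients of
  -- neighbouring cells are never compared.
  have e3 : ∀ K' ∈ T.cells, K' ≠ K →
      ∫ x in K'.carrier, ∑ a, (testField K F Fr f).div x a ^ 2 = 0 := by
    intro K' hK' hne
    refine integral_eq_zero_of_ae ?_
    rw [EventuallyEq, ae_restrict_iff' K'.measurableSet_carrier]
    have := T.volume_inter hKT hK' hne.symm
    filter_upwards [compl_mem_ae_iff.2 this] with x hx hxK'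
    have hxK : x ∉ K.carrier := fun h => hx ⟨hxK', h⟩
    simp [testField, indicator_of_notMem hxK]
  have e4 : ∑ K' ∈ T.cells, diagMax (S.To N) K' * K'.diam ^ 2 *
      ∫ x in K'.carrier, ∑ a, (testField K F Fr f).div x a ^ 2 ≤
      volume.real K.carrier * (m * (2 * (n + 1) ^ 2 * (1 + (M / σ) ^ 2) * ∑ a, A a)) := by
    rw [Finset.sum_eq_single_of_mem K hKT fun K' hK' hne => by rw [e3 K' hK' hne, mul_zero],
      mul_assoc, ← integral_const_mul, ← integral_const_mul]
    refine setIntegral_le_of_le hKf ?_ ?_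
    · exact ae_of_all _ fun x => mul_nonneg hm
        (mul_nonneg (sq_nonneg _) (Finset.sum_nonneg fun a _ => sq_nonneg _))
    · filter_upwards [ae_restrict_mem hKm] with x hxK
      refine mul_le_mul_of_nonneg_left ?_ hm
      rw [Finset.mul_sum, Finset.mul_sum]
      refine Finset.sum_le_sum fun a _ => ?_
      simp only [testField, indicator_of_mem hxK]
      exact hb.fluxDiv_le hσ K.diam_pos (hRc a) (fun i => hR a i x hxK) fun i => hR' a i x hxK
  rw [normS, e2, add_zero]
  refine Real.sqrt_le_sqrt (add_le_add ((add_le_add e1 e4).trans ?_) le_rfl)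
  rw [← mul_add, ← mul_add, ← add_mul, ← mul_assoc, mul_comm (volume.real _), mul_assoc]
  refine mul_le_mul_of_nonneg_left ?_ hm
  rw [← mul_assoc]
  refine mul_le_mul_of_nonneg_right ?_ hA
  rw [fluxConst, mul_right_comm (unitBallVolume _)]
  exact mul_le_mul_of_nonneg_right K.volume_le (by positivity)

end

/-! ### Efficiency of the flux estimator -/

section

variable {n Gr N : ℕ} {D : MixedDomain (n + 1)} {S : CrossSections (n + 1) Gr} {T : Mesh D.Ω}
  {K : Cell (n + 1)} {ζ ζh : MixedField (n + 1) (Idx Gr N)} {φt : ScalarField (n + 1) (Idx Gr N)}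

/-- The residual `𝕋_o p_h + ℍ grad φ̃_h`. -/
def fluxResidual (S : CrossSections (n + 1) Gr) (ζh : MixedField (n + 1) (Idx Gr N))
    (φt : ScalarField (n + 1) (Idx Gr N)) (x : E (n + 1)) (a : Idx Gr N) : E (n + 1) :=
  (∑ b, S.To N x a b • ζh.p x b) + ∑ b, Hmat Gr N a b • φt.grad x b

/-- The weak gradient agrees on K with the gradient of the polynomial that represents φ̃_h, so the
whole residual is polynomial; the degree is a crude common bound for its two terms. -/
lemma exists_polyFun_fluxResidual {k mo mφ : ℕ} (hK : interior K.carrier ⊆ D.Ω)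
    (ho : ∀ a b, K.IsPolyOn mo (fun x => S.To N x a b))
    (hp : ∀ a, K.InRTN k (fun x => ζh.p x a)) (hφt : φt.InV D)
    (hφ : ∀ a, K.IsPolyOn mφ (fun x => φt.val x a)) :
    ∃ R : Idx Gr N → Fin (n + 1) → E (n + 1) → ℝ,
      (∀ a i, R a i ∈ PolyFun (n + 1) (mo + (n + 1) * (k + 1) + mφ)) ∧
      ∀ᵐ x ∂volume.restrict K.carrier, ∀ a, fluxResidual S ζh φt x a = fluxVec (R a) x := by
  choose τ hτ hτe using fun a b => (ho a b).exists_polyFun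
  choose P hP hPe using fun a => (hp a).exists_polyFun
  choose Φ hΦ hΦe using fun a => (hφ a).exists_polyFun
  have hg : ∀ a, ∀ᵐ x ∂volume.restrict K.carrier, ∀ i,
      φt.grad x a i = fderiv ℝ (Φ a) x (EuclideanSpace.single i 1) := fun a =>
    (hφt.weakGrad a).ae_eq hK (hφt.memLp_grad a) (PolyFun.contDiff (hΦ a)) (hΦe a)
  refine ⟨fun a i x => (∑ b, τ a b x * P b i x) +
    ∑ b, Hmat Gr N a b * fderiv ℝ (Φ b) x (EuclideanSpace.single i 1), fun a i => ?_, ?_⟩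
  · refine PolyFun.add (PolyFun.sum fun b _ => ?_) (PolyFun.sum fun b _ => ?_)
    · exact PolyFun.mono (by omega) (PolyFun.mul (hτ a b) (hP b i))
    · exact PolyFun.const_mul _ (PolyFun.mono (by omega) (PolyFun.fderiv_apply (hΦ b) _))
  · filter_upwards [ae_all_iff.2 fun a => ae_all_iff.2 (hτe a), ae_all_iff.2 hPe,
      ae_all_iff.2 hg] with x h1 h2 h3 a
    ext i
    simp [fluxResidual, fluxVec, h1, h2, h3]

/-- The test flux is built from the residual, so its norm is of the order of √B; squaring and
dividing by B closes the estimate. -/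
lemma le_of_le_sqrt_mul {B c l : ℝ} (hB : 0 ≤ B) (hc : 0 ≤ c) (h : B ≤ Real.sqrt (c * B) * l) :
    B ≤ c * l ^ 2 := by
  rcases hB.eq_or_lt with h0 | h0
  · rw [← h0]
    positivity
  · have h1 : B ^ 2 ≤ c * B * l ^ 2 := by
      calc B ^ 2 ≤ (Real.sqrt (c * B) * l) ^ 2 := pow_le_pow_left₀ hB h 2
        _ = _ := by rw [mul_pow, Real.sq_sqrt (mul_nonneg hc hB)]
    nlinarith

lemma sq_le_sum_sq {ι : Type*} [Fintype ι] (f : ι → ℝ) (i : ι) : f i ^ 2 ≤ ∑ j, f j ^ 2 :=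
  Finset.single_le_sum (f := fun j => f j ^ 2) (fun _ _ => sq_nonneg _) (Finset.mem_univ i)

/-- A frame whose half space contains a given ball in its interior. -/
lemma exists_far_frame (x₀ : E (n + 1)) {r : ℝ} (hr : 0 < r) :
    ∃ Fr : Frame n, ∀ x ∈ Metric.closedBall x₀ r, x ∈ Fr.half ∧ x ∉ Fr.plane := by
  set ν : E (n + 1) := EuclideanSpace.single 0 1
  have hν : ‖ν‖ = 1 := by simp [ν]
  obtain ⟨Fr, hz, hFν⟩ := exists_frame (x₀ - (2 * r) • ν) ν hν
  refine ⟨Fr, fun x hx => ?_⟩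
  have h1 : 0 < Fr.height x := by
    have h2 := (abs_le.1 (abs_real_inner_le_norm ν (x - x₀))).1
    rw [hν, one_mul, ← dist_eq_norm] at h2
    have h3 := Metric.mem_closedBall.1 hx
    rw [Frame.height, hz, hFν, show x - (x₀ - (2 * r) • ν) = (x - x₀) + (2 * r) • ν by abel,
      inner_add_right, real_inner_smul_right, real_inner_self_eq_norm_sq, hν]
    linarith
  exact ⟨h1.le, h1.ne'⟩

lemma tsupport_cutFlux_subset {b : E (n + 1) → ℝ} {R : Fin (n + 1) → E (n + 1) → ℝ}
    {i : Fin (n + 1)} : tsupport (cutFlux b R i) ⊆ tsupport b := by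
  refine closure_mono (Function.support_subset_iff.2 fun x hx h0 => hx ?_)
  rw [cutFlux, h0, zero_mul, neg_zero]

lemma robinNormSq_eq_zero {g : E (n + 1) → Idx Gr N → ℝ} (hg : ∀ x, g x = 0) :
    robinNormSq T S g = 0 := by
  simp [robinNormSq, hg]

lemma setIntegral_ball_sum {m : ℕ} {ι : Type*} [Fintype ι] {g : ι → E m → ℝ}
    (hg : ∀ i, Continuous (g i)) (x₀ : E m) (r : ℝ) :
    ∫ x in Metric.ball x₀ r, ∑ i, g i x = ∑ i, ∫ x in Metric.ball x₀ r, g i x :=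
  integral_finsetSum _ fun i _ => ((hg i).continuousOn.integrableOn_compact
    (isCompact_closedBall x₀ r)).mono_set Metric.ball_subset_closedBall

/-- The `L^2` norm of the flux residual is bounded by the local norm. -/
theorem exists_fluxResidual_bound (n mo k mφ : ℕ) {κ : ℝ} (hκ : 0 < κ) : ∃ C : ℝ, 0 < C ∧
    ∀ {Gr N : ℕ} {D : MixedDomain (n + 1)} {S : CrossSections (n + 1) Gr} {T : Mesh D.Ω}
      {K : Cell (n + 1)} {Sf : E (n + 1) → Idx Gr N → ℝ} {ζ ζh : MixedField (n + 1) (Idx Gr N)}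
      {φt : ScalarField (n + 1) (Idx Gr N)}, BoundedCoeffs D S N → IsSolution D S Sf ζ →
      ζh.InX D → φt.InV D → K ∈ T.cells → DiagBounds S N K → κ ≤ K.shapeRegularity →
      (∀ a b, K.IsPolyOn mo (fun x => S.To N x a b)) →
      (∀ a, K.InRTN k (fun x => ζh.p x a)) →
      (∀ a, K.IsPolyOn mφ (fun x => φt.val x a)) →
      localNorm D S T K (ζ - reconstruction ζh φt) ≠ ⊤ →
      ∫ x in K.carrier, ∑ a, ‖fluxResidual S ζh φt x a‖ ^ 2 ≤
        C * diagMax (S.To N) K * (localNorm D S T K (ζ - reconstruction ζh φt)).toReal ^ 2 := by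
  -- Half the inner ratio, so that the closed ball carrying the cutoff lies inside the inscribed
  -- open ball. The cutoff equals 1 on the ball of radius σ/2 · h, which is the one used in the
  -- polynomial bound.
  set σ := innerRatio n κ / 2 with hσd
  have hρ : 0 < innerRatio n κ := innerRatio_pos hκ
  have hσ : 0 < σ := by positivity
  obtain ⟨M, -, hcut⟩ := exists_isCutoff (n + 1)
  obtain ⟨Cp, hCp, Hp⟩ := PolyFun.exists_bound (n + 1) (mo + (n + 1) * (k + 1) + mφ) (half_pos hσ)
  set v := unitBallVolume (n + 1)
  have hv : 0 < v := unitBallVolume_pos _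
  have hfc := fluxConst_pos n σ M
  -- The first factor Cp extends the bound on the residual from the small ball to K; the second
  -- comes from the norm of the test flux.
  refine ⟨v * (n + 1) * Cp * (fluxConst n σ M * Cp), by positivity, ?_⟩
  intro Gr N D S T K Sf ζ ζh φt hS hζ hζh hφt hKT hK hκK ho hp hφ hL
  have hKΩ := T.interior_subset K hKT
  have hh := K.diam_pos
  set h := K.diam
  set l := (localNorm D S T K (ζ - reconstruction ζh φt)).toReal
  set m := diagMax (S.To N) K with hmd
  have hm : 0 ≤ m := hK.odd_pos.le.trans hK.odd_le
  obtain ⟨R, hR, hRe⟩ := exists_polyFun_fluxResidual hKΩ ho hp hφt hφ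
  have hRc : ∀ a i, ContDiff ℝ ∞ (R a i) := fun a i => PolyFun.contDiff (hR a i)
  obtain ⟨x₀, hx₀, hball⟩ := K.exists_inner_ball hκK
  obtain ⟨b, hb⟩ := hcut x₀ (σ * h) (by positivity)
  have hball' : Metric.closedBall x₀ (σ * h) ⊆ K.carrier :=
    (Metric.closedBall_subset_ball (by
      rw [hσd]; exact mul_lt_mul_of_pos_right (half_lt_self hρ) hh)).trans hball
  -- An interior flux is treated as a boundary flux on the empty facet: the hyperplane is chosen
  -- away from the ball, so the facet conditions hold trivially.
  obtain ⟨Fr, hFr⟩ := exists_far_frame x₀ (r := σ * h) (by positivity)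
  have G : FluxGeometry D K ∅ Fr := ⟨hKΩ, empty_subset _, empty_subset _, isCompact_empty⟩
  have hsupp : ∀ a i, tsupport (cutFlux b (R a) i) ⊆ Metric.closedBall x₀ (σ * h) := fun a i =>
    tsupport_cutFlux_subset.trans hb.tsupport_subset
  have hf : ∀ a, IsTestFlux K ∅ Fr (cutFlux b (R a)) := fun a =>
    { contDiff := fun i => (hb.contDiff.mul (hRc a i)).neg
      compact := fun i => (isCompact_closedBall x₀ (σ * h)).of_isClosed_subset
        (isClosed_tsupport _) (hsupp a i)
      half := fun i x hx => ⟨fun _ => (hFr x (hsupp a i hx)).1, fun _ => hball' (hsupp a i hx)⟩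
      facet := fun i x hx hxp => absurd hxp (hFr x (hsupp a i hx)).2 }
  set B₀ : Idx Gr N → ℝ := fun a => ∫ x in Metric.ball x₀ (σ / 2 * h), ∑ i, R a i x ^ 2 with hB₀
  set B := ∑ a, B₀ a with hB
  set A : Idx Gr N → ℝ := fun a => Cp / h ^ (n + 1) * B₀ a with hA
  have hB₀0 : ∀ a, 0 ≤ B₀ a := fun a => integral_nonneg fun x =>
    Finset.sum_nonneg fun i _ => sq_nonneg _
  have hB0 : 0 ≤ B := Finset.sum_nonneg fun a _ => hB₀0 a
  have hsumA : ∑ a, A a = Cp / h ^ (n + 1) * B := by rw [hB, Finset.mul_sum]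
  have hcont : ∀ a i, Continuous fun x => R a i x ^ 2 := fun a i => (hRc a i).continuous.pow 2
  have hle : ∀ a i, Cp / h ^ (n + 1) * ∫ x in Metric.ball x₀ (σ / 2 * h), R a i x ^ 2 ≤ A a := by
    intro a i
    refine mul_le_mul_of_nonneg_left ?_ (by positivity)
    rw [hB₀]
    dsimp only
    rw [setIntegral_ball_sum (hcont a)]
    exact Finset.single_le_sum (f := fun i => ∫ x in Metric.ball x₀ (σ / 2 * h), R a i x ^ 2)
      (fun i _ => integral_nonneg fun x => sq_nonneg _) (Finset.mem_univ i)
  have hRA : ∀ a i, ∀ x ∈ K.carrier, R a i x ^ 2 ≤ A a := fun a i x hx =>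
    (Hp _ (hR a i) x₀ h hh x (K.dist_le_diam hx hx₀)).1.trans (hle a i)
  have hRA' : ∀ a i, ∀ x ∈ K.carrier, h ^ 2 * ‖fderiv ℝ (R a i) x‖ ^ 2 ≤ A a := fun a i x hx =>
    (Hp _ (hR a i) x₀ h hh x (K.dist_le_diam hx hx₀)).2.trans (hle a i)
  have hn := normS_testField_le (F := ∅) (Fr := Fr) hKT hK hb hσ hRc hRA hRA'
  have hnt : robinNormSq T S (testField K ∅ Fr fun a => cutFlux b (R a)).nt = 0 :=
    robinNormSq_eq_zero fun x => funext fun a => indicator_of_notMem (notMem_empty x) _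
  rw [hnt, add_zero, hsumA, show fluxConst n σ M * K.diam ^ (n + 1) * (Cp / h ^ (n + 1) * B) =
      fluxConst n σ M * Cp * B by field_simp; rfl] at hn
  have hd := (testField_inXLocal G hKT (hκ.trans_le hκK) hf).dForm_le hL
  rw [dForm_flux hS hζ hζh hφt G hf, Measure.restrict_empty, integral_zero_measure, add_zero] at hd
  -- The sign built into `cutFlux` turns the pairing into ∫ b|R|², and b = 1 on the small ball.
  have hlow : B ≤ -∫ x in K.carrier, ∑ a, inner ℝ ((∑ b, S.To N x a b • ζh.p x b) +
      ∑ b, Hmat Gr N a b • φt.grad x b) (fluxVec (cutFlux b (R a)) x) := by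
    have e1 : -∫ x in K.carrier, ∑ a, inner ℝ ((∑ b, S.To N x a b • ζh.p x b) +
        ∑ b, Hmat Gr N a b • φt.grad x b) (fluxVec (cutFlux b (R a)) x) =
        ∫ x in K.carrier, b x * ∑ a, ∑ i, R a i x ^ 2 := by
      rw [← integral_neg]
      refine integral_congr_ae ?_
      filter_upwards [hRe] with x hx
      simp only [fluxResidual] at hx
      simp only [hx, fluxVec_cutFlux, inner_neg_right, real_inner_smul_right,
        real_inner_self_eq_norm_sq, norm_fluxVec_sq, Finset.sum_neg_distrib, neg_neg,
        Finset.mul_sum]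
    have e2 : B = ∫ x in Metric.ball x₀ (σ / 2 * h), b x * ∑ a, ∑ i, R a i x ^ 2 := by
      rw [hB, hB₀, ← setIntegral_ball_sum fun a => continuous_finsetSum _ fun i _ => hcont a i]
      refine setIntegral_congr_fun measurableSet_ball fun x hx => ?_
      rw [hb.eq_one x (by rwa [mul_div_right_comm]), one_mul]
    rw [e1, e2]
    refine setIntegral_mono_set ?_ ?_ (LE.le.eventuallyLE ?_)
    · refine ContinuousOn.integrableOn_compact K.isCompact_carrier (Continuous.continuousOn ?_)
      exact hb.contDiff.continuous.mul
        (continuous_finsetSum _ fun a _ => continuous_finsetSum _ fun i _ => hcont a i)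
    · exact ae_of_all _ fun x => mul_nonneg (hb.nonneg x)
        (Finset.sum_nonneg fun a _ => Finset.sum_nonneg fun i _ => sq_nonneg _)
    · refine (Metric.ball_subset_closedBall.trans (Metric.closedBall_subset_closedBall ?_)).trans
        hball'
      exact mul_le_mul_of_nonneg_right (half_le_self hσ.le) hh.le
  have hBl : B ≤ Real.sqrt (m * (fluxConst n σ M * Cp) * B) * l := by
    rw [mul_assoc m]
    exact hlow.trans (hd.trans (mul_le_mul_of_nonneg_right hn ENNReal.toReal_nonneg))
  have hfin := le_of_le_sqrt_mul hB0 (by positivity) hBl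
  have hres : ∫ x in K.carrier, ∑ a, ‖fluxResidual S ζh φt x a‖ ^ 2 ≤ v * (n + 1) * Cp * B := by
    refine (setIntegral_le_of_le (c := (n + 1) * (Cp / h ^ (n + 1) * B))
      K.isCompact_carrier.measure_lt_top.ne (ae_of_all _ fun x =>
        Finset.sum_nonneg fun a _ => sq_nonneg _) ?_).trans ?_
    · filter_upwards [hRe, ae_restrict_mem K.measurableSet_carrier] with x hx hxK
      rw [← hsumA, Finset.mul_sum]
      refine Finset.sum_le_sum fun a _ => ?_
      rw [hx a, norm_fluxVec_sq]
      calc ∑ i, R a i x ^ 2 ≤ ∑ _i : Fin (n + 1), A a := Finset.sum_le_sum fun i _ => hRA a i x hxK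
        _ = _ := by simp
    · calc volume.real K.carrier * ((n + 1) * (Cp / h ^ (n + 1) * B))
          ≤ (v * h ^ (n + 1)) * ((n + 1) * (Cp / h ^ (n + 1) * B)) :=
            mul_le_mul_of_nonneg_right K.volume_le (by positivity)
        _ = _ := by field_simp
  calc _ ≤ v * (n + 1) * Cp * B := hres
    _ ≤ v * (n + 1) * Cp * (m * (fluxConst n σ M * Cp) * l ^ 2) :=
        mul_le_mul_of_nonneg_left hfin (by positivity)
    _ = _ := by ring

lemma integrableOn_fluxResidual {R : Idx Gr N → Fin (n + 1) → E (n + 1) → ℝ}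
    (hR : ∀ a i, Continuous (R a i))
    (h : ∀ᵐ x ∂volume.restrict K.carrier, ∀ a, fluxResidual S ζh φt x a = fluxVec (R a) x) :
    IntegrableOn (fun x => ∑ a, ‖fluxResidual S ζh φt x a‖ ^ 2) K.carrier := by
  have hc : IntegrableOn (fun x => ∑ a, ‖fluxVec (R a) x‖ ^ 2) K.carrier :=
    ContinuousOn.integrableOn_compact K.isCompact_carrier (continuous_finsetSum _ fun a _ =>
      (continuous_fluxVec (hR a)).norm.pow 2).continuousOn
  refine hc.congr ?_
  filter_upwards [h] with x hx
  simp only [hx]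

/-- The flux estimator is bounded by the `L^2` norm of the flux residual. -/
lemma etaF_le (hK : DiagBounds S N K) {B : ℝ}
    (h : ∫ x in K.carrier, ∑ a, ‖fluxResidual S ζh φt x a‖ ^ 2 ≤ B)
    (hint : IntegrableOn (fun x => ∑ a, ‖fluxResidual S ζh φt x a‖ ^ 2) K.carrier) :
    etaF S ζh φt K ≤ Real.sqrt (B / diagMin (S.To N) K) := by
  refine Real.sqrt_le_sqrt ?_
  calc ∫ x in K.carrier, ∑ a, ‖fluxResidual S ζh φt x a‖ ^ 2 / S.To N x a a
      ≤ ∫ x in K.carrier, (∑ a, ‖fluxResidual S ζh φt x a‖ ^ 2) / diagMin (S.To N) K := by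
        refine integral_mono_of_nonneg ?_ (hint.div_const _) ?_
        · filter_upwards [hK.odd] with x hx
          exact Finset.sum_nonneg fun a _ =>
            div_nonneg (sq_nonneg _) (hK.odd_pos.le.trans (hx a).1)
        · filter_upwards [hK.odd] with x hx
          rw [Finset.sum_div]
          refine Finset.sum_le_sum fun a _ => ?_
          exact div_le_div_of_nonneg_left (sq_nonneg _) hK.odd_pos (hx a).1
    _ = (∫ x in K.carrier, ∑ a, ‖fluxResidual S ζh φt x a‖ ^ 2) / diagMin (S.To N) K :=
        integral_div _ _
    _ ≤ _ := div_le_div_of_nonneg_right h hK.odd_pos.le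

end

/-! ### The Robin matrix -/

section

open scoped Kronecker

/-- One block of `ℍ`. -/
def hBlock (N : ℕ) : Matrix (Fin N) (Fin N) ℝ :=
  Matrix.of fun i j => if i = j ∨ (i : ℕ) + 1 = (j : ℕ) then 1 else 0

/-- One block of `Γ_e`. -/
def gammaBlock (N : ℕ) : Matrix (Fin N) (Fin N) ℝ :=
  Matrix.of fun i j => alpha (2 * i) * alpha (2 * j) *
    ∫ x in (0 : ℝ)..1, x * (legendreP (2 * i)).eval x * (legendreP (2 * j)).eval x

/-- One block of `Γ̃_e`. -/
def robinBlock (N : ℕ) : Matrix (Fin N) (Fin N) ℝ :=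
  hBlock N * (gammaBlock N)⁻¹ * (hBlock N).transpose

lemma Hmat_eq (G N : ℕ) : Hmat G N = (1 : Matrix (Fin G) (Fin G) ℝ) ⊗ₖ hBlock N := by
  ext ⟨g, i⟩ ⟨g', j⟩
  by_cases h : g = g' <;> simp [Hmat, hBlock, h]

lemma GammaE_eq (G N : ℕ) : GammaE G N = (1 : Matrix (Fin G) (Fin G) ℝ) ⊗ₖ gammaBlock N := by
  ext ⟨g, i⟩ ⟨g', j⟩
  by_cases h : g = g' <;> simp [GammaE, gammaBlock, h]

/-- As a Kronecker product with the identity, the matrix is inverted and factored one block at a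
time, so the constants do not depend on the number of groups. -/
lemma GammaT_eq (G N : ℕ) : GammaT G N = (1 : Matrix (Fin G) (Fin G) ℝ) ⊗ₖ robinBlock N := by
  have h : ((1 : Matrix (Fin G) (Fin G) ℝ) ⊗ₖ hBlock N).transpose =
      (1 : Matrix (Fin G) (Fin G) ℝ) ⊗ₖ (hBlock N).transpose := by
    rw [← Matrix.kroneckerMap_transpose, Matrix.transpose_one]
  rw [GammaT, Hmat_eq, GammaE_eq, Matrix.inv_kronecker, inv_one, h, ← Matrix.mul_kronecker_mul,
    ← Matrix.mul_kronecker_mul, one_mul, one_mul, robinBlock]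

/-- The quadratic form at X is ∫₀¹ x (∑ X_i α_{2i} P_{2i}(x))² dx. -/
lemma posSemidef_gammaBlock (N : ℕ) : (gammaBlock N).PosSemidef := by
  refine Matrix.PosSemidef.of_dotProduct_mulVec_nonneg ?_ fun X => ?_
  · ext i j
    simp only [Matrix.conjTranspose_apply, gammaBlock, Matrix.of_apply, star_trivial]
    rw [mul_comm (alpha (2 * j))]
    congr 1
    exact intervalIntegral.integral_congr fun x _ => by ring
  · set f : Fin N → ℝ → ℝ := fun i x => X i * alpha (2 * i) * (legendreP (2 * i)).eval x with hf
    have hfc : ∀ i, Continuous (f i) := fun i => continuous_const.mul (Polynomial.continuous _)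
    have hc : ∀ i j, Continuous fun x => x * (f i x * f j x) := fun i j =>
      continuous_id.mul ((hfc i).mul (hfc j))
    have h : star X ⬝ᵥ (gammaBlock N).mulVec X = ∫ x in (0 : ℝ)..1, x * (∑ i, f i x) ^ 2 := by
      have e : ∀ x : ℝ, x * (∑ i, f i x) ^ 2 = ∑ i, ∑ j, x * (f i x * f j x) := fun x => by
        rw [sq, Finset.sum_mul_sum]
        simp only [Finset.mul_sum]
      simp only [e]
      rw [intervalIntegral.integral_finsetSum fun i _ => Continuous.intervalIntegrable
        (continuous_finsetSum _ fun j _ => hc i j) _ _]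
      simp only [dotProduct, Matrix.mulVec, star_trivial, Finset.mul_sum]
      refine Finset.sum_congr rfl fun i _ => ?_
      rw [intervalIntegral.integral_finsetSum fun j _ => Continuous.intervalIntegrable
        (hc i j) _ _]
      refine Finset.sum_congr rfl fun j _ => ?_
      simp only [gammaBlock, Matrix.of_apply]
      rw [mul_right_comm, ← mul_assoc, ← mul_assoc, ← intervalIntegral.integral_const_mul]
      refine intervalIntegral.integral_congr fun x _ => ?_
      simp only [hf]
      ring
    rw [h]
    exact intervalIntegral.integral_nonneg zero_le_one fun x hx => mul_nonneg hx.1 (sq_nonneg _)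

lemma posSemidef_robinBlock (N : ℕ) : (robinBlock N).PosSemidef := by
  have := (posSemidef_gammaBlock N).inv.mul_mul_conjTranspose_same (hBlock N)
  rwa [Matrix.conjTranspose_eq_transpose_of_trivial] at this

lemma exists_eq_conjTranspose_mul_self {ι : Type*} [Fintype ι] [DecidableEq ι]
    {A : Matrix ι ι ℝ} (hA : A.PosSemidef) : ∃ R : Matrix ι ι ℝ, A = R.conjTranspose * R := by
  open scoped MatrixOrder in
  exact CStarAlgebra.nonneg_iff_eq_star_mul_self.1 hA.nonneg

/-- The identity also holds for singular matrices, whose `⁻¹` is 0 by convention; invertibility of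
Γ̃_e then never has to be established. -/
lemma nonsing_inv_mul_mul_nonsing_inv {ι : Type*} [Fintype ι] [DecidableEq ι] (A : Matrix ι ι ℝ) :
    A⁻¹ * A * A⁻¹ = A⁻¹ := by
  by_cases h : IsUnit A.det
  · rw [Matrix.nonsing_inv_mul _ h, one_mul]
  · rw [Matrix.nonsing_inv_apply_not_isUnit _ h, mul_zero]

/-- Properties of the inverse of the Robin matrix, with a constant that does not depend on the
number of groups. -/
lemma exists_robin_factor (N : ℕ) : ∃ c : ℝ, 0 < c ∧ ∀ G : ℕ, ∃ R : Matrix (Idx G N) (Idx G N) ℝ,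
    (∀ X, (GammaT G N)⁻¹.mulVec X ⬝ᵥ X = ∑ a, R.mulVec X a ^ 2) ∧
    (∀ X, ∑ a, (GammaT G N)⁻¹.mulVec X a ^ 2 ≤ c * ((GammaT G N)⁻¹.mulVec X ⬝ᵥ X)) ∧
    ∀ X, (GammaT G N).mulVec ((GammaT G N)⁻¹.mulVec X) ⬝ᵥ (GammaT G N)⁻¹.mulVec X =
      (GammaT G N)⁻¹.mulVec X ⬝ᵥ X := by
  obtain ⟨R, hR⟩ := exists_eq_conjTranspose_mul_self (posSemidef_robinBlock N).inv
  rw [Matrix.conjTranspose_eq_transpose_of_trivial] at hR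
  -- The squared Frobenius norm of the factor of a single block; the 1 ensures positivity.
  refine ⟨∑ i, ∑ j, R j i ^ 2 + 1, by positivity, fun G => ⟨1 ⊗ₖ R, ?_⟩⟩
  have hW : (GammaT G N)⁻¹ = ((1 : Matrix (Fin G) (Fin G) ℝ) ⊗ₖ R).transpose * (1 ⊗ₖ R) := by
    rw [GammaT_eq, Matrix.inv_kronecker, inv_one, hR, ← Matrix.kroneckerMap_transpose,
      ← Matrix.mul_kronecker_mul, Matrix.transpose_one, one_mul]
  have h1 : ∀ X, (GammaT G N)⁻¹.mulVec X ⬝ᵥ X =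
      ∑ a, ((1 : Matrix (Fin G) (Fin G) ℝ) ⊗ₖ R).mulVec X a ^ 2 := fun X => by
    rw [hW, ← Matrix.mulVec_mulVec, Matrix.mulVec_transpose, ← Matrix.dotProduct_mulVec]
    simp only [dotProduct, sq]
  refine ⟨h1, fun X => ?_, fun X => ?_⟩
  · rw [h1, hW, ← Matrix.mulVec_mulVec]
    set Y := ((1 : Matrix (Fin G) (Fin G) ℝ) ⊗ₖ R).mulVec X
    have hY : ∀ a : Idx G N, ((1 : Matrix (Fin G) (Fin G) ℝ) ⊗ₖ R).transpose.mulVec Y a =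
        ∑ j, R j a.2 * Y (a.1, j) := by
      rintro ⟨g, i⟩
      simp [Matrix.mulVec, dotProduct, Fintype.sum_prod_type, Matrix.one_apply]
    simp only [hY, Fintype.sum_prod_type]
    rw [Finset.mul_sum]
    refine Finset.sum_le_sum fun g _ => ?_
    calc ∑ i, (∑ j, R j i * Y (g, j)) ^ 2 ≤ ∑ i, (∑ j, R j i ^ 2) * ∑ j, Y (g, j) ^ 2 :=
          Finset.sum_le_sum fun i _ => Finset.sum_mul_sq_le_sq_mul_sq _ _ _
      _ = (∑ i, ∑ j, R j i ^ 2) * ∑ j, Y (g, j) ^ 2 := by rw [Finset.sum_mul]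
      _ ≤ _ := mul_le_mul_of_nonneg_right (by linarith)
          (Finset.sum_nonneg fun j _ => sq_nonneg _)
  · have hsymm : ((GammaT G N)⁻¹).transpose = (GammaT G N)⁻¹ := by
      rw [hW, Matrix.transpose_mul, Matrix.transpose_transpose]
    have hv : ∀ Y, (GammaT G N)⁻¹.mulVec X ⬝ᵥ Y = X ⬝ᵥ (GammaT G N)⁻¹.mulVec Y := fun Y => by
      rw [Matrix.dotProduct_mulVec, ← Matrix.mulVec_transpose, hsymm]
    rw [dotProduct_comm, hv, Matrix.mulVec_mulVec, Matrix.mulVec_mulVec,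
      nonsing_inv_mul_mul_nonsing_inv, dotProduct_comm]

end

/-! ### Geometry of the Robin facets -/

section

variable {n : ℕ}

lemma Cell.subset_carrier_of_mem_facets {d : ℕ} {K : Cell d} {F : Set (E d)} (hF : F ∈ K.facets) :
    F ⊆ K.carrier := by
  cases K with
  | simplex s =>
    simp only [Cell.facets, Finset.mem_image, Finset.mem_univ, true_and] at hF
    obtain ⟨i, rfl⟩ := hF
    exact convexHull_mono (image_subset_range _ _)
  | box e a b hab =>
    simp only [Cell.facets, Finset.mem_union, Finset.mem_image, Finset.mem_univ, true_and] at hF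
    obtain ⟨i, rfl⟩ | ⟨i, rfl⟩ := hF <;> exact fun x hx => hx.1

namespace Frame

variable (Fr : Frame n)

lemma dist_proj_le (x y : E (n + 1)) : dist (Fr.proj x) (Fr.proj y) ≤ dist x y := by
  have h := Fr.o.sum_sq_norm_inner_right (x - y)
  rw [Fin.sum_univ_succ] at h
  rw [dist_eq_norm, dist_eq_norm]
  refine le_of_sq_le_sq ?_ (norm_nonneg _)
  rw [← h, EuclideanSpace.norm_sq_eq]
  have e : ∀ j : Fin n, (Fr.proj x - Fr.proj y) j = inner ℝ (Fr.o j.succ) (x - y) := fun j => by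
    simp [proj, ← inner_sub_right]
  simp only [e]
  linarith [sq_nonneg ‖(inner ℝ (Fr.o 0) (x - y) : ℝ)‖]

lemma contDiff_proj : ContDiff ℝ ∞ Fr.proj := by
  refine (contDiff_euclidean (𝕜 := ℝ)).2 fun j => ?_
  exact contDiff_const.inner ℝ (contDiff_id.sub contDiff_const)

lemma norm_fderiv_proj_le (x : E (n + 1)) : ‖fderiv ℝ Fr.proj x‖ ≤ 1 := by
  have h : LipschitzWith 1 Fr.proj := LipschitzWith.of_dist_le_mul fun x y => by
    simpa using Fr.dist_proj_le x y
  simpa using norm_fderiv_le_of_lipschitz ℝ h (x₀ := x)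

lemma norm_fderiv_comp_proj_le {g : E n → ℝ} (hg : ContDiff ℝ ∞ g) (x : E (n + 1)) :
    ‖fderiv ℝ (fun x => g (Fr.proj x)) x‖ ≤ ‖fderiv ℝ g (Fr.proj x)‖ := by
  have h : HasFDerivAt (fun x => g (Fr.proj x))
      ((fderiv ℝ g (Fr.proj x)).comp (fderiv ℝ Fr.proj x)) x :=
    ((hg.differentiable (by simp)) _).hasFDerivAt.comp x
      ((Fr.contDiff_proj.differentiable (by simp)) x).hasFDerivAt
  rw [h.fderiv]
  refine (ContinuousLinearMap.opNorm_comp_le _ _).trans ?_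
  exact mul_le_of_le_one_right (norm_nonneg _) (Fr.norm_fderiv_proj_le x)

lemma affineSpan_subset_plane {F : Set (E (n + 1))} (hF : F ⊆ Fr.plane) :
    (affineSpan ℝ F : Set (E (n + 1))) ⊆ Fr.plane := fun x hx => by
  refine affineSpan_induction (p := fun x => x ∈ Fr.plane) hx (fun y hy => hF hy) ?_
  intro c u v w hu hv hw
  have h1 : (inner ℝ Fr.ν (u - v) : ℝ) = 0 := by
    rw [← Fr.height_eq_of hv]
    exact hu
  change Fr.height (c • (u - v) + w) = 0
  rw [add_comm, Fr.height_add, real_inner_smul_right, h1, mul_zero, add_zero]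
  exact hw

end Frame

variable {K : Cell (n + 1)} {F : Set (E (n + 1))} {Fr : Frame n} {r : ℝ}

lemma IsFacetFrame.dist_z_le (H : IsFacetFrame K F Fr r) (hr : 0 < r) {x : E (n + 1)}
    (hx : x ∈ K.carrier) : dist x Fr.z ≤ K.diam :=
  K.dist_le_diam hx (H.subset_carrier (H.z_mem hr))

/-- The point at height r/2 above the base point is in K, and the affine span of F stays in the
hyperplane, which gives the lower bound. The base point belongs to F, which gives the upper one. -/
lemma IsFacetFrame.altitude_bounds (H : IsFacetFrame K F Fr r) (hr : 0 < r) :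
    r / 2 ≤ K.altitude F ∧ K.altitude F ≤ K.diam := by
  have hz := H.z_mem hr
  have hzs : Fr.z ∈ (affineSpan ℝ F : Set (E (n + 1))) := subset_affineSpan ℝ F hz
  have hle : ∀ x ∈ K.carrier, Metric.infDist x (affineSpan ℝ F : Set (E (n + 1))) ≤ K.diam :=
    fun x hx => (Metric.infDist_le_dist_of_mem hzs).trans (H.dist_z_le hr hx)
  have hheight : Fr.height (Fr.z + (r / 2) • Fr.ν) = r / 2 := by
    rw [Fr.height_add, Fr.height_z, real_inner_smul_right, Fr.inner_ν_ν, mul_one, zero_add]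
  have hy : Fr.z + (r / 2) • Fr.ν ∈ K.carrier := by
    refine H.ball_subset ⟨?_, ?_⟩
    · rw [Metric.mem_ball, dist_eq_norm, add_sub_cancel_left, norm_smul, Fr.norm_ν, mul_one,
        Real.norm_of_nonneg (by positivity)]
      linarith
    · change 0 ≤ Fr.height _
      rw [hheight]
      positivity
  constructor
  · refine le_trans ?_ (le_csSup ⟨K.diam, ?_⟩ (mem_image_of_mem _ hy))
    · refine (Metric.le_infDist ⟨_, hzs⟩).2 fun w hw => ?_
      have hwp := Fr.affineSpan_subset_plane H.subset_plane hw
      have h := real_inner_le_norm Fr.ν (Fr.z + (r / 2) • Fr.ν - w)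
      rwa [Fr.norm_ν, one_mul, ← Fr.height_eq_of hwp, hheight, ← dist_eq_norm] at h
    · rintro _ ⟨x, hx, rfl⟩
      exact hle x hx
  · refine csSup_le ⟨_, mem_image_of_mem _ hy⟩ ?_
    rintro _ ⟨x, hx, rfl⟩
    exact hle x hx

variable {D : MixedDomain (n + 1)} {T : Mesh D.Ω}

lemma IsFacetFrame.mem_flatSet_of_mem_ball (H : IsFacetFrame K F Fr r)
    (hK : interior K.carrier ⊆ D.Ω) (hF : F ⊆ closure D.ΓV) {x : E (n + 1)}
    (hx : x ∈ Fr.plane) (hxr : x ∈ Metric.ball Fr.z r) : x ∈ flatSet D.Ω K Fr := by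
  refine mem_flatSet D.isOpen D.lipschitz hK H (hF.trans D.closure_ΓV_subset) hx
    (sub_pos.2 (Metric.mem_ball.1 hxr)) ?_
  exact (inter_subset_inter_left _ (Metric.ball_subset_ball' (by linarith))).trans H.ball_subset

variable {Gr N : ℕ} {S : CrossSections (n + 1) Gr}

lemma mem_robinFacets : F ∈ robinFacets D K ↔ F ∈ K.facets ∧ F ⊆ closure D.ΓV := by
  simp only [robinFacets, Finset.mem_filter]

/-- Only one facet contributes to the norm of a localised boundary flux. -/
lemma IsFacetFrame.robinNormSq_eq (H : IsFacetFrame K F Fr r) (hKT : K ∈ T.cells)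
    (hFK : F ∈ K.facets) (hF : F ⊆ closure D.ΓV)
    {g : E (n + 1) → Idx Gr N → ℝ} (hg : ∀ x, x ∉ F → g x = 0)
    (hg' : ∀ x, x ∉ Metric.ball Fr.z r → g x = 0) :
    robinNormSq T S g = diagMax (S.To N) K * K.altitude F *
      ∫ x in F, (GammaT Gr N).mulVec (g x) ⬝ᵥ g x ∂surf (n + 1) := by
  -- The data are nonzero only at flat points of F, and these belong to no other facet of K and to
  -- no other cell.
  have hflat : ∀ x, g x ≠ 0 → x ∈ F ∧ x ∈ flatSet D.Ω K Fr := fun x hx => by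
    have h1 : x ∈ F := by_contra fun h => hx (hg x h)
    exact ⟨h1, H.mem_flatSet_of_mem_ball (T.interior_subset K hKT) hF (H.subset_plane h1)
      (by_contra fun h => hx (hg' x h))⟩
  have hzero : ∀ K' F', (∀ x ∈ F', g x = 0) → diagMax (S.To N) K' * K'.altitude F' *
      ∫ x in F', (GammaT Gr N).mulVec (g x) ⬝ᵥ g x ∂surf (n + 1) = 0 := fun K' F' h => by
    rw [setIntegral_eq_zero_of_forall_eq_zero fun x hx => by rw [h x hx, dotProduct_zero], mul_zero]
  rw [robinNormSq, Finset.sum_eq_single_of_mem K hKT, Finset.sum_eq_single_of_mem F]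
  · exact mem_robinFacets.2 ⟨hFK, hF⟩
  · intro F' hF' hne
    refine hzero K F' fun x hx => by_contra fun h => hne ?_
    obtain ⟨J, _, _, Frs, h1, h2, -⟩ := K.exists_frames le_rfl
    obtain ⟨j, rfl⟩ := h2 F' (mem_robinFacets.1 hF').1
    exact H.eq_of_mem (h1 j) (hflat x h).1 hx (hflat x h).2
  · intro K' hK' hne
    refine Finset.sum_eq_zero fun F' hF' => hzero K' F' fun x hx => by_contra fun h => ?_
    exact T.notMem_of_mem_flatSet hKT hK' hne.symm (hflat x h).2
      (Cell.subset_carrier_of_mem_facets (mem_robinFacets.1 hF').1 hx)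

variable {ζh : MixedField (n + 1) (Idx Gr N)} {φt : ScalarField (n + 1) (Idx Gr N)}

/-- In the chart of a facet, the boundary residual is a polynomial. -/
lemma exists_polyFun_robinResidual {k mφ : ℕ} (H : IsFacetFrame K F Fr r) (hr : 0 < r)
    (G : FluxGeometry D K F Fr) (hζh : ζh.InX D)
    (hp : ∀ a, K.InRTN k (fun x => ζh.p x a)) (hφt : φt.InV D)
    (hφ : ∀ a, K.IsPolyOn mφ (fun x => φt.val x a)) :
    ∃ e : Idx Gr N → E n → ℝ, (∀ a, e a ∈ PolyFun n ((n + 1) * (k + 1) + mφ)) ∧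
      ∀ᵐ y ∂volume.restrict (Fr.chart ⁻¹' F), ∀ a, robinResidual ζh φt (Fr.chart y) a = e a y := by
  choose P hP hPe using fun a => (hp a).exists_polyFun
  choose Φ hΦ hΦe using fun a => (hφ a).exists_polyFun
  have hFU := ae_mem_flatSet D.isOpen D.lipschitz G.interior_subset H hr
    (G.subset_closure.trans D.closure_ΓV_subset)
  have h1 : ∀ a, ∀ᵐ x ∂(surf (n + 1)).restrict F, φt.tr x a = Φ a x := fun a =>
    IsTrace.ae_eq G H hFU (hφt.memLp_val a) (hφt.memLp_grad a) (hφt.weakGrad a) (hφt.memLp_tr a)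
      (hφt.trace a) (PolyFun.contDiff (hΦ a)) (hΦe a)
  have h2 : ∀ a, ∀ᵐ x ∂(surf (n + 1)).restrict F, ζh.nt x a = fluxNormal Fr (P a) x := fun a =>
    IsNormalTrace.ae_eq G H hFU (hζh.memLp_div a) (hζh.weakDiv a) (hζh.memLp_nt a)
      (hζh.trace_V a) (fun i => PolyFun.contDiff (hP a i)) (hPe a)
  have hchart : ∀ i, (fun y : E n => Fr.chart y i) ∈ PolyFun n 1 := fun i => by
    have : (fun y : E n => Fr.chart y i) =
        fun y => Fr.z i + ∑ j, (Fr.o (Fin.succ j)) i * y j := by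
      funext y
      simp [Frame.chart, mul_comm]
    rw [this]
    exact PolyFun.add (PolyFun.const _) (PolyFun.sum fun j _ =>
      PolyFun.const_mul _ (PolyFun.coord j))
  refine ⟨fun a y => (∑ b, Hmat Gr N a b * Φ b (Fr.chart y)) -
    ∑ b, GammaT Gr N a b * fluxNormal Fr (P b) (Fr.chart y), fun a => ?_, ?_⟩
  · refine PolyFun.sub (PolyFun.sum fun b _ => PolyFun.const_mul _ ?_)
      (PolyFun.sum fun b _ => PolyFun.const_mul _ ?_)
    · exact PolyFun.mono (by omega) (PolyFun.comp (hΦ b) hchart)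
    · have : (fun y => fluxNormal Fr (P b) (Fr.chart y)) =
          fun y => (-1) * ∑ i, Fr.ν i * P b i (Fr.chart y) := by
        funext y
        simp [fluxNormal]
      rw [this]
      exact PolyFun.const_mul _ (PolyFun.sum fun i _ => PolyFun.const_mul _
        (PolyFun.mono (by omega) (PolyFun.comp (hP b i) hchart)))
  · have h3 := (ae_all_iff.2 h1).and (ae_all_iff.2 h2)
    rw [Fr.surf_restrict H.subset_plane,
      Fr.isClosedEmbedding_chart.measurableEmbedding.ae_map_iff] at h3
    filter_upwards [h3] with y hy a
    simp only [robinResidual, Pi.sub_apply, Matrix.mulVec, dotProduct, hy.1, hy.2]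

end

/-! ### Efficiency of the boundary estimator -/

section

/-- Young's inequality; the weight t is left free so that one of the two terms can later be
absorbed. -/
lemma sum_inner_le {ι H : Type*} [Fintype ι] [NormedAddCommGroup H] [InnerProductSpace ℝ H]
    (u v : ι → H) {t : ℝ} (ht : 0 < t) :
    ∑ a, (inner ℝ (u a) (v a) : ℝ) ≤ t / 2 * ∑ a, ‖u a‖ ^ 2 + (2 * t)⁻¹ * ∑ a, ‖v a‖ ^ 2 := by
  rw [Finset.mul_sum, Finset.mul_sum, ← Finset.sum_add_distrib]
  refine Finset.sum_le_sum fun a _ => (real_inner_le_norm _ _).trans ?_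
  have h : t / 2 * ‖u a‖ ^ 2 + (2 * t)⁻¹ * ‖v a‖ ^ 2 - ‖u a‖ * ‖v a‖ =
      (2 * t)⁻¹ * (t * ‖u a‖ - ‖v a‖) ^ 2 := by
    field_simp
    ring
  have : 0 ≤ (2 * t)⁻¹ * (t * ‖u a‖ - ‖v a‖) ^ 2 := by positivity
  linarith

/-- Absorption of the norms of the test flux in the efficiency of the boundary estimator. -/
lemma le_of_sqrt_add {B m h c₁ c₂ c₃ l I : ℝ} (hB : 0 ≤ B) (hm : 0 ≤ m) (hh : 0 < h)
    (hc₁ : 0 ≤ c₁) (hc₂ : 0 < c₂) (h1 : B ≤ Real.sqrt (m * h * c₁ * B) * l + I)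
    (h2 : I ≤ 2 * c₂ * h / 2 * (c₃ * m * l ^ 2) + (2 * (2 * c₂ * h))⁻¹ * (c₂ * h * B)) :
    B ≤ 2 * (c₁ + c₂ * c₃) * (m * h * l ^ 2) := by
  -- The weight 2c₂h is chosen so that the volume term costs B/4. The norm of the test flux costs
  -- another B/4, and the remaining half of B explains the factor 2.
  have e1 : (2 * (2 * c₂ * h))⁻¹ * (c₂ * h * B) = B / 4 := by
    field_simp
    ring
  have e2 : Real.sqrt (m * h * c₁ * B) * l ≤ B / 4 + m * h * c₁ * l ^ 2 := by
    have hs : Real.sqrt (m * h * c₁ * B) = Real.sqrt (m * h * c₁) * Real.sqrt B :=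
      Real.sqrt_mul (by positivity) _
    have h3 := Real.sq_sqrt (show 0 ≤ m * h * c₁ by positivity)
    have h4 := Real.sq_sqrt hB
    rw [hs]
    nlinarith [sq_nonneg (Real.sqrt B / 2 - Real.sqrt (m * h * c₁) * l)]
  nlinarith

variable {n : ℕ}

/-- The Robin residual is bounded by the local norm. -/
theorem exists_etaBC_bound (n mo k mφ : ℕ) {κ : ℝ} (hκ : 0 < κ) (N : ℕ) : ∃ C : ℝ, 0 < C ∧
    ∀ {Gr : ℕ} {D : MixedDomain (n + 1)} {S : CrossSections (n + 1) Gr} {T : Mesh D.Ω}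
      {K : Cell (n + 1)} {Sf : E (n + 1) → Idx Gr N → ℝ} {ζ ζh : MixedField (n + 1) (Idx Gr N)}
      {φt : ScalarField (n + 1) (Idx Gr N)}, BoundedCoeffs D S N → IsSolution D S Sf ζ →
      ζh.InX D → φt.InV D → K ∈ T.cells → DiagBounds S N K → κ ≤ K.shapeRegularity →
      (∀ a b, K.IsPolyOn mo (fun x => S.To N x a b)) →
      (∀ a, K.InRTN k (fun x => ζh.p x a)) →
      (∀ a, K.IsPolyOn mφ (fun x => φt.val x a)) →
      localNorm D S T K (ζ - reconstruction ζh φt) ≠ ⊤ → ∀ F ∈ K.facets, F ⊆ closure D.ΓV →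
      etaBC S ζh φt K F ≤ C * (localNorm D S T K (ζ - reconstruction ζh φt)).toReal := by
  set σ := innerRatio n κ / 2 with hσd
  have hρ : 0 < innerRatio n κ := innerRatio_pos hκ
  have hσ : 0 < σ := by positivity
  obtain ⟨M, -, hcut⟩ := exists_isCutoff (n + 1)
  obtain ⟨Cp, hCp, Hp⟩ := PolyFun.exists_bound n ((n + 1) * (k + 1) + mφ) (half_pos hσ)
  obtain ⟨Cf, hCf, Hf⟩ := exists_fluxResidual_bound n mo k mφ hκ
  obtain ⟨cN, hcN, HN⟩ := exists_robin_factor N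
  set v := unitBallVolume (n + 1)
  have hv : 0 < v := unitBallVolume_pos _
  set w := unitBallVolume n
  have hw : 0 < w := unitBallVolume_pos _
  have hfc := fluxConst_pos n σ M
  -- c₁ collects the volume and Robin parts of the squared norm of the test flux, and c₂ its plain
  -- L² norm on K.
  set c₁ := fluxConst n σ M * (Cp * cN) + w * Cp with hc₁
  set c₂ := v * (n + 1) * (Cp * cN) with hc₂
  have hc₁0 : 0 < c₁ := by positivity
  have hc₂0 : 0 < c₂ := by positivity
  refine ⟨Real.sqrt (w * Cp * (2 * (c₁ + c₂ * Cf)) / σ), by positivity, ?_⟩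
  intro Gr D S T K Sf ζ ζh φt hS hζ hζh hφt hKT hK hκK ho hp hφ hL F hFK hFV
  obtain ⟨Rm, HN1, HN2, HN3⟩ := HN Gr
  have hKΩ := T.interior_subset K hKT
  have hh := K.diam_pos
  set h := K.diam
  have hres := Hf hS hζ hζh hφt hKT hK hκK ho hp hφ hL
  set l := (localNorm D S T K (ζ - reconstruction ζh φt)).toReal with hl
  have hl0 : 0 ≤ l := ENNReal.toReal_nonneg
  set m := diagMax (S.To N) K with hmd
  have hm : 0 < m := hK.odd_pos.trans_le hK.odd_le
  obtain ⟨J, _, _, Frs, hJ1, hJ2, -⟩ := K.exists_frames hκK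
  obtain ⟨j, hj⟩ := hJ2 F hFK
  set Fr := Frs j
  have H : IsFacetFrame K F Fr (innerRatio n κ * h) := by
    rw [hj]
    exact hJ1 j
  have hr : 0 < innerRatio n κ * h := by positivity
  have G : FluxGeometry D K F Fr := ⟨hKΩ, H.subset_plane, hFV, H.isCompact⟩
  obtain ⟨halt1, halt2⟩ := H.altitude_bounds hr
  obtain ⟨R, hR, hRe⟩ := exists_polyFun_fluxResidual hKΩ ho hp hφt hφ
  obtain ⟨e, he, hee⟩ := exists_polyFun_robinResidual H hr G hζh hp hφt hφ
  obtain ⟨b, hb⟩ := hcut Fr.z (σ * h) (by positivity)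
  have hballr : Metric.closedBall Fr.z (σ * h) ⊆ Metric.ball Fr.z (innerRatio n κ * h) :=
    Metric.closedBall_subset_ball (by
      rw [hσd]; exact mul_lt_mul_of_pos_right (half_lt_self hρ) hh)
  -- ε = Γ̃_e⁻¹ e is the desired normal component. With the factor Rm of Γ̃_e⁻¹, the density
  -- (Γ̃_e⁻¹e, e) is the sum of the squares of the polynomials g, so the inverse inequality applies
  -- to it term by term.
  set ε : Idx Gr N → E n → ℝ := fun a y => (GammaT Gr N)⁻¹.mulVec (fun c => e c y) a with hε
  have hεP : ∀ a, ε a ∈ PolyFun n ((n + 1) * (k + 1) + mφ) := fun a =>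
    PolyFun.sum fun c _ => PolyFun.const_mul _ (he c)
  have hεc : ∀ a, ContDiff ℝ ∞ (ε a) := fun a => PolyFun.contDiff (hεP a)
  set g : Idx Gr N → E n → ℝ := fun a y => Rm.mulVec (fun c => e c y) a with hg
  have hgP : ∀ a, g a ∈ PolyFun n ((n + 1) * (k + 1) + mφ) := fun a =>
    PolyFun.sum fun c _ => PolyFun.const_mul _ (he c)
  have hgc : ∀ a, Continuous fun y => g a y ^ 2 := fun a =>
    (PolyFun.contDiff (hgP a)).continuous.pow 2
  set Q : E n → ℝ := fun y => ∑ a, g a y ^ 2 with hQ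
  have hQc : Continuous Q := continuous_finsetSum _ fun a _ => hgc a
  have hQ0 : ∀ y, 0 ≤ Q y := fun y => Finset.sum_nonneg fun a _ => sq_nonneg _
  have hQe : ∀ y, (fun a => ε a y) ⬝ᵥ (fun a => e a y) = Q y := fun y => HN1 fun c => e c y
  set B := ∫ y in Metric.ball (0 : E n) (σ / 2 * h), Q y with hB
  have hB0 : 0 ≤ B := integral_nonneg hQ0
  have hint : ∀ {f : E n → ℝ}, Continuous f → IntegrableOn f (Metric.ball (0 : E n) (σ / 2 * h)) :=
    fun hf => (hf.continuousOn.integrableOn_compact (isCompact_closedBall 0 _)).mono_set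
      Metric.ball_subset_closedBall
  -- the test flux
  set P : Idx Gr N → Fin (n + 1) → E (n + 1) → ℝ :=
    fun a i x => Fr.ν i * ε a (Fr.proj x) with hP
  have hPc : ∀ a i, ContDiff ℝ ∞ (P a i) := fun a i =>
    contDiff_const.mul ((hεc a).comp Fr.contDiff_proj)
  have hsupp : ∀ a i, tsupport (cutFlux b (P a) i) ⊆ Metric.closedBall Fr.z (σ * h) := fun a i =>
    tsupport_cutFlux_subset.trans hb.tsupport_subset
  have hf : ∀ a, IsTestFlux K F Fr (cutFlux b (P a)) := fun a =>
    { contDiff := fun i => (hb.contDiff.mul (hPc a i)).neg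
      compact := fun i => (isCompact_closedBall Fr.z (σ * h)).of_isClosed_subset
        (isClosed_tsupport _) (hsupp a i)
      half := fun i x hx => ⟨fun hxK => H.carrier_subset hxK, fun hxH =>
        H.ball_subset ⟨hballr (hsupp a i hx), hxH⟩⟩
      facet := fun i x hx hxp => H.facet_eq ▸ ⟨H.ball_subset
        ⟨hballr (hsupp a i hx), Fr.plane_subset_half hxp⟩, hxp⟩ }
  -- The sign of the outer normal and the sign in `cutFlux` cancel.
  have hnormal : ∀ a x, fluxNormal Fr (cutFlux b (P a)) x = b x * ε a (Fr.proj x) := fun a x => by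
    have e1 : ∀ i, Fr.ν i * cutFlux b (P a) i x =
        -(Fr.ν i * Fr.ν i * (b x * ε a (Fr.proj x))) := fun i => by
      simp only [cutFlux, hP]
      ring
    simp only [fluxNormal, e1, Finset.sum_neg_distrib, neg_neg, ← Finset.sum_mul, sum_ν_sq, one_mul]
  -- pointwise bounds
  set A : Idx Gr N → ℝ := fun a =>
    Cp / h ^ n * ∫ y in Metric.ball (0 : E n) (σ / 2 * h), ε a y ^ 2 with hA
  have hproj : ∀ x ∈ K.carrier, dist (Fr.proj x) 0 ≤ h := fun x hx => by
    rw [dist_zero_right]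
    refine (Fr.norm_proj_le x).trans ?_
    rw [← dist_eq_norm]
    exact H.dist_z_le hr hx
  have hν : ∀ i, Fr.ν i ^ 2 ≤ 1 := fun i => by
    have := sq_le_sum_sq (fun i => Fr.ν i) i
    simp only [sq] at this ⊢
    rwa [sum_ν_sq] at this
  have hPA : ∀ a i, ∀ x ∈ K.carrier, P a i x ^ 2 ≤ A a := fun a i x hx => by
    refine le_trans ?_ (Hp _ (hεP a) 0 h hh _ (hproj x hx)).1
    rw [hP]
    dsimp only
    rw [mul_pow]
    exact mul_le_of_le_one_left (sq_nonneg _) (hν i)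
  have hPA' : ∀ a i, ∀ x ∈ K.carrier, h ^ 2 * ‖fderiv ℝ (P a i) x‖ ^ 2 ≤ A a := fun a i x hx => by
    refine le_trans ?_ (Hp _ (hεP a) 0 h hh _ (hproj x hx)).2
    refine mul_le_mul_of_nonneg_left (pow_le_pow_left₀ (norm_nonneg _) ?_ 2) (sq_nonneg h)
    refine le_trans ?_ (Fr.norm_fderiv_comp_proj_le (hεc a) x)
    have hd : HasFDerivAt (P a i) (Fr.ν i • fderiv ℝ (fun x => ε a (Fr.proj x)) x) x :=
      ((((hεc a).comp Fr.contDiff_proj).differentiable (by simp)) x).hasFDerivAt.const_mul _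
    rw [hd.fderiv, norm_smul, Real.norm_eq_abs]
    exact mul_le_of_le_one_left (norm_nonneg _) ((sq_le_one_iff_abs_le_one _).1 (hν i))
  -- The factor cN, the source of the dependence on N, compares |Γ̃_e⁻¹e|² with (Γ̃_e⁻¹e, e).
  have hsumA : ∑ a, A a ≤ Cp / h ^ n * (cN * B) := by
    rw [hA, ← Finset.mul_sum, ← setIntegral_ball_sum (g := fun a y => ε a y ^ 2) fun a =>
      (hεc a).continuous.pow 2, hB,
      ← integral_const_mul cN]
    refine mul_le_mul_of_nonneg_left (integral_mono
      (hint (continuous_finsetSum _ fun a _ => (hεc a).continuous.pow 2))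
      (hint (continuous_const.mul hQc)) fun y => ?_) (by positivity)
    have := HN2 fun c => e c y
    rwa [HN1] at this
  -- the boundary integrals
  have hFball : Fr.chart ⁻¹' F ⊆ Metric.closedBall 0 h := fun y hy => by
    rw [Metric.mem_closedBall, ← Fr.isometry_chart.dist_eq, Fr.chart_zero]
    exact H.dist_z_le hr (H.subset_carrier hy)
  have hFc : IsCompact (Fr.chart ⁻¹' F) := Fr.isClosedEmbedding_chart.isCompact_preimage H.isCompact
  have hI : ∫ y in Fr.chart ⁻¹' F, Q y ≤ w * Cp * B := by
    refine (setIntegral_le_of_le (c := Cp / h ^ n * B) hFc.measure_lt_top.ne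
      (ae_of_all _ hQ0) ?_).trans ?_
    · filter_upwards [ae_restrict_mem hFc.measurableSet] with y hy
      rw [hB, hQ, setIntegral_ball_sum hgc, Finset.mul_sum]
      exact Finset.sum_le_sum fun a _ => (Hp _ (hgP a) 0 h hh _ (hFball hy)).1
    · have h1 : volume.real (Fr.chart ⁻¹' F) ≤ w * h ^ n := by
        rw [← volume_closedBall n 0 hh.le]
        exact measureReal_mono hFball measure_closedBall_lt_top.ne
      calc _ ≤ w * h ^ n * (Cp / h ^ n * B) := mul_le_mul_of_nonneg_right h1 (by positivity)
        _ = _ := by field_simp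
  have hQF : IntegrableOn Q (Fr.chart ⁻¹' F) := hQc.continuousOn.integrableOn_compact hFc
  have hbc : Continuous fun y => b (Fr.chart y) :=
    hb.contDiff.continuous.comp Fr.isometry_chart.continuous
  -- the norm of the test flux
  have hrob : robinNormSq T S (testField K F Fr fun a => cutFlux b (P a)).nt ≤
      m * h * (w * Cp * B) := by
    have hz : ∀ x, x ∉ Metric.ball Fr.z (innerRatio n κ * h) → b x = 0 := fun x hx =>
      image_eq_zero_of_notMem_tsupport (f := b) fun hx' => hx (hballr (hb.tsupport_subset hx'))
    have hz1 : ∀ x, x ∉ F → (testField K F Fr fun a => cutFlux b (P a)).nt x = 0 :=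
      fun x hx => funext fun a => indicator_of_notMem hx _
    have hz2 : ∀ x, x ∉ Metric.ball Fr.z (innerRatio n κ * h) →
        (testField K F Fr fun a => cutFlux b (P a)).nt x = 0 := fun x hx => funext fun a => by
      simp only [testField, indicator, hnormal, hz x hx, zero_mul, ite_self, Pi.zero_apply]
    rw [H.robinNormSq_eq hKT hFK hFV hz1 hz2]
    have e1 : ∫ x in F, (GammaT Gr N).mulVec ((testField K F Fr fun a => cutFlux b (P a)).nt x) ⬝ᵥ
        (testField K F Fr fun a => cutFlux b (P a)).nt x ∂surf (n + 1) =
        ∫ y in Fr.chart ⁻¹' F, b (Fr.chart y) ^ 2 * Q y := by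
      rw [Fr.setIntegral_surf H.subset_plane]
      refine setIntegral_congr_fun hFc.measurableSet fun y hy => ?_
      have e2 : (testField K F Fr fun a => cutFlux b (P a)).nt (Fr.chart y) =
          b (Fr.chart y) • (GammaT Gr N)⁻¹.mulVec fun c => e c y := by
        funext a
        simp only [testField, indicator_of_mem (show Fr.chart y ∈ F from hy), hnormal,
          Fr.proj_chart, hε, Pi.smul_apply, smul_eq_mul]
      -- The weight Γ̃_e in the norm meets Γ̃_e⁻¹e twice and leaves (Γ̃_e⁻¹e, e): the Robin part of
      -- the norm has the same density as the estimator.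
      rw [e2, Matrix.mulVec_smul, smul_dotProduct, dotProduct_smul, HN3, HN1]
      simp only [smul_eq_mul, hQ, hg]
      ring
    have e3 : ∫ y in Fr.chart ⁻¹' F, b (Fr.chart y) ^ 2 * Q y ≤ w * Cp * B := by
      refine le_trans (integral_mono ((((hbc.pow 2).mul hQc).continuousOn).integrableOn_compact hFc)
        hQF fun y => ?_) hI
      exact mul_le_of_le_one_left (hQ0 y) (pow_le_one₀ (hb.nonneg _) (hb.le_one _))
    rw [e1]
    have h0 : 0 ≤ w * Cp * B := by positivity
    calc m * K.altitude F * ∫ y in Fr.chart ⁻¹' F, b (Fr.chart y) ^ 2 * Q y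
        ≤ m * K.altitude F * (w * Cp * B) :=
          mul_le_mul_of_nonneg_left e3 (mul_nonneg hm.le ((half_pos hr).le.trans halt1))
      _ ≤ _ := mul_le_mul_of_nonneg_right (mul_le_mul_of_nonneg_left halt2 hm.le) h0
  have hn : normS D S T (testField K F Fr fun a => cutFlux b (P a)) ≤
      Real.sqrt (m * h * c₁ * B) := by
    refine (normS_testField_le (F := F) (Fr := Fr) hKT hK hb hσ hPc hPA hPA').trans
      (Real.sqrt_le_sqrt ?_)
    calc m * (fluxConst n σ M * h ^ (n + 1) * ∑ a, A a) + _
        ≤ m * (fluxConst n σ M * h ^ (n + 1) * (Cp / h ^ n * (cN * B))) +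
          m * h * (w * Cp * B) := by
          refine add_le_add (mul_le_mul_of_nonneg_left ?_ hm.le) hrob
          exact mul_le_mul_of_nonneg_left hsumA (by positivity)
      _ = _ := by
          rw [hc₁, pow_succ]
          field_simp
  -- the residual
  have hd := (testField_inXLocal G hKT (hκ.trans_le hκK) hf).dForm_le hL
  rw [dForm_flux hS hζ hζh hφt G hf] at hd
  have hlow : B ≤ ∫ x in F, robinResidual ζh φt x ⬝ᵥ
      (fun a => fluxNormal Fr (cutFlux b (P a)) x) ∂surf (n + 1) := by
    have e1 : ∫ x in F, robinResidual ζh φt x ⬝ᵥ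
        (fun a => fluxNormal Fr (cutFlux b (P a)) x) ∂surf (n + 1) =
        ∫ y in Fr.chart ⁻¹' F, b (Fr.chart y) * Q y := by
      rw [Fr.setIntegral_surf H.subset_plane]
      refine integral_congr_ae ?_
      filter_upwards [hee] with y hy
      rw [show robinResidual ζh φt (Fr.chart y) = fun a => e a y from funext hy, ← hQe,
        dotProduct_comm]
      simp only [hnormal, Fr.proj_chart, dotProduct, Finset.mul_sum, mul_assoc]
    have e2 : B = ∫ y in Metric.ball (0 : E n) (σ / 2 * h), b (Fr.chart y) * Q y := by
      rw [hB]
      refine setIntegral_congr_fun measurableSet_ball fun y hy => ?_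
      have : Fr.chart y ∈ Metric.ball Fr.z (σ * h / 2) := by
        rw [← mul_div_right_comm, ← Fr.preimage_ball_chart] at hy
        exact hy
      rw [hb.eq_one _ this, one_mul]
    rw [e1, e2]
    refine setIntegral_mono_set ((hbc.mul hQc).continuousOn.integrableOn_compact hFc)
      (ae_of_all _ fun y => mul_nonneg (hb.nonneg _) (hQ0 y)) (LE.le.eventuallyLE ?_)
    refine (Metric.ball_subset_ball ?_).trans H.ball_chart_subset
    refine mul_le_mul_of_nonneg_right ?_ hh.le
    rw [hσd]
    linarith
  set I := ∫ x in K.carrier, ∑ a, (inner ℝ ((∑ b, S.To N x a b • ζh.p x b) +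
    ∑ b, Hmat Gr N a b • φt.grad x b) (fluxVec (cutFlux b (P a)) x) : ℝ) with hId
  have hBI : B ≤ Real.sqrt (m * h * c₁ * B) * l + I := by
    have := hd.trans (mul_le_mul_of_nonneg_right hn hl0)
    linarith
  have hq : ∫ x in K.carrier, ∑ a, ‖fluxVec (cutFlux b (P a)) x‖ ^ 2 ≤ c₂ * h * B := by
    refine (setIntegral_le_of_le (c := (n + 1) * ∑ a, A a)
      K.isCompact_carrier.measure_lt_top.ne (ae_of_all _ fun x =>
        Finset.sum_nonneg fun a _ => sq_nonneg _) ?_).trans ?_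
    · filter_upwards [ae_restrict_mem K.measurableSet_carrier] with x hxK
      rw [Finset.mul_sum]
      exact Finset.sum_le_sum fun a _ => hb.norm_fluxVec_le fun i => hPA a i x hxK
    · calc volume.real K.carrier * ((n + 1) * ∑ a, A a)
          ≤ (v * h ^ (n + 1)) * ((n + 1) * (Cp / h ^ n * (cN * B))) := by
            refine mul_le_mul K.volume_le (mul_le_mul_of_nonneg_left hsumA (by positivity)) ?_
              (by positivity)
            exact mul_nonneg (by positivity) (Finset.sum_nonneg fun a _ =>
              mul_nonneg (by positivity) (integral_nonneg fun y => sq_nonneg _))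
        _ = _ := by
          rw [hc₂, pow_succ]
          field_simp
  -- The volume term pairs the test flux with the flux residual, already bounded by the local norm.
  have hIle : I ≤ 2 * c₂ * h / 2 * (Cf * m * l ^ 2) + (2 * (2 * c₂ * h))⁻¹ * (c₂ * h * B) := by
    have ht : 0 < 2 * c₂ * h := by positivity
    have hqi : IntegrableOn (fun x => ∑ a, ‖fluxVec (cutFlux b (P a)) x‖ ^ 2) K.carrier :=
      ContinuousOn.integrableOn_compact K.isCompact_carrier (continuous_finsetSum _ fun a _ =>
        (continuous_fluxVec fun i => ((hf a).contDiff i).continuous).norm.pow 2).continuousOn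
    have hri := integrableOn_fluxResidual (fun a i => (PolyFun.contDiff (hR a i)).continuous) hRe
    have hIi : IntegrableOn (fun x => ∑ a, (inner ℝ ((∑ b, S.To N x a b • ζh.p x b) +
        ∑ b, Hmat Gr N a b • φt.grad x b) (fluxVec (cutFlux b (P a)) x) : ℝ)) K.carrier := by
      have hc : IntegrableOn (fun x => ∑ a, (inner ℝ (fluxVec (R a) x)
          (fluxVec (cutFlux b (P a)) x) : ℝ)) K.carrier :=
        ContinuousOn.integrableOn_compact K.isCompact_carrier (continuous_finsetSum _ fun a _ =>
          (continuous_fluxVec fun i => (PolyFun.contDiff (hR a i)).continuous).inner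
          (continuous_fluxVec fun i => ((hf a).contDiff i).continuous)).continuousOn
      refine hc.congr ?_
      filter_upwards [hRe] with x hx
      simp only [fluxResidual] at hx
      simp only [hx]
    calc I ≤ ∫ x in K.carrier, (2 * c₂ * h / 2 * (∑ a, ‖fluxResidual S ζh φt x a‖ ^ 2) +
          (2 * (2 * c₂ * h))⁻¹ * ∑ a, ‖fluxVec (cutFlux b (P a)) x‖ ^ 2) := by
          refine integral_mono_ae hIi ((hri.const_mul _).add (hqi.const_mul _)) ?_
          exact ae_of_all _ fun x => sum_inner_le _ _ ht
      _ = 2 * c₂ * h / 2 * (∫ x in K.carrier, ∑ a, ‖fluxResidual S ζh φt x a‖ ^ 2) +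
          (2 * (2 * c₂ * h))⁻¹ * ∫ x in K.carrier, ∑ a, ‖fluxVec (cutFlux b (P a)) x‖ ^ 2 := by
          rw [integral_add (hri.const_mul _) (hqi.const_mul _), integral_const_mul,
            integral_const_mul]
      _ ≤ _ := add_le_add (mul_le_mul_of_nonneg_left hres (by positivity))
          (mul_le_mul_of_nonneg_left hq (by positivity))
  have hBfin := le_of_sqrt_add hB0 hm.le hh hc₁0.le hc₂0 hBI hIle
  -- the estimator
  have heta : ∫ x in F, (GammaT Gr N)⁻¹.mulVec (robinResidual ζh φt x) ⬝ᵥ robinResidual ζh φt x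
      ∂surf (n + 1) = ∫ y in Fr.chart ⁻¹' F, Q y := by
    rw [Fr.setIntegral_surf H.subset_plane]
    refine integral_congr_ae ?_
    filter_upwards [hee] with y hy
    rw [show robinResidual ζh φt (Fr.chart y) = fun a => e a y from funext hy]
    exact hQe y
  have halt0 : 0 < K.altitude F := (half_pos hr).trans_le halt1
  rw [etaBC, heta, ← Real.sqrt_inv, ← Real.sqrt_mul (by positivity)]
  refine (Real.sqrt_le_sqrt ?_).trans (le_of_eq ?_) (b := Real.sqrt
    (w * Cp * (2 * (c₁ + c₂ * Cf)) / σ * l ^ 2))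
  -- The bound for B carries a factor h where the estimator is scaled by the altitude; comparing the
  -- two costs 1/σ.
  · have hσa : σ * h ≤ K.altitude F := by
      refine le_trans (le_of_eq ?_) halt1
      rw [hσd]
      ring
    rw [inv_mul_le_iff₀ (by positivity)]
    calc ∫ y in Fr.chart ⁻¹' F, Q y ≤ w * Cp * (2 * (c₁ + c₂ * Cf) * (m * h * l ^ 2)) :=
          hI.trans (mul_le_mul_of_nonneg_left hBfin (by positivity))
      _ = m * (σ * h) * (w * Cp * (2 * (c₁ + c₂ * Cf)) / σ * l ^ 2) := by field_simp
      _ ≤ _ := mul_le_mul_of_nonneg_right (mul_le_mul_of_nonneg_left hσa hm.le) (by positivity)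
  · rw [Real.sqrt_mul (by positivity), Real.sqrt_sq hl0]

end

/-! ### Local efficiency -/

/-- An infinite local norm makes the right-hand side infinite because c > 0, so only the finite case
needs an estimate. -/
lemma ofReal_le_ofReal_mul {x c : ℝ} (hc : 0 < c) {L : ℝ≥0∞} (h : L ≠ ⊤ → x ≤ c * L.toReal) :
    ENNReal.ofReal x ≤ ENNReal.ofReal c * L := by
  by_cases hL : L = ⊤
  · rw [hL, ENNReal.mul_top (ENNReal.ofReal_pos.2 hc).ne']
    exact le_top
  · calc ENNReal.ofReal x ≤ ENNReal.ofReal (c * L.toReal) := ENNReal.ofReal_le_ofReal (h hL)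
      _ = _ := by rw [ENNReal.ofReal_mul hc.le, ENNReal.ofReal_toReal hL]

/-- The dimension is written n + 1 so that hyperplanes are modelled on `E n`. -/
theorem local_efficiency (n k mo me mφ : ℕ) (κ : ℝ) (hκ : 0 < κ) :
    ∃ c : ℝ, 0 < c ∧ ∃ C : ℝ, 0 < C ∧ ∀ N : ℕ, 2 ≤ N → ∃ C' : ℝ, 0 < C' ∧ ∀ G : ℕ, 2 ≤ G →
    ∀ (D : MixedDomain (n + 1)) (T : Mesh D.Ω) (S : CrossSections (n + 1) G)
      (Sf : E (n + 1) → Idx G N → ℝ) (ζ ζh : MixedField (n + 1) (Idx G N))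
      (φt : ScalarField (n + 1) (Idx G N)),
      S.Admissible N D.Ω →
      IsSolution D S Sf ζ →
      IsDiscreteSolution D S T k Sf ζh →
      φt.InV D →
      (∀ K ∈ T.cells, ∀ a b, K.IsPolyOn mo (fun x => S.To N x a b)) →
      (∀ K ∈ T.cells, ∀ a b, K.IsPolyOn me (fun x => S.Te N x a b)) →
      (∀ K ∈ T.cells, ∀ a, K.InScalarSpace k (fun x => Sf x a)) →
      (∀ K ∈ T.cells, ∀ a, K.IsPolyOn mφ (fun x => φt.val x a)) →
      ∀ K ∈ T.cells, κ ≤ K.shapeRegularity →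
        ENNReal.ofReal (etaR S Sf ζh φt K) ≤
            ENNReal.ofReal (c * Real.sqrt (diagMax (S.Te N) K / diagMin (S.Te N) K)) *
              localNorm D S T K (ζ - reconstruction ζh φt) ∧
        ENNReal.ofReal (etaF S ζh φt K) ≤
            ENNReal.ofReal (C * Real.sqrt (diagMax (S.To N) K / diagMin (S.To N) K)) *
              localNorm D S T K (ζ - reconstruction ζh φt) ∧
        ∀ F ∈ K.facets, F ⊆ closure D.ΓV →
          ENNReal.ofReal (etaBC S ζh φt K F) ≤
            ENNReal.ofReal C' * localNorm D S T K (ζ - reconstruction ζh φt) := by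
  obtain ⟨Cf, hCf, Hf⟩ := exists_fluxResidual_bound n mo k mφ hκ
  refine ⟨1, one_pos, Real.sqrt Cf, Real.sqrt_pos.2 hCf, fun N hN => ?_⟩
  obtain ⟨C', hC', HC'⟩ := exists_etaBC_bound n mo k mφ hκ N
  refine ⟨C', hC', ?_⟩
  intro G hG D T S Sf ζ ζh φt hadm hζ hζh hφt ho he hSf hφ K hKT hκK
  have : Nonempty (Idx G N) := ⟨(⟨0, by omega⟩, ⟨0, by omega⟩)⟩
  have hKΩ := T.interior_subset K hKT
  have hK := hadm.diagBounds hKΩ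
  have hS := boundedCoeffs_of_isPolyOn ho he
  have hSf2 : ∀ a, MemLp (fun x => Sf x a) 2 (volume.restrict D.Ω) := fun a =>
    memLp_of_inScalarSpace fun K hK => hSf K hK a
  have hX := hζh.1.1
  have hp : ∀ a, K.InRTN k (fun x => ζh.p x a) := fun a => (hζh.1.2 K hKT a).1
  have hmo := hK.odd_pos.trans_le hK.odd_le
  have hme := hK.even_pos.trans_le hK.even_le
  refine ⟨ofReal_le_ofReal_mul (by have := hK.even_pos; positivity) fun hL => ?_,
    ofReal_le_ofReal_mul (by have := hK.odd_pos; positivity) fun hL => ?_, fun F hF hFV =>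
      ofReal_le_ofReal_mul hC' fun hL => ?_⟩
  · refine (etaR_le hS hSf2 hζ hX hφt hKT hK hL).trans ?_
    -- The ratio of the coefficient bounds is at least 1, so its square root may be inserted for
    -- free.
    refine le_mul_of_one_le_left ENNReal.toReal_nonneg ?_
    rw [one_mul, Real.one_le_sqrt, one_le_div hK.even_pos]
    exact hK.even_le
  · obtain ⟨R, hR, hRe⟩ := exists_polyFun_fluxResidual hKΩ (ho K hKT) hp hφt (hφ K hKT)
    refine (etaF_le hK (Hf hS hζ hX hφt hKT hK hκK (ho K hKT) hp (hφ K hKT) hL)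
      (integrableOn_fluxResidual (fun a i => (PolyFun.contDiff (hR a i)).continuous) hRe)).trans
      (le_of_eq ?_)
    rw [mul_div_right_comm, mul_div_assoc, Real.sqrt_mul (by have := hK.odd_pos; positivity),
      Real.sqrt_mul hCf.le, Real.sqrt_sq ENNReal.toReal_nonneg]
  · exact HC' hS hζ hX hφt hKT hK hκK (ho K hKT) hp (hφ K hKT) hL F hF hFV

end SPN

end

theorem mainTheorem9 (d : ℕ) (hd : d = 2 ∨ d = 3) (k mo me mφ : ℕ) (κ : ℝ) (hκ : 0 < κ) :
    -- `c`, `C` depend only on the polynomial degrees, on `d` and on `κ`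
    ∃ c : ℝ, 0 < c ∧ ∃ C : ℝ, 0 < C ∧ ∀ N : ℕ, 2 ≤ N →
    -- `C'` may depend moreover on the angular order `N`, through the matrix `Γ̃_e`
    ∃ C' : ℝ, 0 < C' ∧ ∀ G : ℕ, 2 ≤ G →
    ∀ (D : MixedDomain d) (T : Mesh D.Ω) (S : CrossSections d G) (Sf : E d → Idx G N → ℝ)
      (ζ ζh : MixedField d (Idx G N)) (φt : ScalarField d (Idx G N)),
      S.Admissible N D.Ω →
      IsSolution D S Sf ζ →
      IsDiscreteSolution D S T k Sf ζh →
      φt.InV D →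
      -- piecewise polynomial data and reconstruction
      (∀ K ∈ T.cells, ∀ a b, K.IsPolyOn mo (fun x => S.To N x a b)) →
      (∀ K ∈ T.cells, ∀ a b, K.IsPolyOn me (fun x => S.Te N x a b)) →
      (∀ K ∈ T.cells, ∀ a, K.InScalarSpace k (fun x => Sf x a)) →
      (∀ K ∈ T.cells, ∀ a, K.IsPolyOn mφ (fun x => φt.val x a)) →
      ∀ K ∈ T.cells, κ ≤ K.shapeRegularity →
        ENNReal.ofReal (etaR S Sf ζh φt K) ≤
            ENNReal.ofReal (c * Real.sqrt (diagMax (S.Te N) K / diagMin (S.Te N) K)) *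
              localNorm D S T K (ζ - reconstruction ζh φt) ∧
        ENNReal.ofReal (etaF S ζh φt K) ≤
            ENNReal.ofReal (C * Real.sqrt (diagMax (S.To N) K / diagMin (S.To N) K)) *
              localNorm D S T K (ζ - reconstruction ζh φt) ∧
        ∀ F ∈ K.facets, F ⊆ closure D.ΓV →
          ENNReal.ofReal (etaBC S ζh φt K F) ≤
            ENNReal.ofReal C' * localNorm D S T K (ζ - reconstruction ζh φt) := by
  obtain rfl | rfl := hd
  · exact local_efficiency 1 k mo me mφ κ hκ
  · exact local_efficiency 2 k mo me mφ κ hκ
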